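/- Let $\mathbb{F}_\epsilon$ be a finite field with $\hat q$ elements, and put $A_\epsilon=\mathbb{F}_\epsilon[[z]]$ and $Q_\epsilon=\mathbb{F}_\epsilon((z))$. Let $R$ be a complete discrete valuation ring with maximal ideal $\mathfrak{m}_R$, fraction field $K$ and separable closure $K^{\rm sep}$ of $K$. Let $\gamma\colon A_\epsilon\hookrightarrow R$ be an injective ring homomorphism with $\zeta:=\gamma(z)\in\mathfrak{m}_R$; it makes $R$, $K$ and $K^{\rm sep}$ into $\mathbb{F}_\epsilon$-algebras. For an $\mathbb{F}_\epsilon$-algebra $B$ let $\hat\sigma$ be the endomorphism of $B[[z]]$ and of $B((z)):=B[[z]][\tfrac1z]$ given by $z\mapsto z$ and $b\mapsto b^{\hat q}$ for $b\in B$. A \emph{local shtuka} over $R$ is a pair $\underline{\hat M}=(\hat M,\tau_{\hat M})$ consisting of a finite free $R[[z]]$-module $\hat M$ and an isomorphism $\tau_{\hat M}\colon\hat\sigma^*\hat M[\tfrac1{z-\zeta}]\to\hat M[\tfrac1{z-\zeta}]$ of $R[[z]][\tfrac1{z-\zeta}]$-modules, where $\hat\sigma^*\hat M:=\hat M\otimes_{R[[z]],\hat\sigma}R[[z]]$;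 write $\hat\sigma_{\hat M}^*m:=m\otimes1$. Since $z-\zeta$ is a unit in $K^{\rm sep}[[z]]$, the map $m\mapsto\tau_{\hat M}(\hat\sigma^*_{\hat M}m)$ extends $\hat\sigma$-semilinearly to $\hat M\otimes_{R[[z]]}K^{\rm sep}[[z]]$ and to $\hat M\otimes_{R[[z]]}K^{\rm sep}((z))$. Set \[ \check T_\epsilon\underline{\hat M}:=\{m\in\hat M\otimes_{R[[z]]}K^{\rm sep}[[z]]\colon\tau_{\hat M}(\hat\sigma_{\hat M}^*m)=m\},\qquad \check V_\epsilon\underline{\hat M}:=\{m\in\hat M\otimes_{R[[z]]}K^{\rm sep}((z))\colon\tau_{\hat M}(\hat\sigma_{\hat M}^*m)=m\}. \] These are modules over $A_\epsilon$ and $Q_\epsilon$, respectively, on which $\operatorname{Gal}(K^{\rm sep}/K)$ acts through the coefficients in $K^{\rm sep}$. Let $\underline{\hat M}$ be a local shtuka over $R$. A \emph{local shtuka $\underline{\hat M}'\subset\underline{\hat M}[\tfrac1z]$ of full rank} is a local shtuka $(\hat M',\tau_{\hat M'})$ over $R$ such that $\hat M'$ is an $R[[z]]$-submodule of $\hat M[\tfrac1z]$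 with $\operatorname{rk}\hat M'=\operatorname{rk}\hat M$ and such that $\tau_{\hat M'}$ is compatible with $\tau_{\hat M}$, i.e. $\tau_{\hat M'}(\hat\sigma^*_{\hat M'}m)=\tau_{\hat M}(\hat\sigma^*_{\hat M}m)$ in $\hat M[\tfrac1z][\tfrac1{z-\zeta}]$ for all $m\in\hat M'$. The inclusion then induces a map $\check T_\epsilon\underline{\hat M}'\to\check V_\epsilon\underline{\hat M}$, and we identify $\check T_\epsilon\underline{\hat M}'$ with its image. A \emph{full $A_\epsilon$-lattice} in $\check V_\epsilon\underline{\hat M}$ is a finitely generated $A_\epsilon$-submodule which spans $\check V_\epsilon\underline{\hat M}$ over $Q_\epsilon$. Then the map \[ \{\text{local shtukas }\underline{\hat M}'\subset\underline{\hat M}[\tfrac1z]\text{ over }R\text{ of full rank}\}\longrightarrow\{\operatorname{Gal}(K^{\rm sep}/K)\text{-stable full }A_\epsilon\text{-lattices }\check T'\subset\check V_\epsilon\underline{\hat M}\},\qquad \underline{\hat M}'\longmapsto\check T_\epsilon\underline{\hat M}' \] is well defined and a bijection. -/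

import Mathlib

set_option linter.unusedSectionVars false

open scoped TensorProduct PowerSeries LaurentSeries

noncomputable section

namespace LocSht

/-! ### Coefficientwise maps on Laurent series

`A⟦X⟧` is `A[[z]]` and `A⸨X⸩` is `A((z)) = A[[z]][1/z]`; the variable `X` plays the role of `z`. -/

/-- The ring homomorphism `A((z)) → B((z))` which applies `f : A → B` to every coefficient. -/
def laurentMap {A B : Type*} [CommRing A] [CommRing B] (f : A →+* B) : A⸨X⸩ →+* B⸨X⸩ where
  toFun x := HahnSeries.map x f
  map_one' := HahnSeries.map_one (f.toMonoidWithZeroHom)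
  map_zero' := HahnSeries.map_zero (f : A →+ B).toZeroHom
  map_add' _ _ := HahnSeries.map_add (f : A →+ B)
  map_mul' _ _ := HahnSeries.map_mul (f : A →ₙ+* B)

@[simp]
theorem laurentMap_coeff {A B : Type*} [CommRing A] [CommRing B] (f : A →+* B) (x : A⸨X⸩)
    (n : ℤ) : (laurentMap f x).coeff n = f (x.coeff n) := rfl

theorem laurentMap_ofPowerSeries {A B : Type*} [CommRing A] [CommRing B] (f : A →+* B)
    (a : A⟦X⟧) : laurentMap f (HahnSeries.ofPowerSeries ℤ A a) =
      HahnSeries.ofPowerSeries ℤ B (PowerSeries.map f a) := by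
  ext n
  rw [laurentMap_coeff]
  change f ((a : A⸨X⸩).coeff n) = ((PowerSeries.map f a : B⟦X⟧) : B⸨X⸩).coeff n
  rw [PowerSeries.coeff_coe, PowerSeries.coeff_coe]
  split_ifs <;> simp

/-- `B((z))` is an algebra over `A((z))` whenever `B` is an algebra over `A`. -/
instance (priority := low) laurentAlgebra (A B : Type*) [CommRing A] [CommRing B] [Algebra A B] :
    Algebra A⸨X⸩ B⸨X⸩ := (laurentMap (algebraMap A B)).toAlgebra

theorem smulComm_of_algebra (A B C : Type*) [CommRing A] [CommRing B] [CommRing C]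
    [Algebra A C] [Algebra B C] : SMulCommClass A B C :=
  ⟨fun a b c => by simp only [Algebra.smul_def, mul_left_comm]⟩

instance smulComm₁ (A B C : Type*) [CommRing A] [CommRing B] [CommRing C]
    [Algebra A C] [Algebra B C] : SMulCommClass A⟦X⟧ B⟦X⟧ C⟦X⟧ :=
  smulComm_of_algebra _ _ _

instance smulComm₂ (A B C : Type*) [CommRing A] [CommRing B] [CommRing C]
    [Algebra A C] [Algebra B C] : SMulCommClass A⟦X⟧ B⟦X⟧ C⸨X⸩ :=
  smulComm_of_algebra _ _ _

instance smulComm₃ (A B C : Type*) [CommRing A] [CommRing B] [CommRing C]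
    [Algebra A C] [Algebra B C] : SMulCommClass A⟦X⟧ B⸨X⸩ C⸨X⸩ :=
  smulComm_of_algebra _ _ _

instance tower₁ (A B C : Type*) [CommRing A] [CommRing B] [CommRing C]
    [Algebra A B] [Algebra B C] [Algebra A C] [IsScalarTower A B C] :
    IsScalarTower A⟦X⟧ B⟦X⟧ C⟦X⟧ := by
  refine IsScalarTower.of_algebraMap_eq fun a => ?_
  change PowerSeries.map (algebraMap A C) a =
    PowerSeries.map (algebraMap B C) (PowerSeries.map (algebraMap A B) a)
  ext n
  simp [IsScalarTower.algebraMap_apply A B C]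

instance tower₂ (A B C : Type*) [CommRing A] [CommRing B] [CommRing C]
    [Algebra A B] [Algebra B C] [Algebra A C] [IsScalarTower A B C] :
    IsScalarTower A⟦X⟧ B⟦X⟧ C⸨X⸩ := by
  refine IsScalarTower.of_algebraMap_eq fun a => ?_
  change HahnSeries.ofPowerSeries ℤ C (algebraMap A⟦X⟧ C⟦X⟧ a) =
    HahnSeries.ofPowerSeries ℤ C (algebraMap B⟦X⟧ C⟦X⟧ (algebraMap A⟦X⟧ B⟦X⟧ a))
  rw [← IsScalarTower.algebraMap_apply]

instance tower₃ (A C : Type*) [CommRing A] [CommRing C] [Algebra A C] :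
    IsScalarTower A⟦X⟧ A⸨X⸩ C⸨X⸩ := by
  refine IsScalarTower.of_algebraMap_eq fun a => ?_
  exact (laurentMap_ofPowerSeries (algebraMap A C) a).symm

/-! ### The endomorphism `σ̂` -/

section Frobenius

variable (F : Type*) [Field F] [Fintype F]

/-- The endomorphism `σ̂` of `A[[z]]` with `σ̂(z) = z` and `σ̂(b) = b ^ q̂` for `b ∈ A`, where
`q̂ = #F` and `A` is an algebra over the finite field `F`. -/
def hatSigma (A : Type*) [CommRing A] [Algebra F A] : A⟦X⟧ →+* A⟦X⟧ :=
  PowerSeries.map (FiniteField.frobeniusAlgHom F A : A →+* A)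

/-- The endomorphism `σ̂` of `A((z))`: the `q̂`-Frobenius applied to all coefficients. -/
def hatSigmaLaurent (A : Type*) [CommRing A] [Algebra F A] : A⸨X⸩ →+* A⸨X⸩ :=
  laurentMap (FiniteField.frobeniusAlgHom F A : A →+* A)

/-- An `R[[z]]`-algebra `C` with an endomorphism `σ̂` that extends the endomorphism `σ̂` of
`R[[z]]`. It is used for `R((z))`, `L[[z]]` and `L((z))` with `L` a field containing `R`. -/
class HatSigmaAlgebra (R C : Type*) [CommRing R] [Algebra F R] [CommRing C]
    [Algebra R⟦X⟧ C] where
  sigma : C →+* C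
  sigma_algebraMap : ∀ a : R⟦X⟧,
    sigma (algebraMap R⟦X⟧ C a) = algebraMap R⟦X⟧ C (hatSigma F R a)

theorem hatSigma_map {R A : Type*} [CommRing R] [CommRing A] [Algebra F R] [Algebra F A]
    [Algebra R A] (a : R⟦X⟧) :
    hatSigma F A (PowerSeries.map (algebraMap R A) a) =
      PowerSeries.map (algebraMap R A) (hatSigma F R a) := by
  ext n
  simp [hatSigma]

theorem hatSigma_const {A : Type*} [CommRing A] [Algebra F A] (a : F⟦X⟧) :
    hatSigma F A (PowerSeries.map (algebraMap F A) a) = PowerSeries.map (algebraMap F A) a := by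
  ext n
  simp [hatSigma]

theorem hatSigmaLaurent_const {A : Type*} [CommRing A] [Algebra F A] (a : F⸨X⸩) :
    hatSigmaLaurent F A (laurentMap (algebraMap F A) a) = laurentMap (algebraMap F A) a := by
  ext n
  simp [hatSigmaLaurent]

instance sigmaLaurentSelf (R : Type*) [CommRing R] [Algebra F R] :
    HatSigmaAlgebra F R R⸨X⸩ where
  sigma := hatSigmaLaurent F R
  sigma_algebraMap a := laurentMap_ofPowerSeries _ a

instance sigmaPower (R L : Type*) [CommRing R] [Algebra F R] [Field L] [Algebra F L]
    [Algebra R L] : HatSigmaAlgebra F R L⟦X⟧ where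
  sigma := hatSigma F L
  sigma_algebraMap a := hatSigma_map F a

instance sigmaLaurent (R L : Type*) [CommRing R] [Algebra F R] [Field L] [Algebra F L]
    [Algebra R L] : HatSigmaAlgebra F R L⸨X⸩ where
  sigma := hatSigmaLaurent F L
  sigma_algebraMap a := by
    change hatSigmaLaurent F L (HahnSeries.ofPowerSeries ℤ L
        (PowerSeries.map (algebraMap R L) a)) = HahnSeries.ofPowerSeries ℤ L
        (PowerSeries.map (algebraMap R L) (hatSigma F R a))
    rw [hatSigmaLaurent, laurentMap_ofPowerSeries, ← hatSigma_map]
    rfl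

end Frobenius

/-! ### Local shtukas

Throughout `F` is the finite field `𝔽_ε`, `A_ε` is `F[[z]]` and `Q_ε` is `F((z))`. A local
homomorphism `γ : A_ε → R` is the same as an `F`-algebra structure on `R` together with the element
`ζ = γ(z)` of the maximal ideal of the complete local ring `R`; it is injective if and only if
`ζ ≠ 0` (for `R` a domain). -/

section Shtuka

variable (F : Type*) [Field F] [Fintype F] {R : Type*} [CommRing R] [Algebra F R]

/-- The ring `R[[z]]`, regarded as an algebra over `R[[z]]` through `σ̂`. -/
@[nolint unusedArguments]
def Twist (_F : Type*) (R : Type*) [CommRing R] : Type _ := R⟦X⟧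

instance (R : Type*) [CommRing R] : CommRing (Twist F R) :=
  inferInstanceAs (CommRing R⟦X⟧)

instance (R : Type*) [CommRing R] [Algebra F R] : Algebra R⟦X⟧ (Twist F R) :=
  (hatSigma F R : R⟦X⟧ →+* R⟦X⟧).toAlgebra

/-- `σ̂^* M = R[[z]] ⊗_{σ̂, R[[z]]} M`. -/
def HatSigmaPullback (M : Type*) [AddCommGroup M] [Module R⟦X⟧ M] : Type _ :=
  Twist F R ⊗[R⟦X⟧] M

variable (M : Type*) [AddCommGroup M] [Module R⟦X⟧ M]

instance : AddCommGroup (HatSigmaPullback F (R := R) M) :=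
  inferInstanceAs (AddCommGroup (Twist F R ⊗[R⟦X⟧] M))

/-- The `R[[z]]`-module structure of `σ̂^* M` is the one by multiplication on the factor
`R[[z]]`. -/
instance : Module R⟦X⟧ (HatSigmaPullback F (R := R) M) :=
  inferInstanceAs (Module (Twist F R) (Twist F R ⊗[R⟦X⟧] M))

variable {M}

/-- The natural `σ̂`-semilinear map `M → σ̂^* M`, `m ↦ 1 ⊗ m`. -/
def toPullback : M →ₛₗ[hatSigma F R] HatSigmaPullback F (R := R) M where
  toFun m := (1 : Twist F R) ⊗ₜ[R⟦X⟧] m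
  map_add' x y := TensorProduct.tmul_add _ _ _
  map_smul' a m := by
    change (1 : Twist F R) ⊗ₜ[R⟦X⟧] (a • m) =
      (show Twist F R from hatSigma F R a) • ((1 : Twist F R) ⊗ₜ[R⟦X⟧] m)
    rw [TensorProduct.smul_tmul', ← TensorProduct.smul_tmul, Algebra.smul_def, smul_eq_mul]
    rfl

/-- The ring `R[[z]][1/(z - ζ)]`. -/
abbrev AwayRing (ζ : R) : Type _ :=
  Localization.Away (PowerSeries.X - PowerSeries.C ζ : R⟦X⟧)

/-- `M[1/(z - ζ)]`. -/
abbrev AwayModule (ζ : R) (M : Type*) [AddCommGroup M] [Module R⟦X⟧ M] : Type _ :=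
  AwayRing ζ ⊗[R⟦X⟧] M

/-- A local `σ̂`-shtuka over `R` with underlying `R[[z]]`-module `M`: the module `M` is finite free
and `tau` is an isomorphism `σ̂^*M[1/(z - ζ)] → M[1/(z - ζ)]`. -/
structure LocalShtuka (ζ : R) (M : Type*) [AddCommGroup M] [Module R⟦X⟧ M] where
  free : Module.Free R⟦X⟧ M
  finite : Module.Finite R⟦X⟧ M
  tau : AwayModule ζ (HatSigmaPullback F (R := R) M) ≃ₗ[AwayRing ζ] AwayModule ζ M

namespace LocalShtuka

variable {F} {ζ : R} (P : LocalShtuka F ζ M)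

/-- The `σ̂`-semilinear map `M → M[1/(z - ζ)]`, `m ↦ τ(σ̂^* m)`. -/
def phi : M →ₛₗ[hatSigma F R] AwayModule ζ M where
  toFun m := P.tau ((1 : AwayRing ζ) ⊗ₜ[R⟦X⟧] toPullback F m)
  map_add' x y := by rw [map_add, TensorProduct.tmul_add, map_add]
  map_smul' a m := by
    rw [LinearMap.map_smulₛₗ, TensorProduct.tmul_smul, ← algebraMap_smul (AwayRing ζ),
      map_smul, algebraMap_smul]

/-- For an `R[[z]]`-algebra `C` with endomorphism `σ̂`, the `σ̂`-semilinear extension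
`M ⊗ C → (M ⊗ C)[1/(z - ζ)]`, `m ↦ τ(σ̂^* m)`. On pure tensors it sends `c ⊗ m` to
`σ̂(c) · τ(σ̂^* m)`. -/
def phiExt (C : Type*) [CommRing C] [Algebra R⟦X⟧ C] [HatSigmaAlgebra F R C] :
    C ⊗[R⟦X⟧] M →ₛₗ[hatSigma F R] AwayModule ζ (C ⊗[R⟦X⟧] M) :=
  TensorProduct.lift <| LinearMap.mk₂'ₛₗ (hatSigma F R) (hatSigma F R)
    (fun c m => LinearMap.lTensor (AwayRing ζ)
      (TensorProduct.mk R⟦X⟧ C M (HatSigmaAlgebra.sigma F R c)) (P.phi m))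
    (fun c c' m => by
      rw [map_add, map_add, LinearMap.lTensor_add, LinearMap.add_apply])
    (fun a c m => by
      rw [Algebra.smul_def, map_mul, HatSigmaAlgebra.sigma_algebraMap, ← Algebra.smul_def,
        map_smul, LinearMap.lTensor_smul, LinearMap.smul_apply])
    (fun c m m' => by rw [map_add, map_add])
    (fun a c m => by rw [LinearMap.map_smulₛₗ, map_smul])

theorem phiExt_tmul (C : Type*) [CommRing C] [Algebra R⟦X⟧ C] [HatSigmaAlgebra F R C] (c : C)
    (m : M) : P.phiExt C (c ⊗ₜ m) = LinearMap.lTensor (AwayRing ζ)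
      (TensorProduct.mk R⟦X⟧ C M (HatSigmaAlgebra.sigma F R c)) (P.phi m) := rfl

/-- The canonical map `M → M[1/(z - ζ)]`. -/
abbrev toAway (ζ : R) (M : Type*) [AddCommGroup M] [Module R⟦X⟧ M] :
    M →ₗ[R⟦X⟧] AwayModule ζ M :=
  TensorProduct.mk R⟦X⟧ (AwayRing ζ) M 1

theorem lTensor_toAway {M' : Type*} [AddCommGroup M'] [Module R⟦X⟧ M'] (f : M →ₗ[R⟦X⟧] M')
    (x : M) : LinearMap.lTensor (AwayRing ζ) f (toAway ζ M x) = toAway ζ M' (f x) := rfl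

/-- Functoriality of `phiExt` in the coefficient algebra. -/
theorem phiExt_rTensor {C C' : Type*} [CommRing C] [Algebra R⟦X⟧ C] [HatSigmaAlgebra F R C]
    [CommRing C'] [Algebra R⟦X⟧ C'] [HatSigmaAlgebra F R C'] (f f' : C →ₗ[R⟦X⟧] C')
    (hf : ∀ c, HatSigmaAlgebra.sigma F R (f c) = f' (HatSigmaAlgebra.sigma F R c))
    (x : C ⊗[R⟦X⟧] M) : P.phiExt C' (f.rTensor M x) =
      (f'.rTensor M).lTensor (AwayRing ζ) (P.phiExt C x) := by
  induction x with
  | zero => simp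
  | add x y hx hy => simp only [map_add, hx, hy]
  | tmul c m =>
    rw [LinearMap.rTensor_tmul, phiExt_tmul, phiExt_tmul, hf, ← LinearMap.lTensor_comp_apply]
    rfl

/-! ### Tate modules -/

section Tate

variable (L : Type*) [Field L] [Algebra F L] [Algebra R L] [IsScalarTower F R L]

/-- The (dual) Tate module `Ť_ε M = {m ∈ M ⊗ L[[z]] : τ(σ̂^* m) = m}` as a module over
`A_ε = F[[z]]`, where `L = K^sep`. The equation is an equation in `(M ⊗ L[[z]])[1/(z - ζ)]`; this
is the same as `M ⊗ L[[z]]` because `z - ζ` is a unit of `L[[z]]` for `ζ ≠ 0`. -/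
def tateModule : Submodule F⟦X⟧ (L⟦X⟧ ⊗[R⟦X⟧] M) where
  carrier := {x | P.phiExt L⟦X⟧ x = toAway ζ _ x}
  zero_mem' := by simp
  add_mem' {x y} hx hy := by
    change _ = _ at hx hy
    change _ = _
    rw [map_add, map_add, hx, hy]
  smul_mem' a x hx := by
    change _ = _ at hx
    change _ = _
    have h : hatSigma F R (algebraMap F⟦X⟧ R⟦X⟧ a) = algebraMap F⟦X⟧ R⟦X⟧ a :=
      hatSigma_const F a
    rw [← algebraMap_smul R⟦X⟧ a x, LinearMap.map_smulₛₗ, h, map_smul, hx]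

theorem laurent_smul_eq (a : F⸨X⸩) (x : L⸨X⸩ ⊗[R⟦X⟧] M) :
    a • x = (LinearMap.mulLeft R⟦X⟧ (algebraMap F⸨X⸩ L⸨X⸩ a)).rTensor M x := by
  induction x with
  | zero => simp
  | add x y hx hy => simp only [map_add, smul_add, hx, hy]
  | tmul c m => simp [TensorProduct.smul_tmul', Algebra.smul_def]

/-- The rational (dual) Tate module `V̌_ε M = {m ∈ M ⊗ L((z)) : τ(σ̂^* m) = m}` as a vector space
over `Q_ε = F((z))`, where `L = K^sep`. The equation is an equation in
`(M ⊗ L((z)))[1/(z - ζ)] = M ⊗ L((z))`. -/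
def rationalTateModule : Submodule F⸨X⸩ (L⸨X⸩ ⊗[R⟦X⟧] M) where
  carrier := {x | P.phiExt L⸨X⸩ x = toAway ζ _ x}
  zero_mem' := by simp
  add_mem' {x y} hx hy := by
    change _ = _ at hx hy
    change _ = _
    rw [map_add, map_add, hx, hy]
  smul_mem' a x hx := by
    change _ = _ at hx
    change _ = _
    rw [laurent_smul_eq, phiExt_rTensor P _ (LinearMap.mulLeft R⟦X⟧ (algebraMap F⸨X⸩ L⸨X⸩ a)),
      hx, lTensor_toAway]
    intro c
    rw [LinearMap.mulLeft_apply, LinearMap.mulLeft_apply, map_mul]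
    congr 1
    exact hatSigmaLaurent_const F a

theorem mem_rationalTateModule {x : L⸨X⸩ ⊗[R⟦X⟧] M} :
    x ∈ P.rationalTateModule L ↔ P.phiExt L⸨X⸩ x = toAway ζ _ x := Iff.rfl

/-! ### The Galois action -/

section Galois

variable {L} (K : Type*) [Field K] [Algebra R K] [Algebra K L] [IsScalarTower R K L]

/-- An automorphism `g` of `L` over `K` acting on the coefficients of Laurent series, as a map
which is linear over `R[[z]]`. -/
def galLaurent (g : L ≃ₐ[K] L) : L⸨X⸩ →ₗ[R⟦X⟧] L⸨X⸩ where
  toFun := laurentMap (g : L →+* L)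
  map_add' := map_add _
  map_smul' a x := by
    rw [Algebra.smul_def, map_mul, Algebra.smul_def]
    congr 1
    change laurentMap _ (HahnSeries.ofPowerSeries ℤ L (PowerSeries.map (algebraMap R L) a)) =
      HahnSeries.ofPowerSeries ℤ L (PowerSeries.map (algebraMap R L) a)
    rw [laurentMap_ofPowerSeries]
    congr 1
    ext n
    simp [IsScalarTower.algebraMap_apply R K L]

variable {K}

theorem galLaurent_coeff (g : L ≃ₐ[K] L) (x : L⸨X⸩) (n : ℤ) :
    (galLaurent (R := R) K g x).coeff n = g (x.coeff n) := rfl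

variable [Algebra F K] [IsScalarTower F K L]

theorem gal_smul (g : L ≃ₐ[K] L) (a : F⸨X⸩) (x : L⸨X⸩ ⊗[R⟦X⟧] M) :
    (galLaurent K g).rTensor M (a • x) = a • (galLaurent K g).rTensor M x := by
  rw [laurent_smul_eq, laurent_smul_eq, ← LinearMap.rTensor_comp_apply,
    ← LinearMap.rTensor_comp_apply]
  congr 2
  ext c : 1
  change laurentMap (g : L →+* L) (_ * c) = _ * laurentMap (g : L →+* L) c
  rw [map_mul]
  congr 1
  ext n
  change g (algebraMap F L _) = algebraMap F L _
  rw [IsScalarTower.algebraMap_apply F K L, g.commutes]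

theorem gal_mem (g : L ≃ₐ[K] L) {x : L⸨X⸩ ⊗[R⟦X⟧] M} (hx : x ∈ P.rationalTateModule L) :
    (galLaurent K g).rTensor M x ∈ P.rationalTateModule L := by
  rw [mem_rationalTateModule] at *
  rw [phiExt_rTensor P _ (galLaurent K g), hx, lTensor_toAway]
  intro c
  ext n
  change (g _) ^ _ = g (_ ^ _)
  rw [map_pow]

variable (L K)

/-- The action of `g ∈ Gal(L/K)` on `M ⊗ L((z))` through the coefficients in `L`. -/
def galAmbient (g : L ≃ₐ[K] L) : L⸨X⸩ ⊗[R⟦X⟧] M →ₗ[F⸨X⸩] L⸨X⸩ ⊗[R⟦X⟧] M where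
  toFun := (galLaurent K g).rTensor M
  map_add' := map_add _
  map_smul' a x := by
    rw [RingHom.id_apply]
    exact gal_smul (F := F) (R := R) (M := M) g a x

/-- The action of `g ∈ Gal(L/K)` on `V̌_ε M`. -/
def galAct (g : L ≃ₐ[K] L) : P.rationalTateModule L →ₗ[F⸨X⸩] P.rationalTateModule L :=
  (galAmbient (F := F) (R := R) (M := M) L K g).restrict fun _ hx => P.gal_mem g hx

theorem galAct_coe (g : L ≃ₐ[K] L) (v : P.rationalTateModule L) :
    (P.galAct L K g v : L⸨X⸩ ⊗[R⟦X⟧] M) = (galLaurent K g).rTensor M v := rfl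

/-- The representation of `Gal(L/K)` on `V̌_ε M`: the group acts on the coefficients of the Laurent
series in `M ⊗ L((z))`. -/
def galoisRep : Representation F⸨X⸩ (L ≃ₐ[K] L) (P.rationalTateModule L) where
  toFun := P.galAct L K
  map_one' := by
    ext v
    rw [galAct_coe]
    have h : galLaurent (R := R) K (1 : L ≃ₐ[K] L) = LinearMap.id := by
      ext c n
      rfl
    rw [h, LinearMap.rTensor_id, LinearMap.id_apply, Module.End.one_apply]
  map_mul' g h := by
    ext v
    rw [Module.End.mul_apply, galAct_coe, galAct_coe, galAct_coe, ← LinearMap.rTensor_comp_apply]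
    rfl

end Galois

/-- The full `A_ε`-lattices in `V̌_ε M` that are stable under `Gal(L/K)`. -/
def galoisStableLattices (K : Type*) [Field K] [Algebra R K] [Algebra K L] [IsScalarTower R K L]
    [Algebra F K] [IsScalarTower F K L] : Set (Submodule F⟦X⟧ (P.rationalTateModule L)) :=
  {T | T.IsLattice F⸨X⸩ ∧ ∀ g : L ≃ₐ[K] L, ∀ v ∈ T, P.galoisRep L K g v ∈ T}

end Tate

/-! ### Sub-shtukas of `M[1/z]` -/

/-- A local shtuka contained in `M[1/z] = M ⊗ R((z))`: an `R[[z]]`-submodule `N` together with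
the structure of a local shtuka on `N` such that the inclusion `N → M[1/z]` is compatible with the
maps `τ`, that is, `τ_N(σ̂^* n) = τ_M(σ̂^* n)` in `M[1/z][1/(z - ζ)]` for all `n ∈ N`. -/
structure SubShtuka where
  carrier : Submodule R⟦X⟧ (R⸨X⸩ ⊗[R⟦X⟧] M)
  shtuka : LocalShtuka F ζ carrier
  compat : ∀ n : carrier, carrier.subtype.lTensor (AwayRing ζ) (shtuka.phi n) =
    P.phiExt R⸨X⸩ (n : R⸨X⸩ ⊗[R⟦X⟧] M)

namespace SubShtuka

variable {P} (N : P.SubShtuka)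

/-- The sub-shtuka has the same rank as the ambient local shtuka. -/
def IsFullRank : Prop :=
  Module.finrank R⟦X⟧ N.carrier = Module.finrank R⟦X⟧ M

variable (L : Type*) [Field L] [Algebra F L] [Algebra R L] [IsScalarTower F R L]

variable (R) in
/-- The inclusion `R((z)) → L((z))`. -/
def laurentIncl : R⸨X⸩ →ₗ[R⟦X⟧] L⸨X⸩ where
  toFun := laurentMap (algebraMap R L)
  map_add' := map_add _
  map_smul' a x := by
    rw [Algebra.smul_def, map_mul, Algebra.smul_def]
    congr 1
    exact laurentMap_ofPowerSeries _ a

/-- The canonical map `N ⊗ L[[z]] → M[1/z] ⊗ L[[z]] = M ⊗ L((z))`, linear over `R[[z]]`; it sends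
`a ⊗ n` to `a · n`. -/
def baseChangeIncl : L⟦X⟧ ⊗[R⟦X⟧] N.carrier →ₗ[R⟦X⟧] L⸨X⸩ ⊗[R⟦X⟧] M :=
  TensorProduct.lift <| LinearMap.mk₂ R⟦X⟧
    (fun a n => (HahnSeries.ofPowerSeries ℤ L a) •
      (laurentIncl R L).rTensor M (n : R⸨X⸩ ⊗[R⟦X⟧] M))
    (fun a b n => by rw [map_add, add_smul])
    (fun c a n => by
      rw [Algebra.smul_def, map_mul, mul_smul]
      exact algebraMap_smul L⸨X⸩ c _)
    (fun a n n' => by rw [Submodule.coe_add, map_add, smul_add])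
    (fun c a n => by rw [Submodule.coe_smul, map_smul, smul_comm])

theorem baseChangeIncl_tmul (a : L⟦X⟧) (n : N.carrier) :
    N.baseChangeIncl L (a ⊗ₜ n) = (LinearMap.mulLeft R⟦X⟧ (HahnSeries.ofPowerSeries ℤ L a)).rTensor
      M ((laurentIncl R L).rTensor M (n : R⸨X⸩ ⊗[R⟦X⟧] M)) := by
  change (HahnSeries.ofPowerSeries ℤ L a) • (laurentIncl R L).rTensor M (n : R⸨X⸩ ⊗[R⟦X⟧] M) = _
  generalize (laurentIncl R L).rTensor M (n : R⸨X⸩ ⊗[R⟦X⟧] M) = x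
  induction x with
  | zero => simp
  | add x y hx hy => simp only [map_add, smul_add, hx, hy]
  | tmul c m => simp [TensorProduct.smul_tmul']

theorem phiExt_baseChangeIncl (t : L⟦X⟧ ⊗[R⟦X⟧] N.carrier) :
    P.phiExt L⸨X⸩ (N.baseChangeIncl L t) =
      (N.baseChangeIncl L).lTensor (AwayRing ζ) (N.shtuka.phiExt L⟦X⟧ t) := by
  induction t with
  | zero => simp
  | add x y hx hy => simp only [map_add, hx, hy]
  | tmul a n =>
    rw [baseChangeIncl_tmul, phiExt_rTensor P _ (LinearMap.mulLeft R⟦X⟧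
        (HahnSeries.ofPowerSeries ℤ L (hatSigma F L a))),
      phiExt_rTensor P _ (laurentIncl R L), ← N.compat, phiExt_tmul,
      ← LinearMap.lTensor_comp_apply, ← LinearMap.lTensor_comp_apply,
      ← LinearMap.lTensor_comp_apply]
    · congr 2
    · intro c
      ext k
      change (algebraMap R L _) ^ _ = algebraMap R L (_ ^ _)
      rw [map_pow]
    · intro c
      rw [LinearMap.mulLeft_apply, LinearMap.mulLeft_apply, map_mul]
      congr 1
      exact laurentMap_ofPowerSeries _ a

theorem baseChangeIncl_mem {t : L⟦X⟧ ⊗[R⟦X⟧] N.carrier} (ht : t ∈ N.shtuka.tateModule L) :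
    N.baseChangeIncl L t ∈ P.rationalTateModule L := by
  change _ = _ at ht
  rw [mem_rationalTateModule, phiExt_baseChangeIncl, ht, lTensor_toAway]

/-- The map `Ť_ε N → V̌_ε M` which is induced by the inclusion `N ⊂ M[1/z]`. -/
def tateIncl : N.shtuka.tateModule L →ₗ[F⟦X⟧] P.rationalTateModule L where
  toFun t := ⟨N.baseChangeIncl L t, N.baseChangeIncl_mem L t.2⟩
  map_add' s t := Subtype.ext <| by
    change N.baseChangeIncl L ((s : L⟦X⟧ ⊗[R⟦X⟧] N.carrier) + t) = _
    rw [map_add]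
    rfl
  map_smul' a t := Subtype.ext <| by
    change N.baseChangeIncl L (a • (t : L⟦X⟧ ⊗[R⟦X⟧] N.carrier)) =
      a • N.baseChangeIncl L (t : L⟦X⟧ ⊗[R⟦X⟧] N.carrier)
    rw [← algebraMap_smul R⟦X⟧ a (t : L⟦X⟧ ⊗[R⟦X⟧] N.carrier), map_smul, algebraMap_smul]

/-- The Tate module `Ť_ε N`, regarded as an `A_ε`-submodule of `V̌_ε M`. -/
def tateLattice : Submodule F⟦X⟧ (P.rationalTateModule L) :=
  LinearMap.range (N.tateIncl L)

end SubShtuka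

end LocalShtuka

end Shtuka

end LocSht

end

/-! Write `L` for the separable closure and fix a basis of `M`. Since `z - ζ` is a unit of `L[[z]]`,
the matrix `A` of `τ` lies in `GL_r(L[[z]])`, and Lang's theorem provides a fundamental matrix `X ∈
GL_r(L[[z]])` with `A σ̂(X) = X` (`exists_matrix_powerSeries_lang`). The substitution `v = X w`
turns the equation `A σ̂(v) = v` into `σ̂(w) = w`. So the rational Tate module is the `F((z))`-span
of the columns of `X`, and a lattice in it can be recovered from the `L[[z]]`-lattice it generates
in `L((z))^r`.

For a sub-shtuka `N` of full rank, let `Y` be the matrix over `R((z))` of a basis of `N`. The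
crucial point is that `Y` is invertible (`isUnit_carrierMatrix`). This is not automatic, because
`R((z))` is not a field. With `d = det Y`, compatibility with `τ` makes `d / σ̂(d)` a unit of
`R[[z]][1/(z - ζ)]`; as Frobenius multiplies valuations by `q̂`, no power of a uniformizer can
divide `d`, and `d` is a unit (`isUnit_of_mul_eq_mul_hatSigma`). Hence the Tate module of `N` is a
full lattice generating `Y L[[z]]^r`, and it is Galois-stable because `Y` has entries in `R((z))`.
Moreover `N` is the set of `R((z))`-points of `Y L[[z]]^r`, so the Tate module determines `N`.

Conversely, a Galois-stable lattice generates a Galois-stable `L[[z]]`-lattice `Λ`. Galois descent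
shows that the `R((z))`-points of `Λ` generate it, and these points are free over `R[[z]]` because
modulo `z` they are torsion-free over the discrete valuation ring `R` (`exists_rational_basis`). In
a basis of these points, `τ` and its inverse have entries both in `R((z))[1/(z - ζ)]` and in
`L[[z]]`, hence in `R[[z]][1/(z - ζ)]` (`exists_awayEval_eq`). So the points form a local shtuka. -/

namespace LocSht

/-! ### Frobenius-semilinear maps over separably closed fields -/

section Lang

variable (F : Type*) [Field F] [Fintype F] {L : Type*} [Field L] [Algebra F L]

/-- The `q̂`-Frobenius endomorphism of an `F`-algebra. -/
abbrev frob (A : Type*) [CommRing A] [Algebra F A] : A →+* A :=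
  (FiniteField.frobeniusAlgHom F A : A →+* A)

theorem frob_apply {A : Type*} [CommRing A] [Algebra F A] (a : A) :
    frob F A a = a ^ Fintype.card F := rfl

variable (L) in
theorem card_cast_eq_zero : (Fintype.card F : L) = 0 := by
  rw [← map_natCast (algebraMap F L), FiniteField.cast_card_eq_zero, map_zero]

/-- The polynomial `Y^q - Y + c` has derivative `-1`, because `q` vanishes in `L`, so it is
separable. -/
theorem exists_artinSchreier [IsSepClosed L] (c : L) : ∃ y : L, y - frob F L y = c := by
  have hq : 1 < Fintype.card F := Fintype.one_lt_card
  let p : Polynomial L := Polynomial.X ^ Fintype.card F - (Polynomial.X - Polynomial.C c)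
  have hd : p.degree = Fintype.card F := by
    rw [Polynomial.degree_sub_eq_left_of_degree_lt, Polynomial.degree_X_pow]
    rw [Polynomial.degree_X_pow, Polynomial.degree_X_sub_C]
    exact_mod_cast hq
  have hs : p.Separable := by
    have : Polynomial.derivative p = -1 := by
      rw [Polynomial.derivative_sub, Polynomial.derivative_X_pow, card_cast_eq_zero F L]
      simp
    rw [Polynomial.separable_def, this]
    exact isCoprime_one_right.neg_right
  obtain ⟨y, hy⟩ := IsSepClosed.exists_root p (by rw [hd]; exact_mod_cast (by omega)) hs
  refine ⟨y, ?_⟩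
  simp only [p, Polynomial.IsRoot, Polynomial.eval_sub, Polynomial.eval_pow, Polynomial.eval_X,
    Polynomial.eval_C] at hy
  rw [frob_apply]
  linear_combination -hy

variable {F}

/-- The polynomials `P₀ = a₀ Y^q`, `Pᵢ₊₁ = Pᵢ^q + aᵢ₊₁ Y^q`. -/
noncomputable def langPoly (q : ℕ) (a : ℕ → L) : ℕ → Polynomial L
  | 0 => Polynomial.C (a 0) * Polynomial.X ^ q
  | i + 1 => langPoly q a i ^ q + Polynomial.C (a (i + 1)) * Polynomial.X ^ q

/-- Once a nonzero coefficient has occurred the degree is at least `q`; the next `q`-th power then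
has degree above `q`, so adding a multiple of `Y^q` cannot cancel its leading term. -/
theorem langPoly_natDegree {q : ℕ} (hq : 1 < q) (a : ℕ → L) (i : ℕ) :
    q ≤ (langPoly q a i).natDegree ∨ langPoly q a i = 0 ∧ ∀ j ≤ i, a j = 0 := by
  have key (c : L) (hc : c ≠ 0) : (Polynomial.C c * Polynomial.X ^ q).natDegree = q :=
    Polynomial.natDegree_C_mul_X_pow q c hc
  induction i with
  | zero =>
    by_cases h : a 0 = 0
    · right
      simp [langPoly, h]
    · left
      rw [langPoly, key _ h]
  | succ i ih =>
    rcases ih with ih | ⟨ih, ih'⟩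
    · left
      rw [langPoly, Polynomial.natDegree_add_eq_left_of_natDegree_lt] <;>
        rw [Polynomial.natDegree_pow]
      · nlinarith
      · refine (Polynomial.natDegree_C_mul_X_pow_le _ _).trans_lt ?_
        nlinarith
    · by_cases h : a (i + 1) = 0
      · right
        refine ⟨by simp [langPoly, ih, h]; omega, fun j hj => ?_⟩
        rcases hj.lt_or_eq with hj | rfl
        · exact ih' j (by omega)
        · exact h
      · left
        rw [langPoly, ih, zero_pow (by omega), zero_add, key _ h]

theorem langPoly_derivative {q : ℕ} (hq : (q : L) = 0) (a : ℕ → L) (i : ℕ) :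
    Polynomial.derivative (langPoly q a i) = 0 := by
  cases i <;> simp [langPoly, Polynomial.derivative_pow, hq]

theorem langPoly_eval_zero {q : ℕ} (hq : q ≠ 0) (a : ℕ → L) (i : ℕ) :
    (langPoly q a i).eval 0 = 0 := by
  induction i with
  | zero => simp [langPoly, hq]
  | succ i ih => simp [langPoly, hq, ih]

/-- The polynomial `P - Y` has derivative `-1`, so its root `0` is simple. Its cofactor `g` after
division by `Y` is separable of positive degree, and a root of `g` cannot be `0`. -/
theorem exists_langPoly_eval_eq [IsSepClosed L] {q : ℕ} (hq : 1 < q) (hq0 : (q : L) = 0)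
    (a : ℕ → L) (i : ℕ) (ha : ∃ j ≤ i, a j ≠ 0) :
    ∃ y : L, y ≠ 0 ∧ (langPoly q a i).eval y = y := by
  set P := langPoly q a i with hP
  have hdeg : q ≤ P.natDegree := by
    rcases langPoly_natDegree hq a i with h | ⟨-, h⟩
    · exact h
    · obtain ⟨j, hj, hj'⟩ := ha
      exact absurd (h j hj) hj'
  set p := P - Polynomial.X with hp
  have hpd : p.natDegree = P.natDegree := by
    rw [hp, Polynomial.natDegree_sub_eq_left_of_natDegree_lt]
    rw [Polynomial.natDegree_X]
    omega
  have hder : Polynomial.derivative p = -1 := by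
    rw [hp, Polynomial.derivative_sub, langPoly_derivative hq0, Polynomial.derivative_X, zero_sub]
  have hs : p.Separable := by
    rw [Polynomial.separable_def, hder]
    exact isCoprime_one_right.neg_right
  obtain ⟨g, hg⟩ : Polynomial.X ∣ p := by
    rw [Polynomial.X_dvd_iff, Polynomial.coeff_zero_eq_eval_zero, hp, Polynomial.eval_sub,
      langPoly_eval_zero (Nat.ne_zero_of_lt hq), Polynomial.eval_X, sub_zero]
  have hg0 : g ≠ 0 := by
    rintro rfl
    rw [mul_zero] at hg
    have h0 : p.natDegree = 0 := by rw [hg, Polynomial.natDegree_zero]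
    omega
  have hgd : g.degree ≠ 0 := by
    intro h
    have h1 := Polynomial.natDegree_mul Polynomial.X_ne_zero hg0
    rw [← hg, hpd, Polynomial.natDegree_X, Polynomial.natDegree_eq_zero_iff_degree_le_zero.2 h.le] at h1
    omega
  obtain ⟨y, hy⟩ := IsSepClosed.exists_root g hgd (hg ▸ hs).of_mul_right
  refine ⟨y, ?_, ?_⟩
  · rintro rfl
    have h1 := congrArg (Polynomial.eval 0) hder
    rw [hg] at h1
    simp [Polynomial.IsRoot.def.1 hy] at h1
  · have : p.eval y = 0 := by rw [hg, Polynomial.eval_mul, Polynomial.IsRoot.def.1 hy, mul_zero]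
    rw [hp, Polynomial.eval_sub, Polynomial.eval_X] at this
    exact sub_eq_zero.1 this

variable {V : Type*} [AddCommGroup V] [Module L V]

/-- The images of a basis span the space, hence are a basis by counting; the coordinates of `φ x` in
it are the `q`-th powers of those of `x`. -/
theorem linearIndependent_map_of_span_range [Module.Finite L V] (φ : V →ₛₗ[frob F L] V)
    (hφ : Submodule.span L (Set.range φ) = ⊤) : Function.Injective φ := by
  let b := Module.finBasis L V
  have hq : Fintype.card F ≠ 0 := Fintype.card_ne_zero
  have hexp (x : V) : φ x = ∑ i, (b.repr x i) ^ Fintype.card F • φ (b i) := by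
    conv_lhs => rw [← b.sum_repr x, map_sum]
    exact Finset.sum_congr rfl fun i _ => map_smulₛₗ _ _ _
  have hli : LinearIndependent L fun i => φ (b i) := by
    refine linearIndependent_of_top_le_span_of_card_eq_finrank ?_ (by simp)
    rw [← hφ, Submodule.span_le]
    rintro _ ⟨x, rfl⟩
    rw [SetLike.mem_coe, hexp]
    exact Submodule.sum_mem _ fun i _ => Submodule.smul_mem _ _ (Submodule.subset_span ⟨i, rfl⟩)
  rw [injective_iff_map_eq_zero]
  intro x hx
  rw [hexp] at hx
  have h := Fintype.linearIndependent_iff.1 hli _ hx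
  refine b.repr.map_eq_zero_iff.1 (Finsupp.ext fun i => ?_)
  exact pow_eq_zero_iff hq |>.1 (h i)

theorem exists_iterate_mem_span [Module.Finite L V] (f : V → V) (v : V) :
    ∃ m : ℕ, (LinearIndependent L fun i : Fin m => f^[i] v) ∧
      f^[m] v ∈ Submodule.span L (Set.range fun i : Fin m => f^[i] v) := by
  by_contra! h
  have hli (m : ℕ) : LinearIndependent L fun i : Fin m => f^[i] v := by
    induction m with
    | zero => exact linearIndependent_empty_type
    | succ m ih =>
      rw [linearIndependent_finSucc']
      exact ⟨ih, h m ih⟩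
  have := (hli (Module.finrank L V + 1)).fintype_card_le_finrank
  simp at this

/-- A Frobenius-semilinear endomorphism of a nonzero space over a separably closed field, with image
spanning the space, has a nonzero fixed vector. -/
theorem exists_fixed_ne_zero [IsSepClosed L] [Module.Finite L V] [Nontrivial V]
    (φ : V →ₛₗ[frob F L] V) (hφ : Submodule.span L (Set.range φ) = ⊤) :
    ∃ w : V, w ≠ 0 ∧ φ w = w := by
  have hinj := linearIndependent_map_of_span_range φ hφ
  have hq : 1 < Fintype.card F := Fintype.one_lt_card
  obtain ⟨v, hv⟩ := exists_ne (0 : V)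
  obtain ⟨m, hli, hm⟩ := exists_iterate_mem_span (L := L) φ v
  have hit (i : ℕ) : φ^[i] v ≠ 0 := by
    induction i with
    | zero => exact hv
    | succ i ih =>
      rw [Function.iterate_succ_apply', Ne, ← map_zero φ]
      exact fun h => ih (hinj h)
  obtain ⟨c, hc⟩ := (Submodule.mem_span_range_iff_exists_fun L).1 hm
  let a : ℕ → L := fun i => if h : i < m then c ⟨i, h⟩ else 0
  have hca (i : Fin m) : c i = a i := by simp [a]
  obtain ⟨n, rfl⟩ : ∃ n, m = n + 1 := by
    refine ⟨m - 1, ?_⟩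
    rcases m with _ | m
    · simp at hc
      exact absurd hc.symm hv
    · omega
  -- If all coefficients vanished, `φ^(n+1) v` would be zero, contradicting injectivity of `φ`.
  have hne : ∃ j ≤ n, a j ≠ 0 := by
    by_contra! h
    refine hit (n + 1) ?_
    rw [← hc]
    refine Finset.sum_eq_zero fun i _ => ?_
    rw [hca, h i (by omega), zero_smul]
  obtain ⟨y, hy0, hy⟩ := exists_langPoly_eval_eq hq (card_cast_eq_zero F L) a n hne
  -- Look for a fixed vector `∑ xᵢ φ^i v` with last coefficient `y`. The relation rewrites the top
  -- term `y^q φ^(n+1) v` as `y^q ∑ aᵢ φ^i v`; comparing coefficients gives exactly the recursion of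
  -- `langPoly`, and `Pₙ(y) = y` closes it. Since `y ≠ 0`, the vector is nonzero.
  let x : ℕ → L := fun i => (langPoly (Fintype.card F) a i).eval y
  have hx0 : x 0 = a 0 * y ^ Fintype.card F := by simp [x, langPoly]
  have hxs (i : ℕ) : x (i + 1) = x i ^ Fintype.card F + a (i + 1) * y ^ Fintype.card F := by
    simp [x, langPoly]
  have hxn : x n = y := hy
  refine ⟨∑ i : Fin (n + 1), x i • φ^[i] v, fun h => ?_, ?_⟩
  · have := Fintype.linearIndependent_iff.1 hli (fun i => x i) h (Fin.last n)
    simp [hxn] at this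
    exact hy0 this
  · rw [map_sum]
    have h1 : ∀ i : Fin (n + 1), φ (x i • φ^[i] v) = x i ^ Fintype.card F • φ^[i + 1] v := by
      intro i
      rw [map_smulₛₗ, Function.iterate_succ_apply', frob_apply]
    rw [Finset.sum_congr rfl fun i _ => h1 i, Fin.sum_univ_castSucc, Fin.val_last, hxn, ← hc,
      Finset.smul_sum, Fin.sum_univ_succ (fun i : Fin (n + 1) => x i • φ^[i] v),
      Fin.sum_univ_succ, Fin.val_zero, hx0, add_left_comm, ← Finset.sum_add_distrib]
    congr 1
    · rw [hca, smul_smul, mul_comm]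
      rfl
    · refine Finset.sum_congr rfl fun i _ => ?_
      rw [Fin.val_succ, hxs, add_smul, hca, smul_smul, mul_comm (y ^ _)]
      rfl

/-- A Frobenius-semilinear endomorphism of a finite-dimensional space over a separably closed
field, with image spanning the space, has a spanning set of fixed vectors. -/
theorem span_fixed_eq_top [IsSepClosed L] [Module.Finite L V] (φ : V →ₛₗ[frob F L] V)
    (hφ : Submodule.span L (Set.range φ) = ⊤) :
    Submodule.span L {w : V | φ w = w} = ⊤ := by
  set W := Submodule.span L {w : V | φ w = w} with hW
  by_contra hne
  have hmap : W ≤ W.comap φ := by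
    rw [hW, Submodule.span_le]
    intro w hw
    rw [SetLike.mem_coe, Submodule.mem_comap, show φ w = w from hw]
    exact Submodule.subset_span hw
  -- On the span of the fixed vectors, `1 - φ` is surjective by Artin–Schreier in each coefficient.
  -- This is what lifts fixed vectors from `V ⧸ W` to `V`.
  have hAS (c : V) (hc : c ∈ W) : ∃ y : V, y ∈ W ∧ y - φ y = c := by
    rw [hW] at hc
    induction hc using Submodule.closure_induction with
    | smul_mem a w hw =>
      obtain ⟨y, hy⟩ := exists_artinSchreier F a
      refine ⟨y • w, W.smul_mem _ (Submodule.subset_span hw), ?_⟩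
      rw [map_smulₛₗ, show φ w = w from hw, ← sub_smul, hy]
    | zero => exact ⟨0, W.zero_mem, by simp⟩
    | add c d _ _ hc hd =>
      obtain ⟨y, hy, rfl⟩ := hc
      obtain ⟨z, hz, rfl⟩ := hd
      exact ⟨y + z, W.add_mem hy hz, by rw [map_add]; abel⟩
  let ψ : V ⧸ W →ₛₗ[frob F L] V ⧸ W := W.mapQ W φ hmap
  have hψ : Submodule.span L (Set.range ψ) = ⊤ := by
    rw [eq_top_iff, ← W.range_mkQ, ← Submodule.map_top, ← hφ, Submodule.map_span,
      Submodule.span_le]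
    rintro _ ⟨_, ⟨x, rfl⟩, rfl⟩
    exact Submodule.subset_span ⟨W.mkQ x, rfl⟩
  have : Nontrivial (V ⧸ W) := Submodule.Quotient.nontrivial_iff.2 hne
  obtain ⟨w', hw0, hw'⟩ := exists_fixed_ne_zero ψ hψ
  obtain ⟨w, rfl⟩ := W.mkQ_surjective w'
  -- A lift `w` of a fixed class satisfies `φ w - w = y - φ y` with `y ∈ W`, so `w + y` is fixed and
  -- therefore lies in `W`, against the class of `w` being nonzero.
  obtain ⟨y, hy, hyw⟩ := hAS (φ w - w) ((Submodule.Quotient.eq W).1 hw')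
  refine hw0 ((Submodule.Quotient.mk_eq_zero W).2 ?_)
  have : w + y ∈ W := by
    refine Submodule.subset_span ?_
    change φ (w + y) = w + y
    rw [map_add, ← sub_eq_zero]
    rw [← sub_eq_zero] at hyw
    rw [← neg_eq_zero, ← hyw]
    abel
  simpa using W.sub_mem this hy

/-- Lang's theorem for `GL_n` over a separably closed field. -/
theorem exists_matrix_lang [IsSepClosed L] {ι : Type*} [Fintype ι] [DecidableEq ι]
    (A : Matrix ι ι L) (hA : IsUnit A) :
    ∃ X : Matrix ι ι L, IsUnit X ∧ A * X.map (frob F L) = X := by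
  let φ : (ι → L) →ₛₗ[frob F L] (ι → L) :=
    { toFun := fun x => A.mulVec (frob F L ∘ x)
      map_add' := fun x y => by
        rw [← Matrix.mulVec_add]
        congr 1
        ext i
        exact map_add (frob F L) _ _
      map_smul' := fun a x => by
        rw [← Matrix.mulVec_smul]
        congr 1
        ext i
        exact map_mul (frob F L) _ _ }
  have hφ : Submodule.span L (Set.range φ) = ⊤ := by
    rw [eq_top_iff]
    intro v _
    obtain ⟨B, hB⟩ := hA.exists_right_inv
    -- On standard vectors the Frobenius does nothing, so `φ` takes them to the columns of the
    -- invertible matrix `A`.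
    have hv : v = ∑ i, (B.mulVec v i) • φ (Pi.single i 1) := by
      have h1 (i : ι) : φ (Pi.single i 1) = A.mulVecLin (Pi.single i 1) := by
        change A.mulVec _ = A.mulVec _
        congr 1
        ext j
        by_cases h : j = i
        · subst h; simp
        · simp [Pi.single_eq_of_ne h]
      simp_rw [h1, ← map_smul, ← map_sum]
      rw [← pi_eq_sum_univ' (B.mulVec v), Matrix.mulVecLin_apply, Matrix.mulVec_mulVec, hB,
        Matrix.one_mulVec]
    rw [hv]
    exact Submodule.sum_mem _ fun i _ => Submodule.smul_mem _ _ (Submodule.subset_span ⟨_, rfl⟩)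
  let b₀ := Module.Basis.ofSpan (span_fixed_eq_top φ hφ).ge
  let b := b₀.reindex (b₀.indexEquiv (Pi.basisFun L ι))
  have hb (i : ι) : φ (b i) = b i :=
    Module.Basis.ofSpan_subset (span_fixed_eq_top φ hφ).ge ⟨_, (b₀.reindex_apply _ i).symm⟩
  refine ⟨Matrix.of fun i j => b j i, ?_, ?_⟩
  · rw [← Matrix.linearIndependent_cols_iff_isUnit]
    exact b.linearIndependent
  · ext i j
    exact congrFun (hb j) i

/-! ### Lang's theorem over power series -/

/-- A sequence defined by strong recursion. -/
def strongSeq {α : Type*} [Inhabited α] (G : ℕ → (ℕ → α) → α) (n : ℕ) : α :=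
  G n fun k => if k < n then strongSeq G k else default
termination_by n

/-- By `hG` the value of `G n` depends only on the terms below `n`, so the default value inserted at
the other indices has no effect. -/
theorem strongSeq_eq {α : Type*} [Inhabited α] (G : ℕ → (ℕ → α) → α)
    (hG : ∀ n f g, (∀ k < n, f k = g k) → G n f = G n g) (n : ℕ) :
    strongSeq G n = G n (strongSeq G) := by
  conv_lhs => rw [strongSeq]
  exact hG _ _ _ fun k hk => if_pos hk

theorem coeff_hatSigma (a : L⟦X⟧) (n : ℕ) :
    PowerSeries.coeff n (hatSigma F L a) = frob F L (PowerSeries.coeff n a) :=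
  PowerSeries.coeff_map _ _ _

/-- Since `A` is `1` modulo `z`, the coefficient of `z^n` in the equation reads `Xₙ - σ̂(Xₙ) = ` an
expression in `X₀, …, Xₙ₋₁`. It is solved entry by entry by Artin–Schreier, starting from `X₀ = 1`.
The erased pair `(0, n)` indexes the only terms that contain `Xₙ`. -/
theorem exists_matrix_lang_of_constantCoeff [IsSepClosed L] {ι : Type*} [Fintype ι]
    [DecidableEq ι] (A : Matrix ι ι L⟦X⟧) (hA : A.map PowerSeries.constantCoeff = 1) :
    ∃ X : Matrix ι ι L⟦X⟧, X.map PowerSeries.constantCoeff = 1 ∧ A * X.map (hatSigma F L) = X := by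
  have : Inhabited (Matrix ι ι L) := ⟨0⟩
  choose as has using exists_artinSchreier F (L := L)
  let rhs : ℕ → (ℕ → Matrix ι ι L) → Matrix ι ι L := fun n f => Matrix.of fun i j =>
    ∑ p ∈ (Finset.HasAntidiagonal.antidiagonal n).erase (0, n), ∑ k, PowerSeries.coeff p.1 (A i k) *
      frob F L (f p.2 k j)
  let G : ℕ → (ℕ → Matrix ι ι L) → Matrix ι ι L := fun n f =>
    if n = 0 then 1 else Matrix.of fun i j => as (rhs n f i j)
  have hlt {n : ℕ} {p : ℕ × ℕ} (hp : p ∈ (Finset.HasAntidiagonal.antidiagonal n).erase (0, n)) : p.2 < n := by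
    obtain ⟨h0, h1⟩ := Finset.mem_erase.1 hp
    rw [Finset.HasAntidiagonal.mem_antidiagonal] at h1
    rcases p with ⟨a, b⟩
    simp only [ne_eq, Prod.mk.injEq] at h0 h1 ⊢
    omega
  have hG : ∀ n f g, (∀ k < n, f k = g k) → G n f = G n g := by
    intro n f g h
    have : rhs n f = rhs n g := by
      ext i j
      simp only [rhs, Matrix.of_apply]
      refine Finset.sum_congr rfl fun p hp => ?_
      rw [h _ (hlt hp)]
    simp only [G, this]
  let x := strongSeq G
  have hx (n : ℕ) : x n = G n x := strongSeq_eq G hG n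
  have hx0 : x 0 = 1 := by rw [hx]; exact if_pos rfl
  refine ⟨Matrix.of fun i j => PowerSeries.mk fun n => x n i j, ?_, ?_⟩
  · ext i j
    rw [Matrix.map_apply, Matrix.of_apply, ← PowerSeries.coeff_zero_eq_constantCoeff_apply,
      PowerSeries.coeff_mk, hx0]
  · ext i j n
    have hA0 (k : ι) : PowerSeries.coeff 0 (A i k) = (1 : Matrix ι ι L) i k := by
      rw [← hA, Matrix.map_apply, PowerSeries.coeff_zero_eq_constantCoeff_apply]
    rw [Matrix.mul_apply, map_sum]
    simp only [Matrix.map_apply, Matrix.of_apply, PowerSeries.coeff_mul, coeff_hatSigma,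
      PowerSeries.coeff_mk]
    rw [Finset.sum_comm, ← Finset.add_sum_erase _ _
      (Finset.HasAntidiagonal.mem_antidiagonal.2 (zero_add n) : (0, n) ∈ Finset.HasAntidiagonal.antidiagonal n)]
    simp only [hA0]
    have h1 : ∑ k, (1 : Matrix ι ι L) i k * frob F L (x n k j) = frob F L (x n i j) := by
      simp [Matrix.one_apply]
    have h2 : x n i j - frob F L (x n i j) = rhs n x i j := by
      rcases Nat.eq_zero_or_pos n with rfl | hn
      · rw [hx0]
        have h3 : (Finset.HasAntidiagonal.antidiagonal 0).erase ((0, 0) : ℕ × ℕ) = ∅ := rfl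
        simp only [rhs, h3, Finset.sum_empty, Matrix.of_apply]
        by_cases h : i = j
        · rw [h, Matrix.one_apply_eq, map_one, sub_self]
        · rw [Matrix.one_apply_ne h, map_zero, sub_self]
      · rw [hx, show G n x = Matrix.of fun i j => as (rhs n x i j) from if_neg hn.ne']
        exact has _
    rw [h1]
    exact (sub_eq_iff_eq_add'.1 h2).symm

/-- Lang's theorem for `GL_n` of the power series ring over a separably closed field. -/
theorem exists_matrix_powerSeries_lang [IsSepClosed L] {ι : Type*} [Fintype ι]
    [DecidableEq ι] (A : Matrix ι ι L⟦X⟧) (hA : IsUnit A) :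
    ∃ X : Matrix ι ι L⟦X⟧, IsUnit X ∧ A * X.map (hatSigma F L) = X := by
  have hunit (B : Matrix ι ι L⟦X⟧) (hB : IsUnit (B.map PowerSeries.constantCoeff)) : IsUnit B := by
    rw [Matrix.isUnit_iff_isUnit_det, PowerSeries.isUnit_iff_constantCoeff,
      (PowerSeries.constantCoeff (R := L)).map_det]
    exact (Matrix.isUnit_iff_isUnit_det _).1 hB
  obtain ⟨X₀, hX₀, hAX₀⟩ := exists_matrix_lang (F := F) (A.map PowerSeries.constantCoeff)
    (hA.map (PowerSeries.constantCoeff (R := L)).mapMatrix)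
  obtain ⟨Y₀, hYX⟩ := hX₀.exists_left_inv
  have hXY : X₀ * Y₀ = 1 := mul_eq_one_comm.1 hYX
  let c := (PowerSeries.C (R := L)).mapMatrix (m := ι)
  have hc (B : Matrix ι ι L) : (c B).map (hatSigma F L) = c (B.map (frob F L)) := by
    ext i j : 1
    exact PowerSeries.map_C (frob F L) (B i j)
  have hc' (B : Matrix ι ι L) : (c B).map PowerSeries.constantCoeff = B := by
    ext i j
    exact PowerSeries.constantCoeff_C (B i j)
  -- Solving the equation modulo `z` by `X₀` and replacing `A` by `X₀⁻¹ A σ̂(X₀)` reduces to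
  -- constant term `1`.
  obtain ⟨Z, hZ, hAZ⟩ := exists_matrix_lang_of_constantCoeff (F := F)
    (c Y₀ * A * c (X₀.map (frob F L))) (by
      rw [Matrix.map_mul, Matrix.map_mul, hc', hc', mul_assoc, hAX₀, hYX])
  refine ⟨c X₀ * Z, hunit _ ?_, ?_⟩
  · rw [Matrix.map_mul, hc', hZ, mul_one]
    exact hX₀
  · have h1 : c X₀ * c Y₀ = 1 := by rw [← map_mul, hXY, map_one]
    rw [Matrix.map_mul, hc]
    calc A * (c (X₀.map (frob F L)) * Z.map (hatSigma F L))
        = (c X₀ * c Y₀) * (A * (c (X₀.map (frob F L)) * Z.map (hatSigma F L))) := by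
          rw [h1, one_mul]
      _ = c X₀ * (c Y₀ * A * c (X₀.map (frob F L)) * Z.map (hatSigma F L)) := by
          simp only [mul_assoc]
      _ = c X₀ * Z := by rw [hAZ]

/-! ### Fixed points of `σ̂` -/

variable (F) in
-- The polynomial `X^q - X` already has all its `q` roots in `F`, so it acquires no new ones in `L`.
theorem exists_of_frob_eq (a : L) (ha : frob F L a = a) : ∃ c : F, algebraMap F L c = a := by
  have hq : 1 < Fintype.card F := Fintype.one_lt_card
  have h : a ∈ (Polynomial.map (algebraMap F L)
      (Polynomial.X ^ Fintype.card F - Polynomial.X)).roots := by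
    rw [Polynomial.map_sub, Polynomial.map_pow, Polynomial.map_X, Polynomial.mem_roots
      (FiniteField.X_pow_card_sub_X_ne_zero L hq), Polynomial.IsRoot.def, Polynomial.eval_sub,
      Polynomial.eval_pow, Polynomial.eval_X, sub_eq_zero]
    exact ha
  rw [Polynomial.Splits.roots_map, FiniteField.roots_X_pow_card_sub_X] at h
  · simpa using h
  · exact Polynomial.splits_iff_card_roots.2 (by
      rw [FiniteField.roots_X_pow_card_sub_X, FiniteField.X_pow_card_sub_X_natDegree_eq F hq]
      exact Finset.card_univ)

theorem exists_of_hatSigma_eq (a : L⟦X⟧) (ha : hatSigma F L a = a) :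
    ∃ c : F⟦X⟧, PowerSeries.map (algebraMap F L) c = a := by
  choose c hc using fun n => exists_of_frob_eq F (PowerSeries.coeff n a) (by
    rw [← coeff_hatSigma, ha])
  exact ⟨PowerSeries.mk c, by ext n; rw [PowerSeries.coeff_map, PowerSeries.coeff_mk, hc]⟩

theorem exists_of_hatSigmaLaurent_eq (a : L⸨X⸩) (ha : hatSigmaLaurent F L a = a) :
    ∃ c : F⸨X⸩, laurentMap (algebraMap F L) c = a := by
  choose c hc using fun n => exists_of_frob_eq F (a.coeff n) (by
    conv_rhs => rw [← ha]
    rfl)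
  refine ⟨⟨c, a.isPWO_support.mono fun n hn => ?_⟩, ?_⟩
  · rw [HahnSeries.mem_support, ← hc]
    exact (map_ne_zero _).2 hn
  · ext n
    exact hc n

end Lang

/-! ### Rank one: `d / σ̂(d)` a unit of `R[[z]][1/(z - ζ)]` -/

section RankOne

variable {F : Type*} [Field F] [Fintype F] {R : Type*} [CommRing R] [IsDomain R]
  [IsDiscreteValuationRing R] [IsAdicComplete (IsLocalRing.maximalIdeal R) R] [Algebra F R]
  {ζ : R}

/-- Weierstrass division by the distinguished polynomial `X - ζ`, available because `R` is complete,
identifies `R[[z]]/(z - ζ)` with `R[X]/(X - ζ)`, which is a domain. -/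
theorem prime_X_sub_C (hζ : ζ ∈ IsLocalRing.maximalIdeal R) :
    Prime (PowerSeries.X - PowerSeries.C ζ : R⟦X⟧) := by
  have hd : (Polynomial.X - Polynomial.C ζ).IsDistinguishedAt (IsLocalRing.maximalIdeal R) :=
    { mem := by
        intro n hn
        rw [Polynomial.natDegree_X_sub_C, Nat.lt_one_iff] at hn
        subst hn
        simpa using hζ
      monic := Polynomial.monic_X_sub_C ζ }
  have hcoe : ((Polynomial.X - Polynomial.C ζ : Polynomial R) : R⟦X⟧) =
      PowerSeries.X - PowerSeries.C ζ := by simp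
  have hne : (PowerSeries.X - PowerSeries.C ζ : R⟦X⟧) ≠ 0 := by
    rw [← hcoe, Ne, Polynomial.coe_eq_zero_iff]
    exact Polynomial.X_sub_C_ne_zero ζ
  rw [← Ideal.span_singleton_prime hne, ← Ideal.Quotient.isDomain_iff_prime, ← hcoe]
  have : IsDomain (Polynomial R ⧸ Ideal.span {Polynomial.X - Polynomial.C ζ}) := by
    rw [Ideal.Quotient.isDomain_iff_prime, Ideal.span_singleton_prime
      (Polynomial.X_sub_C_ne_zero ζ)]
    exact Polynomial.prime_X_sub_C ζ
  exact (hd.algEquivQuotient).symm.toMulEquiv.isDomain _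

theorem constantCoeff_hatSigma (a : R⟦X⟧) :
    PowerSeries.constantCoeff (hatSigma F R a) = PowerSeries.constantCoeff a ^ Fintype.card F := by
  rw [← PowerSeries.coeff_zero_eq_constantCoeff_apply, ← PowerSeries.coeff_zero_eq_constantCoeff_apply]
  exact PowerSeries.coeff_map _ _ _

theorem hatSigma_C (a : R) : hatSigma F R (PowerSeries.C a) =
    PowerSeries.C (a ^ Fintype.card F) :=
  PowerSeries.map_C _ _

theorem C_dvd_iff {S : Type*} [CommRing S] {a : S} {f : S⟦X⟧} :
    PowerSeries.C a ∣ f ↔ ∀ n, a ∣ PowerSeries.coeff n f := by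
  refine ⟨fun ⟨g, hg⟩ n => ⟨PowerSeries.coeff n g, by rw [hg, PowerSeries.coeff_C_mul]⟩,
    fun h => ?_⟩
  choose g hg using h
  exact ⟨PowerSeries.mk g, by ext n; rw [PowerSeries.coeff_C_mul, PowerSeries.coeff_mk, hg]⟩

theorem map_residue_eq_zero_iff {ϖ : R} (hϖ : Irreducible ϖ) {f : R⟦X⟧} :
    PowerSeries.map (IsLocalRing.residue R) f = 0 ↔ PowerSeries.C ϖ ∣ f := by
  rw [C_dvd_iff, PowerSeries.ext_iff]
  refine forall_congr' fun n => ?_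
  rw [PowerSeries.coeff_map, map_zero, IsLocalRing.residue_eq_zero_iff,
    hϖ.maximalIdeal_eq, Ideal.mem_span_singleton]

/-- Modulo the maximal ideal, `σ̂` raises the coefficients to the `q`-th power in a field, which
does not change which of them vanish. -/
theorem order_map_hatSigma (d : R⟦X⟧) :
    (PowerSeries.map (IsLocalRing.residue R) (hatSigma F R d)).order =
      (PowerSeries.map (IsLocalRing.residue R) d).order := by
  have h (n : ℕ) : PowerSeries.coeff n (PowerSeries.map (IsLocalRing.residue R) (hatSigma F R d)) =
      PowerSeries.coeff n (PowerSeries.map (IsLocalRing.residue R) d) ^ Fintype.card F := by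
    rw [PowerSeries.coeff_map, PowerSeries.coeff_map, ← map_pow]
    congr 1
  refine le_antisymm ?_ ?_
  · refine PowerSeries.le_order _ _ fun i hi => ?_
    have := PowerSeries.coeff_of_lt_order i hi
    rw [h] at this
    exact pow_eq_zero_iff Fintype.card_ne_zero |>.1 this
  · refine PowerSeries.le_order _ _ fun i hi => ?_
    rw [h, PowerSeries.coeff_of_lt_order i hi, zero_pow Fintype.card_ne_zero]

/-- Frobenius would multiply the exponent of the uniformizer in `d` by `q`, so that exponent is zero
and `d` survives modulo the maximal ideal. There `z - ζ` becomes `z`, and comparing orders in `z`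
shows that `f` is associated to `(z - ζ)^k`. Hence `σ̂(d) = u d` with a unit `u`; the constant term
`d₀ ≠ 0` satisfies `d₀^(q-1) = u₀`, so `d₀` is a unit. -/
theorem isUnit_of_mul_eq_mul_hatSigma (hζ : ζ ∈ IsLocalRing.maximalIdeal R) {d f : R⟦X⟧}
    {k N : ℕ} (hd : PowerSeries.constantCoeff d ≠ 0)
    (hf : f ∣ (PowerSeries.X - PowerSeries.C ζ) ^ N)
    (h : (PowerSeries.X - PowerSeries.C ζ) ^ k * d = f * hatSigma F R d) : IsUnit d := by
  have hq : 1 < Fintype.card F := Fintype.one_lt_card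
  have hp := prime_X_sub_C hζ
  obtain ⟨b, -, u, hu⟩ := (dvd_prime_pow hp N).1 hf
  obtain ⟨ϖ, hϖ⟩ := IsDiscreteValuationRing.exists_irreducible R
  set ρ := PowerSeries.map (IsLocalRing.residue R) with hρ
  have hρp : ρ (PowerSeries.X - PowerSeries.C ζ) = PowerSeries.X := by
    rw [map_sub, hρ, PowerSeries.map_X, PowerSeries.map_C,
      (IsLocalRing.residue_eq_zero_iff ζ).2 hζ, map_zero, sub_zero]
  have hd0 : d ≠ 0 := fun h0 => hd (by rw [h0, map_zero])
  -- the content of `d` is trivial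
  have hcont : ρ d ≠ 0 := by
    have hfin : FiniteMultiplicity (PowerSeries.C ϖ) d := by
      obtain ⟨n, hn⟩ := FiniteMultiplicity.of_not_isUnit hϖ.not_isUnit hd
      refine ⟨n, fun h => hn ?_⟩
      rw [← map_pow, C_dvd_iff] at h
      exact PowerSeries.coeff_zero_eq_constantCoeff_apply d ▸ h 0
    obtain ⟨d', hd', hndvd⟩ := hfin.exists_eq_pow_mul_and_not_dvd
    set m := multiplicity (PowerSeries.C ϖ) d
    have hC : PowerSeries.C ϖ ≠ 0 := by
      rw [Ne, map_eq_zero_iff _ PowerSeries.C_injective]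
      exact hϖ.ne_zero
    rcases Nat.eq_zero_or_pos m with hm | hm
    · rwa [Ne, hρ, map_residue_eq_zero_iff hϖ, hd', hm, pow_zero, one_mul]
    · exfalso
      -- `σ̂` turns `ϖ^m` into `ϖ^(mq)`; as `q ≥ 2` and `m > 0`, at least one factor `ϖ` remains
      -- after cancelling `ϖ^m`, and it must divide `d'`.
      obtain ⟨l, hl⟩ : ∃ l, m * Fintype.card F = m + (l + 1) := by
        refine ⟨m * Fintype.card F - m - 1, ?_⟩
        have : m * 2 ≤ m * Fintype.card F := Nat.mul_le_mul_left _ hq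
        omega
      rw [hd', map_mul, map_pow, hatSigma_C, map_pow, ← pow_mul, mul_comm (Fintype.card F), hl,
        pow_add, pow_succ, mul_left_comm, mul_left_comm f] at h
      have h' : (PowerSeries.X - PowerSeries.C ζ) ^ k * d' =
          PowerSeries.C ϖ * (PowerSeries.C ϖ ^ l * (f * hatSigma F R d')) := by
        apply mul_left_cancel₀ (pow_ne_zero m hC)
        rw [h]
        ring
      have h'' : ρ d' = 0 := by
        have := (map_residue_eq_zero_iff hϖ).2 (Dvd.intro _ h'.symm)
        rw [← hρ, map_mul, map_pow, hρp] at this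
        exact (mul_eq_zero_iff_left (pow_ne_zero _ PowerSeries.X_ne_zero)).1 this
      exact hndvd ((map_residue_eq_zero_iff hϖ).1 h'')
  have hb : k = b := by
    have h1 := congrArg (fun x => (ρ (x * (u : R⟦X⟧))).order) h
    have h2 : f * hatSigma F R d * (u : R⟦X⟧) = (PowerSeries.X - PowerSeries.C ζ) ^ b * hatSigma F R d := by
      rw [← hu]; ring
    have hu0 : (ρ (u : R⟦X⟧)).order = 0 := PowerSeries.order_zero_of_unit (u.isUnit.map ρ)
    simp only [h2, map_mul, map_pow, hρp, PowerSeries.order_mul, PowerSeries.order_X_pow, hu0, add_zero] at h1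
    rw [hρ, order_map_hatSigma] at h1
    have h3 := (ENat.add_left_injective_of_ne_top (PowerSeries.order_eq_top.not.2 hcont)) h1
    exact_mod_cast h3
  subst hb
  have h3 : d * (u : R⟦X⟧) = hatSigma F R d := by
    apply mul_left_cancel₀ (pow_ne_zero k hp.ne_zero)
    calc _ = (PowerSeries.X - PowerSeries.C ζ) ^ k * d * (u : R⟦X⟧) := by ring
      _ = f * hatSigma F R d * (u : R⟦X⟧) := by rw [h]
      _ = f * (u : R⟦X⟧) * hatSigma F R d := by ring
      _ = _ := by rw [hu]
  have h4 := congrArg PowerSeries.constantCoeff h3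
  rw [map_mul, constantCoeff_hatSigma, ← Nat.sub_add_cancel hq.le, pow_succ', mul_right_inj' hd] at h4
  have hu' : IsUnit (PowerSeries.constantCoeff (u : R⟦X⟧)) := u.isUnit.map _
  rw [PowerSeries.isUnit_iff_constantCoeff]
  rw [h4] at hu'
  exact (isUnit_pow_iff (by omega)).1 hu'

/-- A nonzero `d ∈ R((z))` for which `d / σ̂(d)` is a unit of `R[[z]][1/(z - ζ)]` is a unit. -/
theorem isUnit_of_mul_eq_mul_hatSigmaLaurent (hζ : ζ ∈ IsLocalRing.maximalIdeal R) {d : R⸨X⸩}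
    {f : R⟦X⟧} {k N : ℕ} (hd : d ≠ 0) (hf : f ∣ (PowerSeries.X - PowerSeries.C ζ) ^ N)
    (h : HahnSeries.ofPowerSeries ℤ R ((PowerSeries.X - PowerSeries.C ζ) ^ k) * d =
      HahnSeries.ofPowerSeries ℤ R f * hatSigmaLaurent F R d) : IsUnit d := by
  -- The power of `z` in `d` is a unit fixed by `σ̂` and cancels; what remains is a power series
  -- with nonzero constant term.
  have hd' := LaurentSeries.single_order_mul_powerSeriesPart d
  set e := d.powerSeriesPart
  set s : R⸨X⸩ := HahnSeries.single d.order 1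
  have hs : IsUnit s := by
    refine IsUnit.of_mul_eq_one (HahnSeries.single (-d.order) 1) ?_
    rw [HahnSeries.single_mul_single]
    simp
  have hσs : hatSigmaLaurent F R s = s := by
    ext n
    change (s.coeff n) ^ Fintype.card F = s.coeff n
    rw [HahnSeries.coeff_single]
    split_ifs
    · exact one_pow _
    · exact zero_pow Fintype.card_ne_zero
  rw [← hd'] at h ⊢
  rw [map_mul, hσs, hatSigmaLaurent, laurentMap_ofPowerSeries, mul_left_comm,
    mul_left_comm _ s, hs.mul_right_inj, ← map_mul, ← map_mul] at h
  refine hs.mul (IsUnit.map _ (isUnit_of_mul_eq_mul_hatSigma (F := F) hζ ?_ hf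
    (HahnSeries.ofPowerSeries_injective h)))
  rw [← PowerSeries.coeff_zero_eq_constantCoeff_apply, LaurentSeries.powerSeriesPart_coeff]
  simpa [HahnSeries.coeff_order_eq_zero] using hd

end RankOne

/-! ### Galois descent for subspaces -/

section Descent

variable {K L : Type*} [Field K] [Field L] [Algebra K L]

/-- A Galois-stable subspace of `L^J` is spanned by its `K`-rational points. -/
theorem mem_span_rational_of_galois_stable [IsGalois K L] {J : Type*} [Fintype J]
    (S : Submodule L (J → L)) (hS : ∀ g : L ≃ₐ[K] L, ∀ v ∈ S, (fun j => g (v j)) ∈ S)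
    (v : J → L) (hv : v ∈ S) :
    v ∈ Submodule.span L {w | w ∈ S ∧ ∃ u : J → K, w = fun j => algebraMap K L (u j)} := by
  classical
  set T := Submodule.span L {w | w ∈ S ∧ ∃ u : J → K, w = fun j => algebraMap K L (u j)}
  let supp : (J → L) → Finset J := fun w => Finset.univ.filter fun j => w j ≠ 0
  have hsupp (w : J → L) (j : J) : j ∈ supp w ↔ w j ≠ 0 := by simp [supp]
  induction hn : (supp v).card using Nat.strong_induction_on generalizing v with
  | _ n ih =>
    subst hn
    by_cases hv0 : v = 0
    · rw [hv0]
      exact T.zero_mem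
    -- Take a nonzero `m ∈ S` of minimal support inside that of `v`, scaled to have an entry `1`.
    -- Then `g m - m` has smaller support and vanishes for every `g`, so the scaled vector is
    -- rational over `K`. Subtracting a multiple of it from `v` shrinks the support of `v`.
    have hex : ∃ n, ∃ m ∈ S, m ≠ 0 ∧ supp m ⊆ supp v ∧ (supp m).card = n :=
      ⟨_, v, hv, hv0, subset_rfl, rfl⟩
    obtain ⟨m, hmS, hm0, hmv, hmc⟩ := Nat.find_spec hex
    have hmin (d : J → L) (hd : d ∈ S) (hdm : supp d ⊂ supp m) : d = 0 := by
      by_contra h0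
      have := Nat.find_min' hex ⟨d, hd, h0, hdm.1.trans hmv, rfl⟩
      rw [← hmc] at this
      exact (Finset.card_lt_card hdm).not_ge this
    obtain ⟨j, hj⟩ := Function.ne_iff.1 hm0
    rw [Pi.zero_apply] at hj
    have hmj : (m j)⁻¹ * m j = 1 := inv_mul_cancel₀ hj
    have hfix (g : L ≃ₐ[K] L) (i : J) : g ((m j)⁻¹ * m i) = (m j)⁻¹ * m i := by
      have h := hmin ((fun i => g (((m j)⁻¹ • m) i)) - (m j)⁻¹ • m)
        (S.sub_mem (hS g _ (S.smul_mem _ hmS)) (S.smul_mem _ hmS)) ?_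
      · exact sub_eq_zero.1 (congrFun h i)
      · refine Finset.ssubset_iff_subset_ne.2 ⟨fun i hi => ?_, fun h => ?_⟩
        · rw [hsupp] at hi ⊢
          contrapose! hi
          simp [hi]
        · have h1 := (hsupp m j).2 hj
          rw [← h, hsupp] at h1
          apply h1
          simp only [Pi.sub_apply, Pi.smul_apply, smul_eq_mul, hmj, map_one, sub_self]
    choose u hu using fun i => (InfiniteGalois.mem_range_algebraMap_iff_fixed ((m j)⁻¹ * m i)).2
      fun g => hfix g i
    have hmT : (m j)⁻¹ • m ∈ T :=
      Submodule.subset_span ⟨S.smul_mem _ hmS, u, funext fun i => (hu i).symm⟩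
    have hvj : v j ≠ 0 := (hsupp v j).1 (hmv ((hsupp m j).2 hj))
    have hd := ih _ (Finset.card_lt_card ?_) (v - v j • (m j)⁻¹ • m)
      (S.sub_mem hv (S.smul_mem _ (S.smul_mem _ hmS))) rfl
    · simpa using T.add_mem hd (T.smul_mem (v j) hmT)
    · refine Finset.ssubset_iff_subset_ne.2 ⟨fun i hi => ?_, fun h => ?_⟩
      · rw [hsupp] at hi ⊢
        contrapose! hi
        have hmi : m i = 0 := by
          by_contra h
          exact (hsupp v i).1 (hmv ((hsupp m i).2 h)) hi
        simp [hi, hmi]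
      · have h1 := (hsupp v j).2 hvj
        rw [← h, hsupp] at h1
        apply h1
        simp only [Pi.sub_apply, Pi.smul_apply, smul_eq_mul, hmj, mul_one, sub_self]

end Descent

/-! ### Laurent series with bounded poles -/

section Bounded

variable {S : Type*} [CommRing S]

/-- `VanishBelow a x` means `x ∈ z^a S[[z]]`. -/
def VanishBelow (a : ℤ) (x : S⸨X⸩) : Prop := ∀ n < a, x.coeff n = 0

theorem VanishBelow.exists_eq {a : ℤ} {x : S⸨X⸩} (h : VanishBelow a x) :
    ∃ y : S⟦X⟧, x = HahnSeries.single a 1 * HahnSeries.ofPowerSeries ℤ S y := by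
  refine ⟨PowerSeries.mk fun n => x.coeff (a + n), ?_⟩
  ext n
  rw [HahnSeries.coeff_single_mul, one_mul, PowerSeries.coeff_coe]
  split_ifs with hn
  · exact h _ (by omega)
  · rw [PowerSeries.coeff_mk]
    congr 1
    omega

theorem vanishBelow_single_mul (a : ℤ) (y : S⟦X⟧) :
    VanishBelow a (HahnSeries.single a 1 * HahnSeries.ofPowerSeries ℤ S y) := by
  intro n hn
  rw [HahnSeries.coeff_single_mul, one_mul, PowerSeries.coeff_coe, if_pos (by omega)]

theorem VanishBelow.mul {a b : ℤ} {x y : S⸨X⸩} (hx : VanishBelow a x) (hy : VanishBelow b y) :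
    VanishBelow (a + b) (x * y) := by
  obtain ⟨x, rfl⟩ := hx.exists_eq
  obtain ⟨y, rfl⟩ := hy.exists_eq
  rw [mul_mul_mul_comm, HahnSeries.single_mul_single, one_mul, ← map_mul]
  exact vanishBelow_single_mul _ _

theorem VanishBelow.mono {a b : ℤ} {x : S⸨X⸩} (hx : VanishBelow a x) (h : b ≤ a) :
    VanishBelow b x := fun n hn => hx n (hn.trans_le h)

theorem VanishBelow.sum {ι : Type*} {s : Finset ι} {a : ℤ} {x : ι → S⸨X⸩}
    (hx : ∀ i ∈ s, VanishBelow a (x i)) : VanishBelow a (∑ i ∈ s, x i) := fun n hn => by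
  rw [HahnSeries.coeff_sum]
  exact Finset.sum_eq_zero fun i hi => hx i hi n hn

theorem vanishBelow_zero_iff {x : S⸨X⸩} :
    VanishBelow 0 x ↔ ∃ y : S⟦X⟧, HahnSeries.ofPowerSeries ℤ S y = x := by
  constructor
  · intro h
    obtain ⟨y, rfl⟩ := h.exists_eq
    exact ⟨y, by rw [HahnSeries.single_zero_one, one_mul]⟩
  · rintro ⟨y, rfl⟩
    have := vanishBelow_single_mul 0 y
    rwa [HahnSeries.single_zero_one, one_mul] at this

theorem exists_vanishBelow (x : S⸨X⸩) : ∃ a : ℕ, VanishBelow (-a) x := by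
  refine ⟨x.order.natAbs, fun n hn => HahnSeries.coeff_eq_zero_of_lt_order ?_⟩
  omega

theorem exists_vanishBelow_family {ι : Type*} [Fintype ι] (x : ι → S⸨X⸩) :
    ∃ a : ℕ, ∀ i, VanishBelow (-a) (x i) := by
  choose a ha using fun i => exists_vanishBelow (x i)
  refine ⟨∑ i, a i, fun i => (ha i).mono ?_⟩
  have := Finset.single_le_sum (fun j _ => Nat.zero_le (a j)) (Finset.mem_univ i)
  omega

/-- The Laurent polynomial with coefficients `u` in degrees `-a, …, a - 1`. -/
noncomputable def laurentOfFin (a : ℕ) (u : Fin (2 * a) → S) : S⸨X⸩ :=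
  ∑ k : Fin (2 * a), HahnSeries.single ((k : ℤ) - a) (u k)

theorem laurentOfFin_coeff (a : ℕ) (u : Fin (2 * a) → S) (k : Fin (2 * a)) :
    (laurentOfFin a u).coeff ((k : ℤ) - a) = u k := by
  rw [laurentOfFin, HahnSeries.coeff_sum, Finset.sum_eq_single k]
  · exact HahnSeries.coeff_single_same _ _
  · intro l _ hl
    refine HahnSeries.coeff_single_of_ne fun h => hl (Fin.ext ?_)
    omega
  · simp

theorem laurentOfFin_vanishBelow (a : ℕ) (u : Fin (2 * a) → S) :
    VanishBelow (-a) (laurentOfFin a u) := by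
  refine VanishBelow.sum fun k _ n hn => HahnSeries.coeff_single_of_ne ?_
  omega

end Bounded

open LocalShtuka.SubShtuka (laurentIncl)

/-! ### Lattices in `L((z))^ι` and their rational points over `R((z))`. -/

section Lattice

variable {R L ι : Type*} [CommRing R] [Field L] [Algebra R L]

instance tower₄ : IsScalarTower R⟦X⟧ L⟦X⟧ L⸨X⸩ := IsScalarTower.of_algebraMap_eq fun _ => rfl

variable (R L ι) in
/-- The inclusion `R((z))^ι → L((z))^ι`. -/
noncomputable def piIncl : (ι → R⸨X⸩) →ₗ[R⟦X⟧] (ι → L⸨X⸩) := (laurentIncl R L).compLeft ι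

theorem piIncl_apply (v : ι → R⸨X⸩) (i : ι) :
    piIncl R L ι v i = laurentMap (algebraMap R L) (v i) := rfl

variable (R) in
/-- The `R((z))`-rational points of an `L[[z]]`-submodule of `L((z))^ι`. -/
noncomputable def rationalPoints (Λ : Submodule L⟦X⟧ (ι → L⸨X⸩)) : Submodule R⟦X⟧ (ι → R⸨X⸩) :=
  (Λ.restrictScalars R⟦X⟧).comap (piIncl R L ι)

theorem mem_rationalPoints {Λ : Submodule L⟦X⟧ (ι → L⸨X⸩)} {v : ι → R⸨X⸩} :
    v ∈ rationalPoints R Λ ↔ piIncl R L ι v ∈ Λ := Iff.rfl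

theorem powerSeries_smul_eq {S : Type*} [CommRing S] (f : S⟦X⟧) (x : S⸨X⸩) :
    f • x = HahnSeries.ofPowerSeries ℤ S f * x := Algebra.smul_def f x

theorem coeff_C_smul {S : Type*} [CommRing S] (c : S) (x : S⸨X⸩) (n : ℤ) :
    ((PowerSeries.C c : S⟦X⟧) • x).coeff n = c * x.coeff n := by
  rw [powerSeries_smul_eq, HahnSeries.ofPowerSeries_C, HahnSeries.C_mul_eq_smul,
    HahnSeries.coeff_smul, smul_eq_mul]

theorem VanishBelow.laurentMap {A B : Type*} [CommRing A] [CommRing B] (f : A →+* B) {a : ℤ}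
    {x : A⸨X⸩} (hx : VanishBelow a x) : VanishBelow a (LocSht.laurentMap f x) := fun n hn => by
  rw [laurentMap_coeff, hx n hn, map_zero]

theorem laurentMap_single {A B : Type*} [CommRing A] [CommRing B] (f : A →+* B) (n : ℤ) (a : A) :
    laurentMap f (HahnSeries.single n a) = HahnSeries.single n (f a) := by
  ext k
  rw [laurentMap_coeff, HahnSeries.coeff_single, HahnSeries.coeff_single, apply_ite f, map_zero]

theorem vanishBelow_single {S : Type*} [CommRing S] (n : ℤ) (a : S) :
    VanishBelow n (HahnSeries.single n a) := fun _ hk =>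
  HahnSeries.coeff_single_of_ne hk.ne

variable [Fintype ι] {a : ℕ} {Λ : Submodule L⟦X⟧ (ι → L⸨X⸩)}

/-- The vectors `z^a eᵢ` are rational, lie in `Λ`, and generate everything that vanishes below `a`.
-/
theorem mem_span_rationalPoints_of_vanishBelow [DecidableEq ι]
    (hhi : ∀ v : ι → L⸨X⸩, (∀ i, VanishBelow a (v i)) → v ∈ Λ)
    (w : ι → L⸨X⸩) (hw : ∀ i, VanishBelow a (w i)) :
    w ∈ Submodule.span L⟦X⟧ (piIncl R L ι '' rationalPoints R Λ) := by
  choose y hy using fun i => (hw i).exists_eq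
  have hsum : w = ∑ i, y i • piIncl R L ι (Pi.single i (HahnSeries.single (a : ℤ) 1)) := by
    ext1 j
    rw [Finset.sum_apply, Finset.sum_eq_single j]
    · rw [Pi.smul_apply, piIncl_apply, Pi.single_eq_same, laurentMap_single, map_one,
        powerSeries_smul_eq, hy, mul_comm]
    · intro i _ hi
      rw [Pi.smul_apply, piIncl_apply, Pi.single_eq_of_ne hi.symm, map_zero, smul_zero]
    · simp
  rw [hsum]
  refine Submodule.sum_mem _ fun i _ => Submodule.smul_mem _ _ (Submodule.subset_span ⟨_, ?_, rfl⟩)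
  refine mem_rationalPoints.2 (hhi _ fun j => VanishBelow.laurentMap _ ?_)
  by_cases h : j = i
  · subst h
    rw [Pi.single_eq_same]
    exact vanishBelow_single _ _
  · rw [Pi.single_eq_of_ne h]
    exact fun _ _ => rfl

/-- A Galois-stable lattice in `L((z))^ι` is spanned by its `R((z))`-rational points. -/
theorem mem_span_rationalPoints [IsDomain R] (K : Type*) [Field K] [Algebra R K]
    [IsFractionRing R K] [Algebra K L] [IsScalarTower R K L] [IsGalois K L]
    (hlo : ∀ v ∈ Λ, ∀ i, VanishBelow (-a) (v i))
    (hhi : ∀ v : ι → L⸨X⸩, (∀ i, VanishBelow a (v i)) → v ∈ Λ)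
    (hgal : ∀ g : L ≃ₐ[K] L, ∀ v ∈ Λ, (fun i => laurentMap (g : L →+* L) (v i)) ∈ Λ)
    (w : ι → L⸨X⸩) (hw : w ∈ Λ) :
    w ∈ Submodule.span L⟦X⟧ (piIncl R L ι '' rationalPoints R Λ) := by
  classical
  -- Recording the coefficients in degrees `-a, …, a - 1` identifies `Λ` modulo `z^a L[[z]]^ι` with
  -- a Galois-stable subspace of a finite-dimensional space, where descent for subspaces applies.
  let Q : Submodule L (ι × Fin (2 * a) → L) :=
    { carrier := {u | ∃ v ∈ Λ, ∀ p, u p = (v p.1).coeff ((p.2 : ℤ) - a)}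
      zero_mem' := ⟨0, Λ.zero_mem, fun _ => rfl⟩
      add_mem' := by
        rintro _ _ ⟨v, hv, h⟩ ⟨v', hv', h'⟩
        exact ⟨v + v', Λ.add_mem hv hv', fun p => by
          rw [Pi.add_apply, h, h', Pi.add_apply, HahnSeries.coeff_add]⟩
      smul_mem' := by
        rintro c _ ⟨v, hv, h⟩
        exact ⟨(PowerSeries.C c : L⟦X⟧) • v, Λ.smul_mem _ hv, fun p => by
          rw [Pi.smul_apply, h, Pi.smul_apply, coeff_C_smul, smul_eq_mul]⟩ }
  have hQ := mem_span_rational_of_galois_stable (K := K) Q (by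
    rintro g u ⟨v, hv, h⟩
    exact ⟨_, hgal g v hv, fun p => congrArg g (h p)⟩)
  -- lifting rational vectors
  have key (u : ι × Fin (2 * a) → L) (hu : u ∈ Q) :
      ∃ y ∈ Submodule.span L⟦X⟧ (piIncl R L ι '' rationalPoints R Λ),
        (∀ i, VanishBelow (-a) (y i)) ∧ ∀ p, u p = (y p.1).coeff ((p.2 : ℤ) - a) := by
    have hu' := hQ u hu
    clear hu
    induction hu' using Submodule.closure_induction with
    | zero => exact ⟨0, Submodule.zero_mem _, fun _ _ _ => rfl, fun _ => rfl⟩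
    | add u u' _ _ h h' =>
      obtain ⟨y, hy, hy1, hy2⟩ := h
      obtain ⟨y', hy', hy1', hy2'⟩ := h'
      refine ⟨y + y', Submodule.add_mem _ hy hy', fun i n hn => ?_, fun p => ?_⟩
      · rw [Pi.add_apply, HahnSeries.coeff_add, hy1 i n hn, hy1' i n hn, add_zero]
      · rw [Pi.add_apply, hy2, hy2', Pi.add_apply, HahnSeries.coeff_add]
    | smul_mem c u hu =>
      obtain ⟨⟨v, hv, hvu⟩, k, rfl⟩ := hu
      -- Descent gives coefficients in `K`; a common denominator `r` moves them into `R`. The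
      -- resulting Laurent polynomial agrees with `r v` modulo `z^a`, hence lies in `Λ`, and `r` is
      -- invertible in `L`.
      obtain ⟨⟨r, hr⟩, hrk⟩ := IsLocalization.exist_integer_multiples_of_finite
        (nonZeroDivisors R) k
      choose k' hk' using hrk
      have hk'' (p) : algebraMap R L (k' p) = algebraMap R L r * algebraMap K L (k p) := by
        rw [IsScalarTower.algebraMap_apply R K L, hk', Algebra.smul_def, map_mul,
          ← IsScalarTower.algebraMap_apply R K L]
      have hr0 : algebraMap R L r ≠ 0 := by
        rw [IsScalarTower.algebraMap_apply R K L, Ne, map_eq_zero_iff _ (algebraMap K L).injective,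
          IsFractionRing.to_map_eq_zero_iff]
        exact nonZeroDivisors.ne_zero hr
      let y₀ : ι → R⸨X⸩ := fun i => laurentOfFin a fun l => k' (i, l)
      have hcoeff (p : ι × Fin (2 * a)) : (piIncl R L ι y₀ p.1).coeff ((p.2 : ℤ) - a) =
          algebraMap R L (k' p) := by
        rw [piIncl_apply, laurentMap_coeff, laurentOfFin_coeff]
      have hy₀ : y₀ ∈ rationalPoints R Λ := by
        rw [mem_rationalPoints]
        have h1 : piIncl R L ι y₀ - (PowerSeries.C (algebraMap R L r) : L⟦X⟧) • v ∈ Λ := by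
          refine hhi _ fun i n hn => ?_
          rw [Pi.sub_apply, HahnSeries.coeff_sub, Pi.smul_apply, coeff_C_smul]
          rcases lt_or_ge n (-a : ℤ) with hn' | hn'
          · rw [hlo v hv i n hn', piIncl_apply,
              (laurentOfFin_vanishBelow _ _).laurentMap _ n hn', mul_zero, sub_zero]
          · obtain ⟨l, rfl⟩ : ∃ l : Fin (2 * a), n = (l : ℤ) - a :=
              ⟨⟨(n + a).toNat, by omega⟩, by simp only; omega⟩
            rw [hcoeff (i, l), ← hvu (i, l), hk'', sub_self]
        simpa using Λ.add_mem h1 (Λ.smul_mem (PowerSeries.C (algebraMap R L r) : L⟦X⟧) hv)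
      refine ⟨(PowerSeries.C (c * (algebraMap R L r)⁻¹) : L⟦X⟧) • piIncl R L ι y₀,
        Submodule.smul_mem _ _ (Submodule.subset_span ⟨y₀, hy₀, rfl⟩), fun i n hn => ?_,
        fun p => ?_⟩
      · rw [Pi.smul_apply, coeff_C_smul, piIncl_apply,
          (laurentOfFin_vanishBelow _ _).laurentMap _ n hn, mul_zero]
      · change c * algebraMap K L (k p) = _
        rw [Pi.smul_apply, coeff_C_smul, hcoeff, hk'', mul_assoc, inv_mul_cancel_left₀ hr0]
  obtain ⟨y, hy, hy1, hy2⟩ := key (fun p => (w p.1).coeff ((p.2 : ℤ) - a)) ⟨w, hw, fun _ => rfl⟩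
  have hd := mem_span_rationalPoints_of_vanishBelow (R := R) hhi (w - y) (fun i n hn => by
    rw [Pi.sub_apply, HahnSeries.coeff_sub]
    rcases lt_or_ge n (-a : ℤ) with hn' | hn'
    · rw [hlo w hw i n hn', hy1 i n hn', sub_zero]
    · obtain ⟨l, rfl⟩ : ∃ l : Fin (2 * a), n = (l : ℤ) - a :=
        ⟨⟨(n + a).toNat, by omega⟩, by simp only; omega⟩
      rw [← hy2 (i, l), sub_self])
  simpa using Submodule.add_mem _ hd hy

variable [IsDomain R] [IsDiscreteValuationRing R] [FaithfulSMul R L]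

theorem laurentMap_injective {A B : Type*} [CommRing A] [CommRing B] {f : A →+* B}
    (hf : Function.Injective f) : Function.Injective (laurentMap f) := fun x y h => by
  ext n
  exact hf (congrArg (fun z => HahnSeries.coeff z n) h)

/-- The rational points lie in `z^(-a) R[[z]]^ι`, a finite module over a Noetherian ring. -/
theorem rationalPoints_finite (hlo : ∀ v ∈ Λ, ∀ i, VanishBelow (-a) (v i)) :
    Module.Finite R⟦X⟧ (rationalPoints R Λ) := by
  classical
  let T : Submodule R⟦X⟧ (ι → R⸨X⸩) := Submodule.span R⟦X⟧
    (Set.range fun i => Pi.single i (HahnSeries.single (-a : ℤ) 1))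
  have hT : rationalPoints R Λ ≤ T := by
    intro v hv
    have hv' (i : ι) : VanishBelow (-a) (v i) := fun n hn => by
      have := hlo _ (mem_rationalPoints.1 hv) i n hn
      rw [piIncl_apply, laurentMap_coeff] at this
      exact (map_eq_zero_iff _ (FaithfulSMul.algebraMap_injective R L)).1 this
    choose y hy using fun i => (hv' i).exists_eq
    have hsum : v = ∑ i, y i • Pi.single (M := fun _ => R⸨X⸩) i (HahnSeries.single (-a : ℤ) 1) := by
      ext1 j
      rw [Finset.sum_apply, Finset.sum_eq_single j]
      · rw [Pi.smul_apply, Pi.single_eq_same, powerSeries_smul_eq, hy, mul_comm]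
      · intro i _ hi
        rw [Pi.smul_apply, Pi.single_eq_of_ne hi.symm, smul_zero]
      · simp
    rw [hsum]
    exact Submodule.sum_mem _ fun i _ => Submodule.smul_mem _ _ (Submodule.subset_span ⟨i, rfl⟩)
  have : IsNoetherian R⟦X⟧ T := isNoetherian_of_fg_of_noetherian _
    (Submodule.fg_span (Set.finite_range _))
  have := isNoetherian_of_le hT
  infer_instance

theorem laurent_X_isUnit (S : Type*) [CommRing S] :
    IsUnit (HahnSeries.ofPowerSeries ℤ S PowerSeries.X) :=
  IsLocalization.map_units S⸨X⸩ (⟨PowerSeries.X, Submonoid.mem_powers _⟩ :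
    Submonoid.powers (PowerSeries.X : S⟦X⟧))

open Pointwise in
/-- The rational points of a lattice in `L((z))^ι` form a free `R[[z]]`-module. -/
theorem rationalPoints_free (hlo : ∀ v ∈ Λ, ∀ i, VanishBelow (-a) (v i)) :
    Module.Free R⟦X⟧ (rationalPoints R Λ) := by
  have hfin := rationalPoints_finite (R := R) hlo
  have hfp := Module.finitePresentation_of_finite R⟦X⟧ (rationalPoints R Λ)
  -- As `z` is regular on the module and lies in the Jacobson radical, freeness can be tested modulo
  -- `z`. There the ring is a quotient of `R`, hence principal, and torsion-freeness suffices.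
  have hdom : IsDomain (R⟦X⟧ ⧸ Ideal.span {(PowerSeries.X : R⟦X⟧)}) := by
    rw [Ideal.Quotient.isDomain_iff_prime]
    exact (Ideal.span_singleton_prime PowerSeries.X_ne_zero).2 PowerSeries.X_prime
  have hpir : IsPrincipalIdealRing (R⟦X⟧ ⧸ Ideal.span {(PowerSeries.X : R⟦X⟧)}) := by
    refine IsPrincipalIdealRing.of_surjective
      ((Ideal.Quotient.mk (Ideal.span {(PowerSeries.X : R⟦X⟧)})).comp PowerSeries.C) ?_
    intro y
    obtain ⟨f, rfl⟩ := Ideal.Quotient.mk_surjective y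
    refine ⟨PowerSeries.constantCoeff f, ?_⟩
    rw [RingHom.comp_apply, Ideal.Quotient.eq, Ideal.mem_span_singleton, PowerSeries.X_dvd_iff]
    simp
  have hreg : IsSMulRegular (rationalPoints R Λ) (PowerSeries.X : R⟦X⟧) := by
    intro x y h
    ext1
    ext1 i
    have := congrFun (congrArg Subtype.val h) i
    simp only [SetLike.val_smul, Pi.smul_apply, powerSeries_smul_eq] at this
    exact (laurent_X_isUnit R).mul_right_inj.1 this
  have hjac : (PowerSeries.X : R⟦X⟧) ∈ (⊥ : Ideal R⟦X⟧).jacobson := by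
    rw [Ideal.mem_jacobson_bot]
    intro y
    rw [PowerSeries.isUnit_iff_constantCoeff]
    simp
  rw [← Module.free_quotSMulTop_iff_free R⟦X⟧ (rationalPoints R Λ) hjac hreg]
  have := Module.Finite.of_restrictScalars_finite R⟦X⟧ (R⟦X⟧ ⧸ Ideal.span {(PowerSeries.X : R⟦X⟧)})
    (QuotSMulTop (PowerSeries.X : R⟦X⟧) (rationalPoints R Λ))
  have : Module.IsTorsionFree (R⟦X⟧ ⧸ Ideal.span {(PowerSeries.X : R⟦X⟧)})
      (QuotSMulTop (PowerSeries.X : R⟦X⟧) (rationalPoints R Λ)) := by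
    rw [Module.isTorsionFree_iff_smul_eq_zero]
    intro f n h
    obtain ⟨f, rfl⟩ := Ideal.Quotient.mk_surjective f
    obtain ⟨n, rfl⟩ := Submodule.mkQ_surjective _ n
    by_cases hf : PowerSeries.constantCoeff f = 0
    · left
      rwa [Ideal.Quotient.eq_zero_iff_mem, Ideal.mem_span_singleton, PowerSeries.X_dvd_iff]
    · right
      change Submodule.Quotient.mk (f • n) = 0 at h
      rw [Submodule.Quotient.mk_eq_zero, Submodule.mem_smul_pointwise_iff_exists] at h
      obtain ⟨n', -, hn'⟩ := h
      obtain ⟨xinv, hx⟩ := (laurent_X_isUnit R).exists_left_inv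
      -- Suppose `f n = z n'` with `f(0) ≠ 0`. Then `f` is a unit in `L[[z]]` and `f · (n/z) = n' ∈
      -- Λ`, so `n/z` is a rational point and `n` is zero modulo `z`.
      have hmem : xinv • (n : ι → R⸨X⸩) ∈ rationalPoints R Λ := by
        rw [mem_rationalPoints]
        have hu : IsUnit (algebraMap R⟦X⟧ L⟦X⟧ f) := by
          rw [PowerSeries.isUnit_iff_constantCoeff]
          change IsUnit (PowerSeries.constantCoeff (PowerSeries.map (algebraMap R L) f))
          rw [← PowerSeries.coeff_zero_eq_constantCoeff_apply, PowerSeries.coeff_map,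
            PowerSeries.coeff_zero_eq_constantCoeff_apply, isUnit_iff_ne_zero, Ne,
            map_eq_zero_iff _ (FaithfulSMul.algebraMap_injective R L)]
          exact hf
        rw [← Submodule.smul_mem_iff_of_isUnit Λ hu, algebraMap_smul, ← map_smul]
        have : f • xinv • (n : ι → R⸨X⸩) = n' := by
          ext1 i
          have h1 := congrFun (congrArg Subtype.val hn') i
          simp only [SetLike.val_smul, Pi.smul_apply, powerSeries_smul_eq, smul_eq_mul] at h1 ⊢
          rw [mul_left_comm, ← h1, ← mul_assoc, hx, one_mul]
        rw [this]
        exact n'.2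
      change Submodule.Quotient.mk n = 0
      rw [Submodule.Quotient.mk_eq_zero, Submodule.mem_smul_pointwise_iff_exists]
      refine ⟨⟨_, hmem⟩, trivial, ?_⟩
      ext1
      ext1 i
      simp only [SetLike.val_smul, Pi.smul_apply, powerSeries_smul_eq, smul_eq_mul]
      rw [← mul_assoc, mul_comm _ xinv, hx, one_mul]
  infer_instance

end Lattice

/-! ### Lattices generated by the columns of a matrix. -/

section MatrixLattice

/-- The inclusion `S[[z]] → S((z))`. -/
noncomputable abbrev psIncl (S : Type*) [CommRing S] : S⟦X⟧ →+* S⸨X⸩ := HahnSeries.ofPowerSeries ℤ S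

theorem psIncl_injective (S : Type*) [CommRing S] : Function.Injective (psIncl S) :=
  HahnSeries.ofPowerSeries_injective

variable {S ι : Type*} [CommRing S] [Fintype ι]

/-- The `S[[z]]`-submodule of `S((z))^ι` generated by the columns of a matrix. -/
noncomputable def latticeOf (X : Matrix ι ι S⸨X⸩) : Submodule S⟦X⟧ (ι → S⸨X⸩) where
  carrier := {v | ∃ w : ι → S⟦X⟧, v = X.mulVec (psIncl S ∘ w)}
  zero_mem' := ⟨0, by
    have : psIncl S ∘ (0 : ι → S⟦X⟧) = 0 := funext fun _ => map_zero _
    rw [this, Matrix.mulVec_zero]⟩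
  add_mem' := by
    rintro _ _ ⟨v, rfl⟩ ⟨w, rfl⟩
    refine ⟨v + w, ?_⟩
    rw [← Matrix.mulVec_add]
    congr 1
    exact funext fun i => (map_add (psIncl S) (v i) (w i)).symm
  smul_mem' := by
    rintro f _ ⟨v, rfl⟩
    refine ⟨f • v, ?_⟩
    rw [← Matrix.mulVec_smul]
    congr 1
    exact funext fun i => by
      rw [Pi.smul_apply, powerSeries_smul_eq]
      exact (map_mul (psIncl S) f (v i)).symm

theorem mem_latticeOf {X : Matrix ι ι S⸨X⸩} {v : ι → S⸨X⸩} :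
    v ∈ latticeOf X ↔ ∃ w : ι → S⟦X⟧, v = X.mulVec (psIncl S ∘ w) := Iff.rfl

theorem col_mem_latticeOf [DecidableEq ι] (X : Matrix ι ι S⸨X⸩) (j : ι) :
    X.col j ∈ latticeOf X := by
  refine ⟨Pi.single j 1, ?_⟩
  have : psIncl S ∘ (Pi.single j 1 : ι → S⟦X⟧) = Pi.single j 1 := by
    ext1 i
    by_cases h : i = j
    · subst h; simp
    · simp [Pi.single_eq_of_ne h]
  rw [this, Matrix.mulVec_single_one]

theorem exists_matrix_of_col_mem {X Z : Matrix ι ι S⸨X⸩} (h : ∀ j, Z.col j ∈ latticeOf X) :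
    ∃ U : Matrix ι ι S⟦X⟧, Z = X * U.map (psIncl S) := by
  choose w hw using h
  refine ⟨Matrix.of fun i j => w j i, ?_⟩
  ext1 i j
  exact congrFun (hw j) i

theorem latticeOf_mul_map (X : Matrix ι ι S⸨X⸩) (U : Matrix ι ι S⟦X⟧) :
    latticeOf (X * U.map (psIncl S)) ≤ latticeOf X := by
  rintro _ ⟨w, rfl⟩
  refine ⟨U.mulVec w, ?_⟩
  rw [← Matrix.mulVec_mulVec]
  congr 1
  ext1 i
  simp [Matrix.mulVec, dotProduct, map_sum]

theorem latticeOf_mul_map_of_isUnit [DecidableEq ι] (X : Matrix ι ι S⸨X⸩) {U : Matrix ι ι S⟦X⟧}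
    (hU : IsUnit U) : latticeOf (X * U.map (psIncl S)) = latticeOf X := by
  refine le_antisymm (latticeOf_mul_map X U) ?_
  obtain ⟨V, hV⟩ := hU.exists_right_inv
  have h := latticeOf_mul_map (X * U.map (psIncl S)) V
  rwa [mul_assoc, ← Matrix.map_mul, hV, Matrix.map_one _ (map_zero _) (map_one _), mul_one] at h

theorem isUnit_of_mul_map_eq [DecidableEq ι] {X Z : Matrix ι ι S⸨X⸩} (hX : IsUnit X)
    {U V : Matrix ι ι S⟦X⟧} (h : Z = X * U.map (psIncl S)) (h' : X = Z * V.map (psIncl S)) :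
    IsUnit U := by
  have h1 : X * ((U * V).map (psIncl S)) = X * 1 := by
    rw [Matrix.map_mul, ← mul_assoc, ← h, ← h', mul_one]
  have h2 := hX.mul_left_cancel h1
  refine IsUnit.of_mul_eq_one V (Matrix.map_injective (psIncl_injective S) ?_)
  exact h2.trans (Matrix.map_one _ (map_zero _) (map_one _)).symm

/-- The entries of `X` bound the poles of lattice vectors, and those of `X⁻¹` show which multiples
of `z` suffice for membership. -/
theorem exists_bounds_latticeOf [DecidableEq ι] (X : Matrix ι ι S⸨X⸩) (hX : IsUnit X) : ∃ a : ℕ,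
    (∀ v ∈ latticeOf X, ∀ i, VanishBelow (-a) (v i)) ∧
      ∀ v : ι → S⸨X⸩, (∀ i, VanishBelow a (v i)) → v ∈ latticeOf X := by
  obtain ⟨Z, hXZ⟩ := hX.exists_right_inv
  obtain ⟨a, ha⟩ := exists_vanishBelow_family fun p : ι × ι => X p.1 p.2
  obtain ⟨b, hb⟩ := exists_vanishBelow_family fun p : ι × ι => Z p.1 p.2
  refine ⟨a + b, ?_, fun v hv => ?_⟩
  · rintro _ ⟨w, rfl⟩ i
    refine VanishBelow.sum fun j _ => ?_
    refine (VanishBelow.mul (ha (i, j)) (vanishBelow_zero_iff.2 ⟨w j, rfl⟩)).mono ?_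
    push_cast
    omega
  · have h (i : ι) : VanishBelow 0 (Z.mulVec v i) := by
      refine VanishBelow.sum fun j _ => ?_
      refine (VanishBelow.mul (hb (i, j)) (hv j)).mono ?_
      push_cast
      omega
    choose w hw using fun i => vanishBelow_zero_iff.1 (h i)
    refine ⟨w, ?_⟩
    rw [show psIncl S ∘ w = Z.mulVec v from funext hw, Matrix.mulVec_mulVec, hXZ,
      Matrix.one_mulVec]

variable {R L : Type*} [CommRing R] [Field L] [Algebra R L]

theorem piIncl_mulVec (Y : Matrix ι ι R⸨X⸩) (w : ι → R⟦X⟧) :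
    piIncl R L ι (Y.mulVec (psIncl R ∘ w)) =
      (Y.map (laurentMap (algebraMap R L))).mulVec
        (psIncl L ∘ fun i => PowerSeries.map (algebraMap R L) (w i)) := by
  ext1 i
  rw [piIncl_apply, Matrix.mulVec, dotProduct, map_sum]
  refine Finset.sum_congr rfl fun j _ => ?_
  rw [map_mul, Function.comp_apply, laurentMap_ofPowerSeries]
  rfl

/-- A Galois-stable lattice in `L((z))^ι` is defined over `R((z))`, and its rational points are a
lattice in `R((z))^ι`. -/
theorem exists_rational_basis [IsDomain R] [IsDiscreteValuationRing R] [FaithfulSMul R L]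
    [DecidableEq ι] (K : Type*) [Field K] [Algebra R K]
    [IsFractionRing R K] [Algebra K L] [IsScalarTower R K L] [IsGalois K L]
    (X : Matrix ι ι L⸨X⸩) (hX : IsUnit X)
    (hgal : ∀ g : L ≃ₐ[K] L, ∀ v ∈ latticeOf X,
      (fun i => laurentMap (g : L →+* L) (v i)) ∈ latticeOf X) :
    ∃ Y : Matrix ι ι R⸨X⸩, IsUnit Y ∧ rationalPoints R (latticeOf X) = latticeOf Y ∧
      ∃ U : Matrix ι ι L⟦X⟧, IsUnit U ∧
        Y.map (laurentMap (algebraMap R L)) = X * U.map (psIncl L) := by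
  obtain ⟨a, hlo, hhi⟩ := exists_bounds_latticeOf X hX
  have hfin := rationalPoints_finite (R := R) hlo
  have hfree := rationalPoints_free (R := R) hlo
  set N := rationalPoints R (latticeOf X) with hN
  let b := Module.Free.chooseBasis R⟦X⟧ N
  -- An `R[[z]]`-basis of the rational points stays independent after inverting `z`, and it spans
  -- because the points contain `z^a eᵢ`. So it is an `R((z))`-basis and can be indexed by `ι`.
  have hli : LinearIndependent R⸨X⸩ fun k => (b k : ι → R⸨X⸩) :=
    LinearIndependent.localization R⸨X⸩ (Submonoid.powers (PowerSeries.X : R⟦X⟧))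
      (b.linearIndependent.map' N.subtype (Submodule.ker_subtype N))
  have hspanN (v : ι → R⸨X⸩) (hv : v ∈ N) :
      v ∈ Submodule.span R⸨X⸩ (Set.range fun k => (b k : ι → R⸨X⸩)) := by
    have h1 := congrArg Subtype.val (b.sum_repr ⟨v, hv⟩)
    simp only [Submodule.coe_sum, SetLike.val_smul] at h1
    rw [← h1]
    refine Submodule.sum_mem _ fun k _ => ?_
    rw [← algebraMap_smul R⸨X⸩]
    exact Submodule.smul_mem _ _ (Submodule.subset_span ⟨k, rfl⟩)
  have hspan : ⊤ ≤ Submodule.span R⸨X⸩ (Set.range fun k => (b k : ι → R⸨X⸩)) := by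
    rw [← (Pi.basisFun R⸨X⸩ ι).span_eq, Submodule.span_le]
    rintro _ ⟨i, rfl⟩
    have hmem : Pi.single i (HahnSeries.single (a : ℤ) 1) ∈ N := by
      refine mem_rationalPoints.2 (hhi _ fun j => VanishBelow.laurentMap _ ?_)
      by_cases h : j = i
      · subst h
        rw [Pi.single_eq_same]
        exact vanishBelow_single _ _
      · rw [Pi.single_eq_of_ne h]
        exact fun _ _ => rfl
    have heq : Pi.basisFun R⸨X⸩ ι i = (HahnSeries.single (-a : ℤ) 1 : R⸨X⸩) •
        Pi.single (M := fun _ => R⸨X⸩) i (HahnSeries.single (a : ℤ) 1) := by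
      ext1 j
      rw [Pi.basisFun_apply, Pi.smul_apply]
      by_cases h : j = i
      · subst h
        rw [Pi.single_eq_same, Pi.single_eq_same, smul_eq_mul, HahnSeries.single_mul_single]
        simp
      · rw [Pi.single_eq_of_ne h, Pi.single_eq_of_ne h, smul_zero]
    rw [SetLike.mem_coe, heq]
    exact Submodule.smul_mem _ _ (hspanN _ hmem)
  let b₀ := Module.Basis.mk hli hspan
  let e := b₀.indexEquiv (Pi.basisFun R⸨X⸩ ι)
  let b₁ := b₀.reindex e
  let b₂ := b.reindex e
  have hb (j : ι) : b₁ j = (b₂ j : ι → R⸨X⸩) := by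
    simp [b₁, b₂, b₀]
  let Y : Matrix ι ι R⸨X⸩ := Matrix.of fun i j => b₁ j i
  have hY : IsUnit Y := by
    rw [Matrix.isUnit_iff_isUnit_det]
    have := (Pi.basisFun R⸨X⸩ ι).isUnit_det b₁
    rwa [Module.Basis.det_apply] at this
  have hmem (w : ι → R⟦X⟧) : Y.mulVec (psIncl R ∘ w) = (∑ j, w j • b₂ j : N) := by
    ext1 i
    simp only [Submodule.coe_sum, SetLike.val_smul, Finset.sum_apply, Pi.smul_apply, ← hb,
      powerSeries_smul_eq]
    exact Finset.sum_congr rfl fun j _ => mul_comm _ _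
  have hNY : N = latticeOf Y := by
    ext v
    rw [mem_latticeOf]
    constructor
    · intro hv
      refine ⟨b₂.repr ⟨v, hv⟩, ?_⟩
      rw [hmem, b₂.sum_repr]
    · rintro ⟨w, rfl⟩
      rw [hmem]
      exact Subtype.property _
  set YL := Y.map (laurentMap (algebraMap R L)) with hYL
  obtain ⟨U, hU⟩ : ∃ U : Matrix ι ι L⟦X⟧, YL = X * U.map (psIncl L) := by
    refine exists_matrix_of_col_mem fun j => ?_
    have : Y.col j ∈ N := hNY ▸ col_mem_latticeOf Y j
    exact mem_rationalPoints.1 this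
  -- The rational points lie in the lattice of `X` by definition; that they generate it over
  -- `L[[z]]` is Galois descent.
  obtain ⟨V, hV⟩ : ∃ V : Matrix ι ι L⟦X⟧, X = YL * V.map (psIncl L) := by
    refine exists_matrix_of_col_mem fun j => ?_
    have h1 := mem_span_rationalPoints (R := R) K hlo hhi hgal _ (col_mem_latticeOf X j)
    refine (Submodule.span_le.2 ?_) h1
    rintro _ ⟨v, hv, rfl⟩
    rw [← hN, hNY] at hv
    obtain ⟨w, rfl⟩ := hv
    exact ⟨_, piIncl_mulVec Y w⟩
  exact ⟨Y, hY, hNY, U, isUnit_of_mul_map_eq hX hU hV, hU⟩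

end MatrixLattice

open LocalShtuka (toAway)

/-! ### Localization at `z - ζ` and its embedding into `L[[z]]`. -/

section Away

variable {R L : Type*} [CommRing R] [Field L] [Algebra R L] {ζ : R} (hζ : algebraMap R L ζ ≠ 0)

theorem isUnit_algebraMap_X_sub_C (hζ : algebraMap R L ζ ≠ 0) :
    IsUnit (algebraMap R⟦X⟧ L⟦X⟧ (PowerSeries.X - PowerSeries.C ζ)) := by
  rw [PowerSeries.isUnit_iff_constantCoeff, isUnit_iff_ne_zero]
  change PowerSeries.constantCoeff (PowerSeries.map (algebraMap R L) _) ≠ 0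
  rw [map_sub, PowerSeries.map_X, PowerSeries.map_C, map_sub, PowerSeries.constantCoeff_X,
    PowerSeries.constantCoeff_C, zero_sub]
  exact neg_ne_zero.2 hζ

/-- The embedding `R[[z]][1/(z - ζ)] → L[[z]]`. -/
noncomputable def awayEval : AwayRing ζ →+* L⟦X⟧ :=
  IsLocalization.Away.lift (PowerSeries.X - PowerSeries.C ζ : R⟦X⟧) (isUnit_algebraMap_X_sub_C hζ)

theorem awayEval_algebraMap (f : R⟦X⟧) :
    awayEval hζ (algebraMap R⟦X⟧ (AwayRing ζ) f) = PowerSeries.map (algebraMap R L) f :=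
  IsLocalization.Away.lift_eq _ _ _

theorem awayEval_smul (f : R⟦X⟧) (s : AwayRing ζ) :
    awayEval hζ (f • s) = f • awayEval hζ s := by
  rw [Algebra.smul_def, map_mul, awayEval_algebraMap, Algebra.smul_def]
  rfl

theorem awayEval_injective [FaithfulSMul R L] : Function.Injective (awayEval hζ) := by
  refine (injective_iff_map_eq_zero _).2 fun s hs => ?_
  obtain ⟨n, a, h⟩ := IsLocalization.Away.surj (PowerSeries.X - PowerSeries.C ζ : R⟦X⟧) s
  have hu : IsUnit (algebraMap R⟦X⟧ (AwayRing ζ) (PowerSeries.X - PowerSeries.C ζ) ^ n) :=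
    (IsLocalization.Away.algebraMap_isUnit _).pow n
  have h1 := congrArg (awayEval hζ) h
  rw [map_mul, hs, zero_mul, awayEval_algebraMap] at h1
  have ha : a = 0 := PowerSeries.map_injective _ (FaithfulSMul.algebraMap_injective R L)
    (by rw [← h1, map_zero])
  rw [ha, map_zero] at h
  exact hu.mul_left_eq_zero.1 h

variable {ι : Type*} {Q : Type*} [AddCommGroup Q] [Module R⟦X⟧ Q]

/-- The extension of a linear map `Q → L((z))^ι` to `Q[1/(z - ζ)]`. -/
noncomputable def awayLift (j : Q →ₗ[R⟦X⟧] (ι → L⸨X⸩)) : AwayModule ζ Q →ₗ[R⟦X⟧] (ι → L⸨X⸩) :=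
  TensorProduct.lift <| LinearMap.mk₂ R⟦X⟧ (fun s q => awayEval hζ s • j q)
    (fun s t q => by rw [map_add, add_smul])
    (fun f s q => by rw [awayEval_smul, smul_assoc])
    (fun s q q' => by rw [map_add, smul_add])
    (fun f s q => by rw [map_smul, smul_comm])

theorem awayLift_tmul (j : Q →ₗ[R⟦X⟧] (ι → L⸨X⸩)) (s : AwayRing ζ) (q : Q) :
    awayLift hζ j (s ⊗ₜ q) = awayEval hζ s • j q := rfl

theorem awayLift_toAway (j : Q →ₗ[R⟦X⟧] (ι → L⸨X⸩)) (q : Q) :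
    awayLift hζ j (toAway ζ Q q) = j q := by
  rw [TensorProduct.mk_apply, awayLift_tmul, map_one, one_smul]

theorem awayLift_lTensor {Q' : Type*} [AddCommGroup Q'] [Module R⟦X⟧ Q']
    (j : Q' →ₗ[R⟦X⟧] (ι → L⸨X⸩)) (f : Q →ₗ[R⟦X⟧] Q') (x : AwayModule ζ Q) :
    awayLift hζ j (f.lTensor (AwayRing ζ) x) = awayLift hζ (j ∘ₗ f) x := by
  induction x using TensorProduct.induction_on with
  | zero => simp
  | add x y hx hy => simp only [map_add, hx, hy]
  | tmul s q => rw [LinearMap.lTensor_tmul, awayLift_tmul, awayLift_tmul]; rfl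

/-- A power of `z - ζ` clears the denominator of an element. This allows equations in `Q[1/(z - ζ)]`
to be checked as equations between column vectors over `L((z))`. -/
theorem awayLift_injective {j : Q →ₗ[R⟦X⟧] (ι → L⸨X⸩)} (hj : Function.Injective j) :
    Function.Injective (awayLift hζ j) := by
  refine (injective_iff_map_eq_zero _).2 fun x hx => ?_
  obtain ⟨⟨q, s⟩, h⟩ := IsLocalizedModule.surj
    (Submonoid.powers (PowerSeries.X - PowerSeries.C ζ : R⟦X⟧)) (toAway ζ Q) x
  have h1 := congrArg (awayLift hζ j) h
  rw [Submonoid.smul_def, map_smul, hx, smul_zero, awayLift_toAway] at h1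
  have hq : q = 0 := hj (by rw [← h1, map_zero])
  rw [hq, map_zero] at h
  exact IsLocalizedModule.smul_injective (toAway ζ Q) s (h.trans (smul_zero s).symm)

end Away

/-! ### The semilinear map of a local shtuka in coordinates. -/

section Coordinates

variable {R : Type*} [CommRing R] (L : Type*) [Field L] [Algebra R L]
  {ι : Type*} [Fintype ι] {M : Type*} [AddCommGroup M] [Module R⟦X⟧ M]
  (b : Module.Basis ι R⟦X⟧ M)

/-- Coordinates on `M ⊗ L((z))` with respect to a basis of `M`. -/
noncomputable def coords : L⸨X⸩ ⊗[R⟦X⟧] M ≃ₗ[L⸨X⸩] (ι → L⸨X⸩) := (b.baseChange L⸨X⸩).equivFun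

theorem coords_tmul (c : L⸨X⸩) (m : M) (i : ι) : coords L b (c ⊗ₜ m) i = b.repr m i • c :=
  Module.Basis.baseChange_repr_tmul _ _ _ _ _

/-- `coords` as a map which is linear over `R[[z]]`. -/
noncomputable def coordsLin : L⸨X⸩ ⊗[R⟦X⟧] M →ₗ[R⟦X⟧] (ι → L⸨X⸩) :=
  (coords L b).toLinearMap.restrictScalars R⟦X⟧

theorem coordsLin_apply (x : L⸨X⸩ ⊗[R⟦X⟧] M) : coordsLin L b x = coords L b x := rfl

variable (F : Type*) [Field F] [Fintype F] [Algebra F R] [Algebra F L] [IsScalarTower F R L]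
  [DecidableEq ι]

/-- The `σ̂`-semilinear action on column vectors. -/
noncomputable def sigmaVec (w : ι → L⸨X⸩) : ι → L⸨X⸩ := fun i => hatSigmaLaurent F L (w i)

variable {F L}
variable {ζ : R} (hζ : algebraMap R L ζ ≠ 0) (P : LocalShtuka F ζ M)

/-- The matrix of `τ` with respect to a basis. -/
noncomputable def tauMatrix : Matrix ι ι (AwayRing ζ) :=
  (b.baseChange (AwayRing ζ)).toMatrix fun j => P.phi (b j)

/-- The matrix of `τ` over `L((z))`. -/
noncomputable def frobMatrix : Matrix ι ι L⸨X⸩ :=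
  (tauMatrix b P).map ((psIncl L).comp (awayEval hζ))

theorem awayLift_coords_one (y : AwayModule ζ M) (i : ι) :
    awayLift hζ (coordsLin L b ∘ₗ TensorProduct.mk R⟦X⟧ L⸨X⸩ M 1) y i =
      psIncl L (awayEval hζ ((b.baseChange (AwayRing ζ)).repr y i)) := by
  induction y using TensorProduct.induction_on with
  | zero => simp
  | add x y hx hy => rw [map_add, Pi.add_apply, hx, hy, map_add, Finsupp.add_apply, map_add, map_add]
  | tmul s m =>
    rw [awayLift_tmul, Module.Basis.baseChange_repr_tmul, awayEval_smul, Pi.smul_apply,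
      LinearMap.comp_apply, TensorProduct.mk_apply, coordsLin_apply, coords_tmul,
      powerSeries_smul_eq, Algebra.smul_def, mul_one, Algebra.smul_def, map_mul, mul_comm]
    rfl

theorem awayLift_smul_left (c : L⸨X⸩) (y : AwayModule ζ M) :
    awayLift hζ (coordsLin L b ∘ₗ TensorProduct.mk R⟦X⟧ L⸨X⸩ M c) y =
      c • awayLift hζ (coordsLin L b ∘ₗ TensorProduct.mk R⟦X⟧ L⸨X⸩ M 1) y := by
  induction y using TensorProduct.induction_on with
  | zero => simp
  | add x y hx hy => rw [map_add, hx, hy, map_add, smul_add]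
  | tmul s m =>
    rw [awayLift_tmul, awayLift_tmul, smul_comm c]
    congr 1
    ext1 i
    simp only [LinearMap.comp_apply, TensorProduct.mk_apply, coordsLin_apply, Pi.smul_apply,
      coords_tmul, smul_eq_mul]
    rw [mul_smul_comm, mul_one]

theorem hatSigmaLaurent_algebraMap (f : R⟦X⟧) :
    hatSigmaLaurent F L (algebraMap R⟦X⟧ L⸨X⸩ f) = algebraMap R⟦X⟧ L⸨X⸩ (hatSigma F R f) :=
  HatSigmaAlgebra.sigma_algebraMap (F := F) (R := R) (C := L⸨X⸩) f

theorem awayLift_phi (m : M) :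
    awayLift hζ (coordsLin L b ∘ₗ TensorProduct.mk R⟦X⟧ L⸨X⸩ M 1) (P.phi m) =
      (frobMatrix b hζ P).mulVec (sigmaVec L F (coords L b (1 ⊗ₜ m))) := by
  conv_lhs => rw [← b.sum_repr m, map_sum, map_sum]
  ext1 i
  rw [Finset.sum_apply, Matrix.mulVec, dotProduct]
  refine Finset.sum_congr rfl fun j _ => ?_
  rw [map_smulₛₗ, map_smul, Pi.smul_apply, awayLift_coords_one, sigmaVec, coords_tmul,
    Algebra.smul_def, Algebra.smul_def, mul_one, hatSigmaLaurent_algebraMap, mul_comm]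
  rfl

/-- The semilinear map `m ↦ τ(σ̂^* m)` in coordinates. -/
theorem awayLift_phiExt (x : L⸨X⸩ ⊗[R⟦X⟧] M) :
    awayLift hζ (coordsLin L b) (P.phiExt L⸨X⸩ x) =
      (frobMatrix b hζ P).mulVec (sigmaVec L F (coords L b x)) := by
  induction x with
  | zero =>
    have : sigmaVec L F (0 : ι → L⸨X⸩) = 0 := funext fun _ => map_zero _
    simp [this]
  | add x y hx hy =>
    have (v w : ι → L⸨X⸩) : sigmaVec L F (v + w) = sigmaVec L F v + sigmaVec L F w :=
      funext fun _ => map_add _ _ _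
    rw [map_add, map_add, hx, hy, map_add, this, Matrix.mulVec_add]
  | tmul c m =>
    rw [LocalShtuka.phiExt_tmul, awayLift_lTensor, awayLift_smul_left, awayLift_phi,
      ← Matrix.mulVec_smul]
    congr 1
    ext1 i
    rw [Pi.smul_apply, sigmaVec, sigmaVec, coords_tmul, coords_tmul,
      Algebra.smul_def (b.repr m i) (1 : L⸨X⸩), Algebra.smul_def (b.repr m i) c, mul_one, map_mul,
      smul_eq_mul, mul_comm]
    rfl

theorem coordsLin_injective : Function.Injective (coordsLin L b) := (coords L b).injective

/-- Membership in `V̌` in coordinates. -/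
theorem mem_rationalTateModule_iff (x : L⸨X⸩ ⊗[R⟦X⟧] M) :
    x ∈ P.rationalTateModule L ↔
      (frobMatrix b hζ P).mulVec (sigmaVec L F (coords L b x)) = coords L b x := by
  rw [LocalShtuka.mem_rationalTateModule, ← awayLift_phiExt,
    ← (awayLift_injective hζ (coordsLin_injective b)).eq_iff, awayLift_toAway]
  rfl

variable (R L) in
/-- The inclusion `L[[z]] → L((z))`, linear over `R[[z]]`. -/
noncomputable def psInclLin : L⟦X⟧ →ₗ[R⟦X⟧] L⸨X⸩ :=
  (Algebra.linearMap L⟦X⟧ L⸨X⸩).restrictScalars R⟦X⟧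

theorem phiExt_psIncl (x : L⟦X⟧ ⊗[R⟦X⟧] M) : P.phiExt L⸨X⸩ ((psInclLin R L).rTensor M x) =
    ((psInclLin R L).rTensor M).lTensor (AwayRing ζ) (P.phiExt L⟦X⟧ x) :=
  P.phiExt_rTensor _ _ (fun c => laurentMap_ofPowerSeries _ c) x

/-- Coordinates on `M ⊗ L[[z]]`. -/
noncomputable def coordsPS (b : Module.Basis ι R⟦X⟧ M) : L⟦X⟧ ⊗[R⟦X⟧] M ≃ₗ[L⟦X⟧] (ι → L⟦X⟧) :=
  (b.baseChange L⟦X⟧).equivFun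

theorem coords_rTensor_psIncl (x : L⟦X⟧ ⊗[R⟦X⟧] M) (i : ι) :
    coords L b ((psInclLin R L).rTensor M x) i = psIncl L (coordsPS b x i) := by
  induction x with
  | zero => simp
  | add x y hx hy => simp only [map_add, Pi.add_apply, hx, hy]
  | tmul c m =>
    rw [LinearMap.rTensor_tmul, coords_tmul, ← map_smul, coordsPS, Module.Basis.equivFun_apply,
      Module.Basis.baseChange_repr_tmul]
    rfl

/-- Membership in `Ť` in coordinates. -/
theorem mem_tateModule_iff (x : L⟦X⟧ ⊗[R⟦X⟧] M) :
    x ∈ P.tateModule L ↔ ((tauMatrix b P).map (awayEval hζ)).mulVec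
      (fun i => hatSigma F L (coordsPS b x i)) = coordsPS b x := by
  have hfree := P.free
  -- The free module `M` is flat, so `L[[z]] ⊗ M` embeds into `L((z)) ⊗ M` and the computation over
  -- Laurent series can be reused.
  have hinj : Function.Injective (coordsLin L b ∘ₗ (psInclLin R L).rTensor M) :=
    (coordsLin_injective b).comp
      (Module.Flat.rTensor_preserves_injective_linearMap _ (psIncl_injective L))
  have h1 (x : L⟦X⟧ ⊗[R⟦X⟧] M) : (coordsLin L b ∘ₗ (psInclLin R L).rTensor M) x =
      psIncl L ∘ coordsPS b x := funext fun i => coords_rTensor_psIncl b x i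
  change P.phiExt L⟦X⟧ x = _ ↔ _
  rw [← (awayLift_injective hζ hinj).eq_iff, awayLift_toAway, ← awayLift_lTensor, ← phiExt_psIncl,
    awayLift_phiExt, h1, ← (psIncl_injective L).comp_left.eq_iff]
  have h2 : (frobMatrix b hζ P).mulVec (sigmaVec L F (coords L b ((psInclLin R L).rTensor M x))) =
      psIncl L ∘ ((tauMatrix b P).map (awayEval hζ)).mulVec
        (fun i => hatSigma F L (coordsPS b x i)) := by
    ext1 i
    rw [Function.comp_apply, Matrix.mulVec, Matrix.mulVec, dotProduct, dotProduct, map_sum]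
    refine Finset.sum_congr rfl fun j _ => ?_
    rw [map_mul, sigmaVec, coords_rTensor_psIncl]
    congr 1
    exact laurentMap_ofPowerSeries _ _
  rw [h2]

end Coordinates

/-! ### Local shtukas and invertible matrices over `R[[z]][1/(z - ζ)]`. -/

section TauMatrix

variable {F : Type*} [Field F] [Fintype F] {R : Type*} [CommRing R] [Algebra F R]
  {ι : Type*} [Fintype ι] {M : Type*} [AddCommGroup M] [Module R⟦X⟧ M]
  (b : Module.Basis ι R⟦X⟧ M) {ζ : R}

variable (F) in
/-- The basis of `σ̂^* M` which is induced by a basis of `M`. -/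
noncomputable def pullbackBasis : Module.Basis ι R⟦X⟧ (HatSigmaPullback F (R := R) M) :=
  show Module.Basis ι (Twist F R) (Twist F R ⊗[R⟦X⟧] M) from b.baseChange (Twist F R)

theorem pullbackBasis_apply (i : ι) : pullbackBasis F b i = toPullback F (b i) :=
  Module.Basis.baseChange_apply (Twist F R) b i

theorem phi_eq_tau (P : LocalShtuka F ζ M) (i : ι) :
    P.phi (b i) = P.tau ((pullbackBasis F b).baseChange (AwayRing ζ) i) := by
  rw [Module.Basis.baseChange_apply, pullbackBasis_apply]
  rfl

/-- The columns are the images under the isomorphism `τ` of the basis of `σ̂^* M` induced by `b`, so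
they form a basis. -/
theorem isUnit_tauMatrix [DecidableEq ι] (P : LocalShtuka F ζ M) : IsUnit (tauMatrix b P) := by
  have h : (fun j => P.phi (b j)) = ((pullbackBasis F b).baseChange (AwayRing ζ)).map P.tau := by
    ext1 j
    rw [Module.Basis.map_apply, phi_eq_tau]
  rw [tauMatrix, h, Matrix.isUnit_iff_isUnit_det]
  have := (b.baseChange (AwayRing ζ)).isUnit_det
    (((pullbackBasis F b).baseChange (AwayRing ζ)).map P.tau)
  rwa [Module.Basis.det_apply] at this

theorem LocalShtuka.ext_of_phi (P P' : LocalShtuka F ζ M) (h : ∀ m, P.phi m = P'.phi m) :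
    P = P' := by
  have hfree := P.free
  have hfin := P.finite
  let b := Module.Free.chooseBasis R⟦X⟧ M
  have ht : P.tau = P'.tau := by
    refine LinearEquiv.toLinearMap_injective
      (((pullbackBasis F b).baseChange (AwayRing ζ)).ext fun i => ?_)
    exact (phi_eq_tau b P i).symm.trans ((h _).trans (phi_eq_tau b P' i))
  cases P
  cases P'
  congr

theorem exists_localShtuka_tauMatrix [DecidableEq ι] (B : Matrix ι ι (AwayRing ζ))
    (hB : IsUnit B) : ∃ P : LocalShtuka F ζ M, tauMatrix b P = B := by
  let e := b.baseChange (AwayRing ζ)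
  have hdet := (Matrix.isUnit_iff_isUnit_det B).1 hB
  let t : AwayModule ζ (HatSigmaPullback F (R := R) M) ≃ₗ[AwayRing ζ] AwayModule ζ M :=
    (((pullbackBasis F b).baseChange (AwayRing ζ)).equiv e (Equiv.refl ι)).trans
      (Matrix.toLinearEquiv e B hdet)
  let P : LocalShtuka F ζ M := ⟨Module.Free.of_basis b, Module.Finite.of_basis b, t⟩
  refine ⟨P, ?_⟩
  ext1 i j
  have h1 : P.phi (b j) = ∑ k, B k j • e k := by
    rw [phi_eq_tau]
    change Matrix.toLin e e B (((pullbackBasis F b).baseChange (AwayRing ζ)).equiv e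
      (Equiv.refl ι) _) = _
    rw [Module.Basis.equiv_apply, Equiv.refl_apply, Matrix.toLin_self]
  rw [tauMatrix, Module.Basis.toMatrix_apply, h1, e.repr_sum_self]

end TauMatrix

/-! ### Submodules of `M[1/z]` and sub-shtukas in coordinates. -/

section SubShtuka

variable {R : Type*} [CommRing R] {L : Type*} [Field L] [Algebra R L]
  {ι : Type*} [Fintype ι] [DecidableEq ι] {M : Type*} [AddCommGroup M] [Module R⟦X⟧ M]
  (b : Module.Basis ι R⟦X⟧ M)
  {F : Type*} [Field F] [Fintype F] [Algebra F R] [Algebra F L] [IsScalarTower F R L]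
  {ζ : R} (hζ : algebraMap R L ζ ≠ 0) {P : LocalShtuka F ζ M}

/-- Coordinates on `M[1/z]`. -/
noncomputable def coordsR (b : Module.Basis ι R⟦X⟧ M) :
    R⸨X⸩ ⊗[R⟦X⟧] M ≃ₗ[R⸨X⸩] (ι → R⸨X⸩) :=
  (b.baseChange R⸨X⸩).equivFun

theorem coords_laurentIncl (x : R⸨X⸩ ⊗[R⟦X⟧] M) :
    coords L b ((laurentIncl R L).rTensor M x) = piIncl R L ι (coordsR b x) := by
  induction x using TensorProduct.induction_on with
  | zero => simp
  | add x y hx hy => simp only [map_add, hx, hy]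
  | tmul c m =>
    ext1 i
    rw [LinearMap.rTensor_tmul, coords_tmul, ← map_smul, coordsR, piIncl_apply,
      Module.Basis.equivFun_apply, Module.Basis.baseChange_repr_tmul]
    rfl

theorem phiExt_laurentIncl (P : LocalShtuka F ζ M) (x : R⸨X⸩ ⊗[R⟦X⟧] M) :
    P.phiExt L⸨X⸩ ((laurentIncl R L).rTensor M x) =
      ((laurentIncl R L).rTensor M).lTensor (AwayRing ζ) (P.phiExt R⸨X⸩ x) := by
  refine P.phiExt_rTensor _ _ (fun c => ?_) x
  ext k
  change (algebraMap R L _) ^ _ = algebraMap R L (_ ^ _)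
  rw [map_pow]

/-- The matrix of a basis of a submodule of `M[1/z]`. -/
noncomputable def carrierMatrix {N : Submodule R⟦X⟧ (R⸨X⸩ ⊗[R⟦X⟧] M)}
    (n : Module.Basis ι R⟦X⟧ N) : Matrix ι ι R⸨X⸩ := Matrix.of fun i j => coordsR b (n j) i

variable (L) in
/-- A matrix over `R((z))`, regarded as a matrix over `L((z))`. -/
noncomputable def matIncl (Y : Matrix ι ι R⸨X⸩) : Matrix ι ι L⸨X⸩ :=
  Y.map (laurentMap (algebraMap R L))

theorem coordsR_eq_mulVec {N : Submodule R⟦X⟧ (R⸨X⸩ ⊗[R⟦X⟧] M)} (n : Module.Basis ι R⟦X⟧ N)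
    (x : N) : coordsR b x = (carrierMatrix b n).mulVec (psIncl R ∘ n.repr x) := by
  have h := congrArg (fun y : N => coordsR b y) (n.sum_repr x)
  simp only [Submodule.coe_sum, SetLike.val_smul, map_sum] at h
  rw [← h]
  ext1 i
  rw [Finset.sum_apply]
  refine Finset.sum_congr rfl fun j _ => ?_
  rw [← algebraMap_smul R⸨X⸩, map_smul, Pi.smul_apply, smul_eq_mul, mul_comm]
  rfl

theorem carrier_eq_comap {N : Submodule R⟦X⟧ (R⸨X⸩ ⊗[R⟦X⟧] M)} (n : Module.Basis ι R⟦X⟧ N)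
    (x : R⸨X⸩ ⊗[R⟦X⟧] M) : x ∈ N ↔ coordsR b x ∈ latticeOf (carrierMatrix b n) := by
  constructor
  · intro hx
    exact ⟨_, coordsR_eq_mulVec b n ⟨x, hx⟩⟩
  · rintro ⟨w, hw⟩
    have h1 := coordsR_eq_mulVec b n (n.equivFun.symm w)
    have h2 : (n.repr (n.equivFun.symm w) : ι → R⟦X⟧) = w := n.equivFun.apply_symm_apply w
    rw [h2, ← hw] at h1
    rw [← (coordsR b).injective h1]
    exact Subtype.property _

theorem awayLift_eq_mulVec {Q : Type*} [AddCommGroup Q] [Module R⟦X⟧ Q] (n : Module.Basis ι R⟦X⟧ Q)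
    (Y : Matrix ι ι L⸨X⸩) (j : Q →ₗ[R⟦X⟧] (ι → L⸨X⸩))
    (hj : ∀ x, j x = Y.mulVec fun k => psIncl L (PowerSeries.map (algebraMap R L) (n.repr x k)))
    (y : AwayModule ζ Q) : awayLift hζ j y =
      Y.mulVec fun k => psIncl L (awayEval hζ ((n.baseChange (AwayRing ζ)).repr y k)) := by
  induction y using TensorProduct.induction_on with
  | zero =>
    rw [map_zero, map_zero]
    simp only [Finsupp.zero_apply, map_zero]
    exact Y.mulVec_zero.symm
  | add x y hx hy =>
    rw [map_add, hx, hy, ← Matrix.mulVec_add, map_add]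
    congr 1
    ext1 k
    rw [Pi.add_apply, Finsupp.add_apply, map_add, map_add]
  | tmul s x =>
    have hs (v : ι → L⸨X⸩) : awayEval hζ s • v = psIncl L (awayEval hζ s) • v :=
      funext fun i => powerSeries_smul_eq _ _
    rw [awayLift_tmul, hj, hs, ← Matrix.mulVec_smul]
    congr 1
    ext1 k
    rw [Pi.smul_apply, smul_eq_mul, Module.Basis.baseChange_repr_tmul, Algebra.smul_def, map_mul,
      awayEval_algebraMap, map_mul, mul_comm]

/-- The compatibility of `τ_N` with `τ_M` in coordinates. -/
theorem frobMatrix_mul_sigma (N : P.SubShtuka) (n : Module.Basis ι R⟦X⟧ N.carrier) :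
    frobMatrix b hζ P * (matIncl L (carrierMatrix b n)).map (hatSigmaLaurent F L) =
      matIncl L (carrierMatrix b n) * frobMatrix n hζ N.shtuka := by
  ext1 i j
  have h1 := congrArg (awayLift hζ (coordsLin L b ∘ₗ (laurentIncl R L).rTensor M))
    (N.compat (n j))
  have h2 := awayLift_eq_mulVec hζ n (matIncl L (carrierMatrix b n))
    ((coordsLin L b ∘ₗ (laurentIncl R L).rTensor M) ∘ₗ N.carrier.subtype) (fun x => by
      rw [LinearMap.comp_apply, LinearMap.comp_apply, coordsLin_apply, coords_laurentIncl,
        Submodule.subtype_apply, coordsR_eq_mulVec b n, piIncl_mulVec]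
      rfl) (N.shtuka.phi (n j))
  rw [← awayLift_lTensor hζ (coordsLin L b) ((laurentIncl R L).rTensor M) (P.phiExt _ _), ← phiExt_laurentIncl, awayLift_phiExt,
    coords_laurentIncl] at h1
  have h3 := awayLift_lTensor hζ (coordsLin L b ∘ₗ (laurentIncl R L).rTensor M) N.carrier.subtype
    (N.shtuka.phi (n j))
  exact (congrFun (h2.symm.trans (h3.symm.trans h1)) i).symm

theorem coords_baseChangeIncl (N : P.SubShtuka) (n : Module.Basis ι R⟦X⟧ N.carrier)
    (t : L⟦X⟧ ⊗[R⟦X⟧] N.carrier) : coords L b (N.baseChangeIncl L t) =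
      (matIncl L (carrierMatrix b n)).mulVec (psIncl L ∘ coordsPS (M := N.carrier) n t) := by
  induction t using TensorProduct.induction_on with
  | zero =>
    have : psIncl L ∘ (0 : ι → L⟦X⟧) = 0 := funext fun _ => map_zero _
    rw [map_zero, map_zero, map_zero, this, Matrix.mulVec_zero]
  | add x y hx hy =>
    rw [map_add, map_add, map_add, hx, hy, ← Matrix.mulVec_add]
    congr 1
    exact funext fun i => (map_add (psIncl L) _ _).symm
  | tmul a x =>
    change coords L b ((psIncl L a) • (laurentIncl R L).rTensor M (x : R⸨X⸩ ⊗[R⟦X⟧] M)) = _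
    rw [map_smul, coords_laurentIncl, coordsR_eq_mulVec b n, piIncl_mulVec, ← Matrix.mulVec_smul]
    congr 1
    ext1 i
    rw [Pi.smul_apply, smul_eq_mul, Function.comp_apply, Function.comp_apply, ← map_mul, coordsPS,
      Module.Basis.equivFun_apply, Module.Basis.baseChange_repr_tmul, Algebra.smul_def, mul_comm]
    rfl

end SubShtuka

/-! ### Fixed vectors of `A σ̂` from a fundamental matrix. -/

section Fixed

variable {F : Type*} [Field F] [Fintype F] {L : Type*} [Field L] [Algebra F L]
  {ι : Type*} [Fintype ι] [DecidableEq ι]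

theorem sigmaVec_mulVec (Z : Matrix ι ι L⸨X⸩) (w : ι → L⸨X⸩) :
    sigmaVec L F (Z.mulVec w) = (Z.map (hatSigmaLaurent F L)).mulVec (sigmaVec L F w) := by
  ext1 i
  rw [sigmaVec, Matrix.mulVec, dotProduct, map_sum]
  refine Finset.sum_congr rfl fun j _ => ?_
  rw [map_mul]
  rfl

variable {A Z : Matrix ι ι L⸨X⸩}

theorem mulVec_injective_of_isUnit {S : Type*} [CommRing S] {Z : Matrix ι ι S} (hZ : IsUnit Z) :
    Function.Injective Z.mulVec := Matrix.mulVec_injective_of_isUnit hZ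

/-- Because `A σ̂(Z) = Z`, the change of variables `v = Z w` turns the operator `A σ̂` into plain
`σ̂`. -/
theorem sigmaVec_eq_of_fixed (hZ : IsUnit Z) (hAZ : A * Z.map (hatSigmaLaurent F L) = Z)
    {w : ι → L⸨X⸩} (hw : A.mulVec (sigmaVec L F (Z.mulVec w)) = Z.mulVec w) :
    sigmaVec L F w = w := by
  rw [sigmaVec_mulVec, Matrix.mulVec_mulVec, hAZ] at hw
  exact mulVec_injective_of_isUnit hZ hw

/-- The fixed vectors of `A σ̂` are the `F((z))`-combinations of the columns of a fundamental
matrix. -/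
theorem exists_of_fixed (hZ : IsUnit Z) (hAZ : A * Z.map (hatSigmaLaurent F L) = Z)
    {v : ι → L⸨X⸩} (hv : A.mulVec (sigmaVec L F v) = v) :
    ∃ c : ι → F⸨X⸩, v = Z.mulVec fun j => laurentMap (algebraMap F L) (c j) := by
  obtain ⟨Z', hZZ'⟩ := hZ.exists_right_inv
  have hv' : v = Z.mulVec (Z'.mulVec v) := by
    rw [Matrix.mulVec_mulVec, hZZ', Matrix.one_mulVec]
  rw [hv'] at hv
  have h := sigmaVec_eq_of_fixed hZ hAZ hv
  choose c hc using fun i => exists_of_hatSigmaLaurent_eq (F := F) _ (congrFun h i)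
  refine ⟨c, ?_⟩
  rw [hv']
  congr 1
  exact funext fun i => (hc i).symm

theorem exists_of_fixed_of_mem_latticeOf (hZ : IsUnit Z)
    (hAZ : A * Z.map (hatSigmaLaurent F L) = Z) {v : ι → L⸨X⸩}
    (hv : A.mulVec (sigmaVec L F v) = v) (hv' : v ∈ latticeOf Z) : ∃ c : ι → F⟦X⟧,
      v = Z.mulVec fun j => psIncl L (PowerSeries.map (algebraMap F L) (c j)) := by
  obtain ⟨w, rfl⟩ := hv'
  have h := sigmaVec_eq_of_fixed hZ hAZ hv
  choose c hc using fun i => exists_of_hatSigma_eq (F := F) (w i) (by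
    apply psIncl_injective L
    rw [← show _ = psIncl L (w i) from congrFun h i]
    exact (laurentMap_ofPowerSeries _ _).symm)
  refine ⟨c, ?_⟩
  congr 1
  exact funext fun i => by rw [hc]; rfl

end Fixed

/-! ### Bases of the rational Tate module. -/

section Tate

variable {R : Type*} [CommRing R] {L : Type*} [Field L] [Algebra R L]
  {ι : Type*} [Fintype ι] [DecidableEq ι] {M : Type*} [AddCommGroup M] [Module R⟦X⟧ M]
  (b : Module.Basis ι R⟦X⟧ M)
  {F : Type*} [Field F] [Fintype F] [Algebra F R] [Algebra F L] [IsScalarTower F R L]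
  {ζ : R} (hζ : algebraMap R L ζ ≠ 0) {P : LocalShtuka F ζ M}

theorem coords_laurent_smul (c : F⸨X⸩) (x : L⸨X⸩ ⊗[R⟦X⟧] M) :
    coords L b (c • x) = laurentMap (algebraMap F L) c • coords L b x := by
  rw [← map_smul]
  congr 1

theorem coords_powerSeries_smul (c : F⟦X⟧) (x : L⸨X⸩ ⊗[R⟦X⟧] M) :
    coords L b (c • x) = psIncl L (PowerSeries.map (algebraMap F L) c) • coords L b x := by
  rw [← map_smul]
  congr 1

theorem coords_sum_laurent {Z : Matrix ι ι L⸨X⸩} {z : ι → P.rationalTateModule L}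
    (hz : ∀ j, coords L b (z j : L⸨X⸩ ⊗[R⟦X⟧] M) = Z.col j) (c : ι → F⸨X⸩) :
    coords L b ((∑ j, c j • z j : P.rationalTateModule L) : L⸨X⸩ ⊗[R⟦X⟧] M) =
      Z.mulVec fun j => laurentMap (algebraMap F L) (c j) := by
  simp only [Submodule.coe_sum, Submodule.coe_smul, map_sum, coords_laurent_smul, hz]
  ext1 i
  rw [Finset.sum_apply]
  exact Finset.sum_congr rfl fun j _ => mul_comm _ _

theorem coords_sum_powerSeries {Z : Matrix ι ι L⸨X⸩} {z : ι → P.rationalTateModule L}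
    (hz : ∀ j, coords L b (z j : L⸨X⸩ ⊗[R⟦X⟧] M) = Z.col j) (c : ι → F⟦X⟧) :
    coords L b ((∑ j, c j • z j : P.rationalTateModule L) : L⸨X⸩ ⊗[R⟦X⟧] M) =
      Z.mulVec fun j => psIncl L (PowerSeries.map (algebraMap F L) (c j)) := by
  simp only [Submodule.coe_sum]
  rw [map_sum]
  ext1 i
  rw [Finset.sum_apply]
  refine Finset.sum_congr rfl fun j _ => ?_
  change coords L b (c j • (z j : L⸨X⸩ ⊗[R⟦X⟧] M)) i = _
  rw [coords_powerSeries_smul, hz, Pi.smul_apply, smul_eq_mul, mul_comm]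
  rfl

/-- A fundamental matrix for `A σ̂` provides a basis of `V̌`. -/
theorem exists_basis_rationalTateModule {Z : Matrix ι ι L⸨X⸩} (hZ : IsUnit Z)
    (hAZ : frobMatrix b hζ P * Z.map (hatSigmaLaurent F L) = Z) :
    ∃ z : Module.Basis ι F⸨X⸩ (P.rationalTateModule L),
      ∀ j, coords L b (z j : L⸨X⸩ ⊗[R⟦X⟧] M) = Z.col j := by
  have hmem (j : ι) : (coords L b).symm (Z.col j) ∈ P.rationalTateModule L := by
    rw [mem_rationalTateModule_iff b hζ, LinearEquiv.apply_symm_apply]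
    ext1 i
    exact congrFun (congrFun hAZ i) j
  let z : ι → P.rationalTateModule L := fun j => ⟨_, hmem j⟩
  have hz (j : ι) : coords L b (z j : L⸨X⸩ ⊗[R⟦X⟧] M) = Z.col j :=
    LinearEquiv.apply_symm_apply _ _
  have hli : LinearIndependent F⸨X⸩ z := by
    refine Fintype.linearIndependent_iffₛ.2 fun c d hcd j => ?_
    have h := coords_sum_laurent b hz c
    rw [hcd, coords_sum_laurent b hz d] at h
    have h1 := mulVec_injective_of_isUnit hZ h
    exact laurentMap_injective (algebraMap F L).injective (congrFun h1 j).symm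
  have hspan : ⊤ ≤ Submodule.span F⸨X⸩ (Set.range z) := by
    rintro v -
    obtain ⟨c, hc⟩ := exists_of_fixed hZ hAZ ((mem_rationalTateModule_iff b hζ P _).1 v.2)
    rw [Submodule.mem_span_range_iff_exists_fun]
    exact ⟨c, Subtype.ext ((coords L b).injective ((coords_sum_laurent b hz c).trans hc.symm))⟩
  exact ⟨Module.Basis.mk hli hspan, fun j => by rw [Module.Basis.mk_apply, hz]⟩

/-- The integral combinations of a basis of `V̌` in coordinates. -/
theorem mem_span_iff_coords_mem_latticeOf {Z : Matrix ι ι L⸨X⸩} (hZ : IsUnit Z)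
    (hAZ : frobMatrix b hζ P * Z.map (hatSigmaLaurent F L) = Z)
    {z : ι → P.rationalTateModule L} (hz : ∀ j, coords L b (z j : L⸨X⸩ ⊗[R⟦X⟧] M) = Z.col j)
    (v : P.rationalTateModule L) : v ∈ Submodule.span F⟦X⟧ (Set.range z) ↔
      coords L b (v : L⸨X⸩ ⊗[R⟦X⟧] M) ∈ latticeOf Z := by
  rw [Submodule.mem_span_range_iff_exists_fun]
  constructor
  · rintro ⟨c, rfl⟩
    exact ⟨_, coords_sum_powerSeries b hz c⟩
  · intro h
    obtain ⟨c, hc⟩ := exists_of_fixed_of_mem_latticeOf hZ hAZ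
      ((mem_rationalTateModule_iff b hζ P _).1 v.2) h
    exact ⟨c, Subtype.ext ((coords L b).injective ((coords_sum_powerSeries b hz c).trans hc.symm))⟩

/-- The matrix of `τ` is invertible over `R[[z]][1/(z - ζ)]`, hence over `L[[z]]`, where Lang's
theorem applies; the solution is integral with integral inverse. -/
theorem exists_fundamental_matrix [IsSepClosed L] (P : LocalShtuka F ζ M) :
    ∃ X : Matrix ι ι L⟦X⟧, IsUnit X ∧
      frobMatrix b hζ P * (X.map (psIncl L)).map (hatSigmaLaurent F L) = X.map (psIncl L) := by
  obtain ⟨X, hX, hAX⟩ := exists_matrix_powerSeries_lang (F := F)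
    ((tauMatrix b P).map (awayEval hζ)) ((isUnit_tauMatrix b P).map (awayEval hζ).mapMatrix)
  refine ⟨X, hX, ?_⟩
  have h : (X.map (psIncl L)).map (hatSigmaLaurent F L) =
      (X.map (hatSigma F L)).map (psIncl L) := by
    ext1 i j
    exact laurentMap_ofPowerSeries _ _
  rw [h]
  conv_rhs => rw [← hAX, Matrix.map_mul]
  rfl

/-- A basis of `V̌` is given by a fundamental matrix. -/
theorem isUnit_of_basis_rationalTateModule [IsSepClosed L]
    {κ : Type*} (t : Module.Basis κ F⸨X⸩ (P.rationalTateModule L)) :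
    ∃ (e : κ ≃ ι) (Z : Matrix ι ι L⸨X⸩), IsUnit Z ∧
      frobMatrix b hζ P * Z.map (hatSigmaLaurent F L) = Z ∧
      ∀ j, coords L b (t (e.symm j) : L⸨X⸩ ⊗[R⟦X⟧] M) = Z.col j := by
  obtain ⟨X, hX, hAX⟩ := exists_fundamental_matrix b hζ P
  have hX' : IsUnit (X.map (psIncl L)) := hX.map (psIncl L).mapMatrix
  obtain ⟨z, hz⟩ := exists_basis_rationalTateModule b hζ hX' hAX
  let e := t.indexEquiv z
  let C : Matrix ι ι F⸨X⸩ := z.toMatrix (t.reindex e)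
  have hC : IsUnit C :=
    IsUnit.of_mul_eq_one _ (z.toMatrix_mul_toMatrix_flip (t.reindex e))
  let Z := X.map (psIncl L) * C.map (laurentMap (algebraMap F L))
  have hcol (j : ι) : coords L b (t (e.symm j) : L⸨X⸩ ⊗[R⟦X⟧] M) = Z.col j := by
    have h1 := coords_sum_laurent b hz fun i => C i j
    rw [z.sum_toMatrix_smul_self, Module.Basis.reindex_apply] at h1
    rw [h1]
    rfl
  refine ⟨e, Z, hX'.mul (hC.map (laurentMap (algebraMap F L)).mapMatrix), ?_, hcol⟩
  ext1 i j
  have h := (mem_rationalTateModule_iff b hζ P _).1 (t (e.symm j)).2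
  rw [hcol] at h
  exact congrFun h i

end Tate

/-! ### The Tate module of a sub-shtuka in coordinates. -/

section SubShtukaTate

variable {R : Type*} [CommRing R] {L : Type*} [Field L] [Algebra R L]
  {ι : Type*} [Fintype ι] [DecidableEq ι] {M : Type*} [AddCommGroup M] [Module R⟦X⟧ M]
  (b : Module.Basis ι R⟦X⟧ M)
  {F : Type*} [Field F] [Fintype F] [Algebra F R] [Algebra F L] [IsScalarTower F R L]
  {ζ : R} {P : LocalShtuka F ζ M}

theorem coe_tateIncl (N : P.SubShtuka) (t : N.shtuka.tateModule L) :
    (N.tateIncl L t : L⸨X⸩ ⊗[R⟦X⟧] M) = N.baseChangeIncl L t.1 := rfl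

/-- The Tate module of a sub-shtuka in coordinates. -/
theorem mem_tateLattice_iff (hζ : algebraMap R L ζ ≠ 0) (N : P.SubShtuka)
    (n : Module.Basis ι R⟦X⟧ N.carrier)
    (hY : IsUnit (matIncl L (carrierMatrix b n))) (v : P.rationalTateModule L) :
    v ∈ N.tateLattice L ↔
      coords L b (v : L⸨X⸩ ⊗[R⟦X⟧] M) ∈ latticeOf (matIncl L (carrierMatrix b n)) := by
  constructor
  · rintro ⟨t, rfl⟩
    rw [coe_tateIncl]
    exact mem_latticeOf.2 ⟨coordsPS (M := N.carrier) n t.1, coords_baseChangeIncl b N n t.1⟩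
  · rintro ⟨w, hw⟩
    let t := (coordsPS (M := N.carrier) n).symm w
    have htw : coordsPS (M := N.carrier) n t = w := LinearEquiv.apply_symm_apply _ _
    have ht : t ∈ N.shtuka.tateModule L := by
      refine (mem_tateModule_iff n hζ N.shtuka t).2 ?_
      rw [htw]
      -- With `Y` the matrix of `n`, compatibility reads `A_M σ̂(Y) = Y A_N`. Cancelling `Y` turns
      -- invariance of `v = Y w` under `τ_M` into invariance of `w` under `τ_N`.
      have h := (mem_rationalTateModule_iff b hζ P _).1 v.2
      rw [hw, sigmaVec_mulVec, Matrix.mulVec_mulVec, frobMatrix_mul_sigma, ← Matrix.mulVec_mulVec]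
        at h
      have h1 := mulVec_injective_of_isUnit hY h
      ext1 i
      apply psIncl_injective L
      rw [← show _ = psIncl L (w i) from congrFun h1 i, Matrix.mulVec, Matrix.mulVec, dotProduct,
        dotProduct, map_sum]
      refine Finset.sum_congr rfl fun j _ => ?_
      rw [map_mul, sigmaVec]
      congr 1
      exact (laurentMap_ofPowerSeries _ _).symm
    refine ⟨⟨t, ht⟩, Subtype.ext ((coords L b).injective ?_)⟩
    rw [hw, ← htw]
    exact coords_baseChangeIncl b N n t

/-- A fundamental matrix for the Tate module of a sub-shtuka. -/
theorem exists_fundamental_matrix_subShtuka [IsSepClosed L] (hζ : algebraMap R L ζ ≠ 0)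
    (N : P.SubShtuka) (n : Module.Basis ι R⟦X⟧ N.carrier)
    (hY : IsUnit (matIncl L (carrierMatrix b n))) :
    ∃ Z : Matrix ι ι L⸨X⸩, IsUnit Z ∧ frobMatrix b hζ P * Z.map (hatSigmaLaurent F L) = Z ∧
      latticeOf Z = latticeOf (matIncl L (carrierMatrix b n)) := by
  obtain ⟨X, hX, hAX⟩ := exists_fundamental_matrix (M := N.carrier) n hζ N.shtuka
  refine ⟨matIncl L (carrierMatrix b n) * X.map (psIncl L),
    hY.mul (hX.map (psIncl L).mapMatrix), ?_, latticeOf_mul_map_of_isUnit _ hX⟩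
  rw [Matrix.map_mul, ← mul_assoc, frobMatrix_mul_sigma b hζ N n, mul_assoc, hAX]

end SubShtukaTate

/-! ### Sub-shtukas of full rank span `M[1/z]`. -/

section SubShtukaTate

variable {R : Type*} [CommRing R] {L : Type*} [Field L] [Algebra R L]
  {ι : Type*} [Fintype ι] [DecidableEq ι] {M : Type*} [AddCommGroup M] [Module R⟦X⟧ M]
  (b : Module.Basis ι R⟦X⟧ M)
  {F : Type*} [Field F] [Fintype F] [Algebra F R] [Algebra F L] [IsScalarTower F R L]
  {ζ : R} {P : LocalShtuka F ζ M}

/-- Localization is flat, so the inclusion into `M[1/z]` stays injective after inverting `z - ζ`,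
and compatibility leaves no choice for `τ_N`. -/
theorem LocalShtuka.SubShtuka.ext_of_carrier (N N' : P.SubShtuka) (h : N.carrier = N'.carrier) :
    N = N' := by
  obtain ⟨C, S, hS⟩ := N
  obtain ⟨C', S', hS'⟩ := N'
  obtain rfl : C = C' := h
  have : S = S' := by
    refine LocalShtuka.ext_of_phi S S' fun n => ?_
    have hflat : Module.Flat R⟦X⟧ (AwayRing ζ) :=
      IsLocalization.flat _ (Submonoid.powers (PowerSeries.X - PowerSeries.C ζ : R⟦X⟧))
    exact Module.Flat.lTensor_preserves_injective_linearMap C.subtype C.injective_subtype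
      ((hS n).trans (hS' n).symm)
  subst this
  rfl

theorem coords_gal {K : Type*} [Field K] [Algebra R K] [Algebra K L] [IsScalarTower R K L]
    (g : L ≃ₐ[K] L) (x : L⸨X⸩ ⊗[R⟦X⟧] M) : coords L b ((LocalShtuka.galLaurent K g).rTensor M x) =
      fun i => laurentMap (g : L →+* L) (coords L b x i) := by
  induction x using TensorProduct.induction_on with
  | zero => ext1 i; simp
  | add x y hx hy => ext1 i; simp only [map_add, hx, hy, Pi.add_apply]
  | tmul c m =>
    ext1 i
    rw [LinearMap.rTensor_tmul, coords_tmul, coords_tmul, ← map_smul]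
    rfl

theorem laurentMap_mulVec {A B : Type*} [CommRing A] [CommRing B] (g : A →+* B)
    (X : Matrix ι ι A⸨X⸩) (w : ι → A⟦X⟧) :
    (fun i => laurentMap g (X.mulVec (psIncl A ∘ w) i)) =
      (X.map (laurentMap g)).mulVec (psIncl B ∘ fun i => PowerSeries.map g (w i)) := by
  ext1 i
  rw [Matrix.mulVec, dotProduct, map_sum]
  refine Finset.sum_congr rfl fun j _ => ?_
  rw [map_mul, Function.comp_apply, laurentMap_ofPowerSeries]
  rfl

/-- The lattice of a matrix with entries in `R((z))` is Galois-stable. -/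
theorem gal_mem_latticeOf_matIncl {K : Type*} [Field K] [Algebra R K] [Algebra K L]
    [IsScalarTower R K L] (g : L ≃ₐ[K] L) (Y : Matrix ι ι R⸨X⸩) (v : ι → L⸨X⸩)
    (hv : v ∈ latticeOf (matIncl L Y)) :
    (fun i => laurentMap (g : L →+* L) (v i)) ∈ latticeOf (matIncl L Y) := by
  obtain ⟨w, rfl⟩ := hv
  rw [laurentMap_mulVec]
  have : (matIncl L Y).map (laurentMap (g : L →+* L)) = matIncl L Y := by
    ext i j n
    change g (algebraMap R L _) = algebraMap R L _
    rw [IsScalarTower.algebraMap_apply R K L, g.commutes]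
  rw [this]
  exact ⟨_, rfl⟩

theorem psIncl_map (f : R⟦X⟧) : psIncl L (PowerSeries.map (algebraMap R L) f) =
    laurentMap (algebraMap R L) (psIncl R f) := (laurentMap_ofPowerSeries _ _).symm

variable [IsDomain R]

/-- A kernel vector over the domain `R((z))`, multiplied by a power of `z`, would be a nontrivial
`R[[z]]`-relation in the basis `n`. -/
theorem det_carrierMatrix_ne_zero {N : Submodule R⟦X⟧ (R⸨X⸩ ⊗[R⟦X⟧] M)}
    (n : Module.Basis ι R⟦X⟧ N) : (carrierMatrix b n).det ≠ 0 := by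
  intro h
  obtain ⟨v, hv0, hv⟩ := Matrix.exists_mulVec_eq_zero_iff.2 h
  obtain ⟨a, ha⟩ := exists_vanishBelow_family v
  choose w hw using fun j => (ha j).exists_eq
  have hvw : v = (HahnSeries.single (-a : ℤ) 1 : R⸨X⸩) • (psIncl R ∘ w) := funext hw
  have hs : (HahnSeries.single (a : ℤ) 1 : R⸨X⸩) * HahnSeries.single (-a : ℤ) 1 = 1 := by
    rw [HahnSeries.single_mul_single, add_neg_cancel, one_mul, HahnSeries.single_zero_one]
  have h1 : (carrierMatrix b n).mulVec (psIncl R ∘ w) = 0 := by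
    have h2 := congrArg ((HahnSeries.single (a : ℤ) 1 : R⸨X⸩) • ·) hv
    simp only [hvw, Matrix.mulVec_smul, smul_smul, hs, one_smul, smul_zero] at h2
    exact h2
  have h3 := coordsR_eq_mulVec b n (n.equivFun.symm w)
  have h4 : (n.repr (n.equivFun.symm w) : ι → R⟦X⟧) = w := n.equivFun.apply_symm_apply w
  rw [h4, h1, LinearEquiv.map_eq_zero_iff, Submodule.coe_eq_zero,
    LinearEquiv.map_eq_zero_iff] at h3
  apply hv0
  ext1 j
  rw [hw, h3, Pi.zero_apply, map_zero, mul_zero, Pi.zero_apply]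

/-- A unit of `R[[z]][1/(z - ζ)]` is a quotient of a divisor of a power of `z - ζ` by a power of
`z - ζ`. -/
theorem exists_dvd_pow_of_isUnit (hζ0 : ζ ≠ 0) {u : AwayRing ζ} (hu : IsUnit u) :
    ∃ (k N : ℕ) (f : R⟦X⟧), f ∣ (PowerSeries.X - PowerSeries.C ζ) ^ N ∧
      algebraMap R⟦X⟧ (AwayRing ζ) ((PowerSeries.X - PowerSeries.C ζ) ^ k) * u =
        algebraMap R⟦X⟧ (AwayRing ζ) f := by
  have hne : (PowerSeries.X - PowerSeries.C ζ : R⟦X⟧) ≠ 0 := by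
    intro h
    have := congrArg PowerSeries.constantCoeff h
    simp [hζ0] at this
  have hinj : Function.Injective (algebraMap R⟦X⟧ (AwayRing ζ)) :=
    IsLocalization.injective _ (powers_le_nonZeroDivisors_of_noZeroDivisors hne)
  obtain ⟨w, huw⟩ := hu.exists_right_inv
  obtain ⟨k, f, hf⟩ := IsLocalization.Away.surj (PowerSeries.X - PowerSeries.C ζ : R⟦X⟧) u
  obtain ⟨l, g, hg⟩ := IsLocalization.Away.surj (PowerSeries.X - PowerSeries.C ζ : R⟦X⟧) w
  refine ⟨k, k + l, f, ⟨g, hinj ?_⟩, by rw [mul_comm, map_pow, hf]⟩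
  rw [map_mul, ← hf, ← hg, map_pow, mul_mul_mul_comm, huw, one_mul, pow_add]

variable [IsDiscreteValuationRing R] [IsAdicComplete (IsLocalRing.maximalIdeal R) R]
  [FaithfulSMul R L]

/-- A sub-shtuka of full rank spans `M[1/z]` over `R((z))`. -/
theorem isUnit_carrierMatrix (hζ0 : ζ ≠ 0) (hζm : ζ ∈ IsLocalRing.maximalIdeal R)
    (hζ : algebraMap R L ζ ≠ 0) (N : P.SubShtuka) (n : Module.Basis ι R⟦X⟧ N.carrier) :
    IsUnit (carrierMatrix b n) := by
  rw [Matrix.isUnit_iff_isUnit_det]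
  set d := (carrierMatrix b n).det with hd
  have hd0 : d ≠ 0 := det_carrierMatrix_ne_zero b n
  let θ := (psIncl L).comp (awayEval hζ)
  have hM := (Matrix.isUnit_iff_isUnit_det _).1 (isUnit_tauMatrix b P)
  have hN := (Matrix.isUnit_iff_isUnit_det _).1 (isUnit_tauMatrix (M := N.carrier) n N.shtuka)
  set α := (tauMatrix b P).det
  set β := (tauMatrix (M := N.carrier) n N.shtuka).det
  -- The determinant of the compatibility relation is `α σ̂(d) = d β`. Writing the unit `α β⁻¹` as
  -- `f / (z - ζ)^k` then gives `(z - ζ)^k d = f σ̂(d)`, the situation of the rank one lemma.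
  have hdet : θ α * laurentMap (algebraMap R L) (hatSigmaLaurent F R d) =
      laurentMap (algebraMap R L) d * θ β := by
    have h := congrArg Matrix.det (frobMatrix_mul_sigma b hζ N n)
    rw [Matrix.det_mul, Matrix.det_mul] at h
    have h1 : ((matIncl L (carrierMatrix b n)).map (hatSigmaLaurent F L)).det =
        laurentMap (algebraMap R L) (hatSigmaLaurent F R d) := by
      rw [hd, RingHom.map_det, RingHom.map_det]
      congr 1
      ext i j k
      change (algebraMap R L _) ^ _ = algebraMap R L (_ ^ _)
      rw [map_pow]
    rw [h1] at h
    rw [show θ α = (frobMatrix b hζ P).det from θ.map_det _,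
      show θ β = (frobMatrix (M := N.carrier) n hζ N.shtuka).det from θ.map_det _,
      show laurentMap (algebraMap R L) d = (matIncl L (carrierMatrix b n)).det from
        RingHom.map_det _ _]
    exact h
  obtain ⟨β', hβ'⟩ := hN.exists_right_inv
  obtain ⟨k, m, f, hf, hfu⟩ := exists_dvd_pow_of_isUnit hζ0
    (hM.mul (IsUnit.of_mul_eq_one β ((mul_comm _ _).trans hβ') : IsUnit β'))
  refine isUnit_of_mul_eq_mul_hatSigmaLaurent (F := F) hζm hd0 hf (k := k)
    (laurentMap_injective (FaithfulSMul.algebraMap_injective R L) ?_)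
  have h2 := congrArg θ hfu
  have h3 (g : R⟦X⟧) : θ (algebraMap R⟦X⟧ (AwayRing ζ) g) =
      laurentMap (algebraMap R L) (psIncl R g) := by
    rw [RingHom.comp_apply, awayEval_algebraMap, psIncl_map]
  rw [map_mul, map_mul, ← h3, ← h3, ← h2, map_mul, map_mul, mul_assoc, mul_assoc]
  congr 1
  have h4 : θ β * θ β' = 1 := by rw [← map_mul, hβ', map_one]
  rw [mul_left_comm, hdet, mul_comm, mul_assoc, h4, mul_one]

end SubShtukaTate

/-! ### The intersection of `R((z))[1/(z - ζ)]` with `L[[z]]`. -/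

section AwayLaurent

variable {R L : Type*} [CommRing R] [Field L] [Algebra R L] {ζ : R}

variable (L ζ) in
/-- The image of `R((z))[1/(z - ζ)]` in `L((z))`. -/
def awayLaurent : Subring L⸨X⸩ where
  carrier := {x | ∃ (k : ℕ) (y : R⸨X⸩), laurentMap (algebraMap R L)
    (psIncl R (PowerSeries.X - PowerSeries.C ζ)) ^ k * x = laurentMap (algebraMap R L) y}
  one_mem' := ⟨0, 1, by simp⟩
  zero_mem' := ⟨0, 0, by simp⟩
  mul_mem' := by
    rintro a b ⟨k, y, h⟩ ⟨l, y', h'⟩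
    exact ⟨k + l, y * y', by rw [pow_add, mul_mul_mul_comm, h, h', map_mul]⟩
  add_mem' := by
    rintro a b ⟨k, y, h⟩ ⟨l, y', h'⟩
    refine ⟨k + l, psIncl R (PowerSeries.X - PowerSeries.C ζ) ^ l * y +
      psIncl R (PowerSeries.X - PowerSeries.C ζ) ^ k * y', ?_⟩
    rw [map_add, map_mul, map_mul, ← h, ← h', map_pow, map_pow]
    ring
  neg_mem' := by
    rintro a ⟨k, y, h⟩
    exact ⟨k, -y, by rw [map_neg, ← h, mul_neg]⟩

theorem laurentMap_mem_awayLaurent (y : R⸨X⸩) :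
    laurentMap (algebraMap R L) y ∈ awayLaurent L ζ := ⟨0, y, by rw [pow_zero, one_mul]⟩

theorem psIncl_awayEval_mem_awayLaurent (hζ : algebraMap R L ζ ≠ 0) (s : AwayRing ζ) :
    psIncl L (awayEval hζ s) ∈ awayLaurent L ζ := by
  obtain ⟨k, f, hf⟩ := IsLocalization.Away.surj (PowerSeries.X - PowerSeries.C ζ : R⟦X⟧) s
  refine ⟨k, psIncl R f, ?_⟩
  rw [← psIncl_map, ← psIncl_map, ← awayEval_algebraMap hζ, ← awayEval_algebraMap hζ, ← hf,
    map_mul, map_mul, mul_comm, map_pow, map_pow]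

/-- An element of `L[[z]]` which lies in `R((z))[1/(z - ζ)]` lies in `R[[z]][1/(z - ζ)]`. -/
theorem exists_awayEval_eq [FaithfulSMul R L] (hζ : algebraMap R L ζ ≠ 0) {x : L⟦X⟧}
    (hx : psIncl L x ∈ awayLaurent L ζ) : ∃ s : AwayRing ζ, awayEval hζ s = x := by
  obtain ⟨k, y, h⟩ := hx
  rw [← psIncl_map, ← map_pow, ← map_mul] at h
  -- After multiplication by `(z - ζ)^k` the element has coefficients in `R` and no pole at `z = 0`,
  -- so it comes from `R[[z]]`.
  obtain ⟨f, rfl⟩ : ∃ f, psIncl R f = y := by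
    refine vanishBelow_zero_iff.1 fun n hn => ?_
    refine FaithfulSMul.algebraMap_injective R L ?_
    rw [← laurentMap_coeff, ← h, map_zero]
    exact vanishBelow_zero_iff.2 ⟨_, rfl⟩ n hn
  rw [← psIncl_map] at h
  have h1 := psIncl_injective L h
  refine ⟨algebraMap R⟦X⟧ _ f *
    IsLocalization.Away.invSelf (PowerSeries.X - PowerSeries.C ζ) ^ k,
    ((isUnit_algebraMap_X_sub_C hζ).pow k).mul_left_cancel ?_⟩
  refine Eq.trans ?_ h1.symm
  have h2 : awayEval hζ (algebraMap R⟦X⟧ (AwayRing ζ) (PowerSeries.X - PowerSeries.C ζ)) *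
      awayEval hζ (IsLocalization.Away.invSelf (PowerSeries.X - PowerSeries.C ζ)) = 1 := by
    rw [← map_mul, IsLocalization.Away.mul_invSelf, map_one]
  rw [awayEval_algebraMap] at h2
  rw [map_mul, awayEval_algebraMap, map_pow, mul_left_comm]
  change _ * (PowerSeries.map (algebraMap R L) _ ^ k * _) = _
  rw [← mul_pow, h2, one_pow, mul_one]

theorem exists_matrix_awayEval_eq {ι : Type*} [FaithfulSMul R L] (hζ : algebraMap R L ζ ≠ 0)
    {X : Matrix ι ι L⟦X⟧} (hX : ∀ i j, psIncl L (X i j) ∈ awayLaurent L ζ) :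
    ∃ B : Matrix ι ι (AwayRing ζ), B.map (awayEval hζ) = X := by
  choose B hB using fun i j => exists_awayEval_eq hζ (hX i j)
  exact ⟨Matrix.of B, Matrix.ext hB⟩

end AwayLaurent

/-! ### Construction of a sub-shtuka from a rational basis. -/

section Construction

variable {R : Type*} [CommRing R] {L : Type*} [Field L] [Algebra R L]
  {ι : Type*} [Fintype ι] [DecidableEq ι] {M : Type*} [AddCommGroup M] [Module R⟦X⟧ M]
  (b : Module.Basis ι R⟦X⟧ M)
  {F : Type*} [Field F] [Fintype F] [Algebra F R] [Algebra F L] [IsScalarTower F R L]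
  {ζ : R} {P : LocalShtuka F ζ M}

/-- The submodule of `M[1/z]` generated by the columns of a matrix. -/
noncomputable def carrierOf (Y : Matrix ι ι R⸨X⸩) : Submodule R⟦X⟧ (R⸨X⸩ ⊗[R⟦X⟧] M) :=
  (latticeOf Y).comap ((coordsR b).toLinearMap.restrictScalars R⟦X⟧)

theorem mem_carrierOf {Y : Matrix ι ι R⸨X⸩} {x : R⸨X⸩ ⊗[R⟦X⟧] M} :
    x ∈ carrierOf b Y ↔ coordsR b x ∈ latticeOf Y := Iff.rfl

theorem exists_basis_carrierOf {Y : Matrix ι ι R⸨X⸩} (hY : IsUnit Y) :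
    ∃ n : Module.Basis ι R⟦X⟧ (carrierOf b Y), carrierMatrix b n = Y := by
  have hmem (j : ι) : (coordsR b).symm (Y.col j) ∈ carrierOf b Y := by
    rw [mem_carrierOf, LinearEquiv.apply_symm_apply]
    exact col_mem_latticeOf Y j
  let z : ι → carrierOf b Y := fun j => ⟨_, hmem j⟩
  have hz (j : ι) : coordsR b (z j : R⸨X⸩ ⊗[R⟦X⟧] M) = Y.col j :=
    LinearEquiv.apply_symm_apply _ _
  have hsum (c : ι → R⟦X⟧) : coordsR b ((∑ j, c j • z j : carrierOf b Y) : R⸨X⸩ ⊗[R⟦X⟧] M) =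
      Y.mulVec (psIncl R ∘ c) := by
    simp only [Submodule.coe_sum, SetLike.val_smul, map_sum]
    ext1 i
    rw [Finset.sum_apply]
    refine Finset.sum_congr rfl fun j _ => ?_
    rw [← algebraMap_smul R⸨X⸩, map_smul, hz, Pi.smul_apply, smul_eq_mul, mul_comm]
    rfl
  have hli : LinearIndependent R⟦X⟧ z := by
    refine Fintype.linearIndependent_iffₛ.2 fun c d hcd j => ?_
    have h := hsum c
    rw [hcd, hsum d] at h
    exact psIncl_injective R (congrFun (mulVec_injective_of_isUnit hY h) j).symm
  have hspan : ⊤ ≤ Submodule.span R⟦X⟧ (Set.range z) := by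
    rintro v -
    obtain ⟨c, hc⟩ := (mem_carrierOf b).1 v.2
    rw [Submodule.mem_span_range_iff_exists_fun]
    exact ⟨c, Subtype.ext ((coordsR b).injective ((hsum c).trans hc.symm))⟩
  refine ⟨Module.Basis.mk hli hspan, ?_⟩
  ext1 i j
  rw [carrierMatrix, Matrix.of_apply, Module.Basis.mk_apply, hz]
  rfl

theorem isUnit_matIncl {Y : Matrix ι ι R⸨X⸩} (hY : IsUnit Y) : IsUnit (matIncl L Y) :=
  hY.map (laurentMap (algebraMap R L)).mapMatrix

theorem matIncl_map_hatSigmaLaurent (Y : Matrix ι ι R⸨X⸩) :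
    (matIncl L Y).map (hatSigmaLaurent F L) = matIncl L (Y.map (hatSigmaLaurent F R)) := by
  ext i j k
  change (algebraMap R L _) ^ _ = algebraMap R L (_ ^ _)
  rw [map_pow]

/-- The matrix of `τ` with respect to the columns of `Y` if these generate the same lattice over
`L[[z]]` as a fundamental matrix. -/
theorem exists_tauMatrix [FaithfulSMul R L] (hζ : algebraMap R L ζ ≠ 0) (P : LocalShtuka F ζ M)
    {Y : Matrix ι ι R⸨X⸩} (hY : IsUnit Y) {Z : Matrix ι ι L⸨X⸩}
    (hAZ : frobMatrix b hζ P * Z.map (hatSigmaLaurent F L) = Z) {U : Matrix ι ι L⟦X⟧}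
    (hU : IsUnit U) (hYU : matIncl L Y = Z * U.map (psIncl L)) :
    ∃ B : Matrix ι ι (AwayRing ζ), IsUnit B ∧
      frobMatrix b hζ P * (matIncl L Y).map (hatSigmaLaurent F L) =
        matIncl L Y * B.map ((psIncl L).comp (awayEval hζ)) := by
  obtain ⟨V, hUV⟩ := hU.exists_right_inv
  obtain ⟨W, hYW⟩ := hY.exists_right_inv
  obtain ⟨T, hT⟩ := (isUnit_tauMatrix b P).exists_right_inv
  have hVU : V * U = 1 := mul_eq_one_comm.1 hUV
  have hWY : W * Y = 1 := mul_eq_one_comm.1 hYW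
  have hsU : (U.map (psIncl L)).map (hatSigmaLaurent F L) =
      (U.map (hatSigma F L)).map (psIncl L) := by
    ext1 i j
    exact laurentMap_ofPowerSeries _ _
  have hσU : U.map (hatSigma F L) * V.map (hatSigma F L) = 1 := by
    rw [← Matrix.map_mul, hUV, Matrix.map_one _ (map_zero _) (map_one _)]
  set A := frobMatrix b hζ P
  set YL := matIncl L Y
  set WL := matIncl L W
  have hYWL : YL * WL = 1 := by
    change (laurentMap (algebraMap R L)).mapMatrix Y * (laurentMap (algebraMap R L)).mapMatrix W = 1
    rw [← map_mul, hYW, map_one]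
  have hWYL : WL * YL = 1 := mul_eq_one_comm.1 hYWL
  let T' : Matrix ι ι L⸨X⸩ := T.map ((psIncl L).comp (awayEval hζ))
  have hAT : A * T' = 1 := by
    change ((psIncl L).comp (awayEval hζ)).mapMatrix (tauMatrix b P) *
      ((psIncl L).comp (awayEval hζ)).mapMatrix T = 1
    rw [← map_mul, hT, map_one]
  -- The matrix of `τ` in the basis `Y = Z U` is `U⁻¹ σ̂(U)`, since `A σ̂(Z) = Z`. This shows that
  -- it and its inverse are integral over `L[[z]]`.
  let N : Matrix ι ι L⟦X⟧ := V * U.map (hatSigma F L)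
  let N' : Matrix ι ι L⟦X⟧ := V.map (hatSigma F L) * U
  have hNN' : N * N' = 1 := by
    rw [show N * N' = V * (U.map (hatSigma F L) * V.map (hatSigma F L)) * U by
      simp only [N, N', mul_assoc], hσU, mul_one, hVU]
  have hAY : A * YL.map (hatSigmaLaurent F L) = YL * N.map (psIncl L) := by
    rw [hYU, Matrix.map_mul, ← mul_assoc, hAZ, hsU, mul_assoc Z, ← Matrix.map_mul]
    congr 2
    rw [← mul_assoc, hUV, one_mul]
  -- The same matrix equals `Y⁻¹ A σ̂(Y)`, so its entries, like those of its inverse, lie in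
  -- `R((z))[1/(z - ζ)]`.
  have hN : N.map (psIncl L) = WL * (A * YL.map (hatSigmaLaurent F L)) := by
    rw [hAY, ← mul_assoc, hWYL, one_mul]
  have hN' : N'.map (psIncl L) = WL.map (hatSigmaLaurent F L) * (T' * YL) := by
    have h1 : N.map (psIncl L) * (WL.map (hatSigmaLaurent F L) * (T' * YL)) = 1 := by
      have h2 : YL.map (hatSigmaLaurent F L) * WL.map (hatSigmaLaurent F L) = 1 := by
        rw [← Matrix.map_mul, hYWL, Matrix.map_one _ (map_zero _) (map_one _)]
      rw [hN, show WL * (A * YL.map (hatSigmaLaurent F L)) *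
        (WL.map (hatSigmaLaurent F L) * (T' * YL)) =
        WL * (A * ((YL.map (hatSigmaLaurent F L) * WL.map (hatSigmaLaurent F L)) * T')) * YL by
          simp only [mul_assoc], h2, one_mul, hAT, mul_one, hWYL]
    have h3 : N'.map (psIncl L) * N.map (psIncl L) = 1 := by
      rw [← Matrix.map_mul, mul_eq_one_comm.1 hNN', Matrix.map_one _ (map_zero _) (map_one _)]
    exact left_inv_eq_right_inv h3 h1
  let D := (awayLaurent L ζ).matrix (n := ι)
  have hDR (Q : Matrix ι ι R⸨X⸩) : matIncl L Q ∈ D := fun i j => laurentMap_mem_awayLaurent _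
  have hDA (Q : Matrix ι ι (AwayRing ζ)) : Q.map ((psIncl L).comp (awayEval hζ)) ∈ D :=
    fun i j => psIncl_awayEval_mem_awayLaurent hζ _
  have hDN : N.map (psIncl L) ∈ D := by
    rw [hN, matIncl_map_hatSigmaLaurent]
    exact D.mul_mem (hDR W) (D.mul_mem (hDA _) (hDR _))
  have hDN' : N'.map (psIncl L) ∈ D := by
    rw [hN', matIncl_map_hatSigmaLaurent]
    exact D.mul_mem (hDR _) (D.mul_mem (hDA T) (hDR Y))
  obtain ⟨B, hB⟩ := exists_matrix_awayEval_eq hζ hDN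
  obtain ⟨B', hB'⟩ := exists_matrix_awayEval_eq hζ hDN'
  refine ⟨B, IsUnit.of_mul_eq_one B' (Matrix.map_injective (awayEval_injective hζ) ?_), ?_⟩
  · refine Eq.trans (Matrix.map_mul (f := awayEval hζ)) ?_
    rw [hB, hB', hNN']
    refine Eq.symm ?_
    exact Matrix.map_one _ (map_zero _) (map_one _)
  · rw [hAY, ← hB]
    rfl

theorem awayLift_phi_eq_mulVec {Q : Type*} [AddCommGroup Q] [Module R⟦X⟧ Q]
    (n : Module.Basis ι R⟦X⟧ Q) (hζ : algebraMap R L ζ ≠ 0) (S : LocalShtuka F ζ Q)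
    (Y : Matrix ι ι L⸨X⸩) (j : Q →ₗ[R⟦X⟧] (ι → L⸨X⸩))
    (hj : ∀ x, j x = Y.mulVec fun k => psIncl L (PowerSeries.map (algebraMap R L) (n.repr x k)))
    (x : Q) : awayLift hζ j (S.phi x) = Y.mulVec ((frobMatrix n hζ S).mulVec (sigmaVec L F
      fun k => psIncl L (PowerSeries.map (algebraMap R L) (n.repr x k)))) := by
  have h2 : (fun k => psIncl L (awayEval hζ ((n.baseChange (AwayRing ζ)).repr (S.phi x) k))) =
      (frobMatrix n hζ S).mulVec (sigmaVec L F (coords L n (1 ⊗ₜ x))) := by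
    rw [← awayLift_phi]
    exact funext fun k => (awayLift_coords_one n hζ (S.phi x) k).symm
  have h3 : coords L n ((1 : L⸨X⸩) ⊗ₜ[R⟦X⟧] x) =
      fun k => psIncl L (PowerSeries.map (algebraMap R L) (n.repr x k)) := by
    ext1 k
    rw [coords_tmul, Algebra.smul_def, mul_one]
    rfl
  rw [awayLift_eq_mulVec hζ n Y j hj, h2, h3]

theorem coordsLin_laurentIncl_injective [FaithfulSMul R L] :
    Function.Injective (coordsLin L b ∘ₗ (laurentIncl R L).rTensor M) := by
  intro x y hxy
  rw [LinearMap.comp_apply, LinearMap.comp_apply, coordsLin_apply, coordsLin_apply,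
    coords_laurentIncl, coords_laurentIncl] at hxy
  refine (coordsR b).injective (funext fun i => ?_)
  exact laurentMap_injective (FaithfulSMul.algebraMap_injective R L) (congrFun hxy i)

theorem awayLift_phiExt_laurentIncl (hζ : algebraMap R L ζ ≠ 0) (P : LocalShtuka F ζ M)
    (x : R⸨X⸩ ⊗[R⟦X⟧] M) :
    awayLift hζ (coordsLin L b ∘ₗ (laurentIncl R L).rTensor M) (P.phiExt R⸨X⸩ x) =
      (frobMatrix b hζ P).mulVec (sigmaVec L F (piIncl R L ι (coordsR b x))) := by
  rw [← awayLift_lTensor, ← phiExt_laurentIncl, awayLift_phiExt, coords_laurentIncl]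

/-- A submodule of `M[1/z]` with a basis in which `τ` has the matrix `B` is a sub-shtuka. -/
theorem exists_subShtuka_of_tauMatrix [FaithfulSMul R L] (hζ : algebraMap R L ζ ≠ 0)
    (C : Submodule R⟦X⟧ (R⸨X⸩ ⊗[R⟦X⟧] M)) (n : Module.Basis ι R⟦X⟧ C)
    (B : Matrix ι ι (AwayRing ζ)) (hB : IsUnit B)
    (hAB : frobMatrix b hζ P * (matIncl L (carrierMatrix b n)).map (hatSigmaLaurent F L) =
      matIncl L (carrierMatrix b n) * B.map ((psIncl L).comp (awayEval hζ))) :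
    ∃ N : P.SubShtuka, N.carrier = C := by
  obtain ⟨S, hS⟩ := exists_localShtuka_tauMatrix (F := F) (M := C) n B hB
  refine ⟨⟨C, S, fun x => awayLift_injective hζ (coordsLin_laurentIncl_injective b) ?_⟩, rfl⟩
  have h1 : piIncl R L ι (coordsR b x) = (matIncl L (carrierMatrix b n)).mulVec fun k =>
      psIncl L (PowerSeries.map (algebraMap R L) (n.repr x k)) := by
    rw [coordsR_eq_mulVec b n, piIncl_mulVec]
    rfl
  have h2 := awayLift_lTensor hζ (coordsLin L b ∘ₗ (laurentIncl R L).rTensor M)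
    C.subtype (S.phi x)
  have h3 := awayLift_phi_eq_mulVec n hζ S (matIncl L (carrierMatrix b n))
    ((coordsLin L b ∘ₗ (laurentIncl R L).rTensor M) ∘ₗ C.subtype) (fun y => by
      rw [LinearMap.comp_apply, LinearMap.comp_apply, coordsLin_apply, coords_laurentIncl,
        Submodule.subtype_apply, coordsR_eq_mulVec b n, piIncl_mulVec]
      rfl) x
  have h4 := awayLift_phiExt_laurentIncl b hζ P (x : R⸨X⸩ ⊗[R⟦X⟧] M)
  rw [h1, sigmaVec_mulVec, Matrix.mulVec_mulVec, hAB, ← Matrix.mulVec_mulVec] at h4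
  have h5 : frobMatrix n hζ S = B.map ((psIncl L).comp (awayEval hζ)) := by
    rw [frobMatrix, hS]
  rw [h5] at h3
  exact h2.trans (h3.trans h4.symm)

/-- The columns of `Y` generate a local shtuka if they generate the same lattice over `L[[z]]` as
a fundamental matrix. -/
theorem exists_subShtuka [FaithfulSMul R L] (hζ : algebraMap R L ζ ≠ 0)
    {Y : Matrix ι ι R⸨X⸩} (hY : IsUnit Y) {Z : Matrix ι ι L⸨X⸩}
    (hAZ : frobMatrix b hζ P * Z.map (hatSigmaLaurent F L) = Z) {U : Matrix ι ι L⟦X⟧}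
    (hU : IsUnit U) (hYU : matIncl L Y = Z * U.map (psIncl L)) :
    ∃ (N : P.SubShtuka) (n : Module.Basis ι R⟦X⟧ N.carrier), carrierMatrix b n = Y := by
  obtain ⟨n, hn⟩ := exists_basis_carrierOf b hY
  obtain ⟨B, hB, hAB⟩ := exists_tauMatrix b hζ P hY hAZ hU hYU
  rw [← hn] at hAB
  obtain ⟨N, hN⟩ := exists_subShtuka_of_tauMatrix b hζ _ n B hB hAB
  exact ⟨N, n.map (LinearEquiv.ofEq _ _ hN.symm), hn⟩

end Construction

theorem exists_basis_of_isLattice.{v} {A Q : Type*} {V : Type v} [CommRing A] [IsDomain A]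
    [IsPrincipalIdealRing A] [Field Q] [Algebra A Q] [IsFractionRing A Q] [AddCommGroup V]
    [Module Q V] [Module A V] [IsScalarTower A Q V] (T : Submodule A V) (hT : T.IsLattice Q) :
    ∃ (κ : Type v) (t : Module.Basis κ Q V), T = Submodule.span A (Set.range t) := by
  have hfree : Module.Free A T := Submodule.IsLattice.free Q T
  let t := Module.Free.chooseBasis A T
  refine ⟨_, t.extendOfIsLattice Q, ?_⟩
  have h1 : Set.range (t.extendOfIsLattice Q) = T.subtype '' Set.range t := by
    rw [← Set.range_comp]
    congr 1
    ext1 j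
    exact t.extendOfIsLattice_apply Q _
  rw [h1, ← Submodule.map_span, t.span_eq, Submodule.map_top, Submodule.range_subtype]

/-! ### The correspondence between sub-shtukas and Galois-stable lattices. -/

section Correspondence

variable {R : Type*} [CommRing R] {L : Type*} [Field L] [Algebra R L]
  {ι : Type*} [Fintype ι] [DecidableEq ι] {M : Type*} [AddCommGroup M] [Module R⟦X⟧ M]
  (b : Module.Basis ι R⟦X⟧ M)
  {F : Type*} [Field F] [Fintype F] [Algebra F R] [Algebra F L] [IsScalarTower F R L]
  {ζ : R} {P : LocalShtuka F ζ M}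

/-- The coordinates `Y⁻¹ v` have coefficients in `R` and, over `L`, no poles; hence they lie in
`R[[z]]`. -/
theorem piIncl_mem_latticeOf_matIncl_iff [FaithfulSMul R L] {Y : Matrix ι ι R⸨X⸩} (hY : IsUnit Y)
    (v : ι → R⸨X⸩) : piIncl R L ι v ∈ latticeOf (matIncl L Y) ↔ v ∈ latticeOf Y := by
  constructor
  · rintro ⟨w, hw⟩
    obtain ⟨W, hYW⟩ := hY.exists_right_inv
    have hv : v = Y.mulVec (W.mulVec v) := by
      rw [Matrix.mulVec_mulVec, hYW, Matrix.one_mulVec]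
    have h1 : piIncl R L ι v = (matIncl L Y).mulVec (piIncl R L ι (W.mulVec v)) := by
      conv_lhs => rw [hv]
      ext1 i
      rw [piIncl_apply, Matrix.mulVec, dotProduct, map_sum]
      refine Finset.sum_congr rfl fun j _ => ?_
      rw [map_mul]
      rfl
    rw [hw] at h1
    have h2 := mulVec_injective_of_isUnit (isUnit_matIncl hY) h1
    have h3 (i : ι) : ∃ f, psIncl R f = W.mulVec v i := by
      refine vanishBelow_zero_iff.1 fun n hn => ?_
      refine FaithfulSMul.algebraMap_injective R L ?_
      rw [← laurentMap_coeff, map_zero, ← piIncl_apply, ← congrFun h2 i]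
      exact vanishBelow_zero_iff.2 ⟨w i, rfl⟩ n hn
    choose f hf using h3
    exact ⟨f, hv.trans (congrArg Y.mulVec (funext fun i => (hf i).symm))⟩
  · rintro ⟨w, rfl⟩
    exact ⟨_, piIncl_mulVec Y w⟩

/-- A sub-shtuka is determined by its Tate module. -/
theorem eq_of_tateLattice_eq [IsSepClosed L] [FaithfulSMul R L] (hζ : algebraMap R L ζ ≠ 0)
    {N N' : P.SubShtuka} (n : Module.Basis ι R⟦X⟧ N.carrier)
    (n' : Module.Basis ι R⟦X⟧ N'.carrier) (hn : IsUnit (carrierMatrix b n))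
    (hn' : IsUnit (carrierMatrix b n')) (h : N.tateLattice L = N'.tateLattice L) : N = N' := by
  -- The columns of a fundamental matrix belong to the Tate module and generate the `L[[z]]`-lattice
  -- of `N`, so an inclusion of Tate modules passes to these lattices.
  have key {N N' : P.SubShtuka} (n : Module.Basis ι R⟦X⟧ N.carrier)
      (n' : Module.Basis ι R⟦X⟧ N'.carrier) (hn : IsUnit (carrierMatrix b n))
      (hn' : IsUnit (carrierMatrix b n')) (h : N.tateLattice L ≤ N'.tateLattice L) :
      latticeOf (matIncl L (carrierMatrix b n)) ≤ latticeOf (matIncl L (carrierMatrix b n')) := by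
    obtain ⟨Z, hZ, hAZ, hlat⟩ :=
      exists_fundamental_matrix_subShtuka b hζ N n (isUnit_matIncl hn)
    obtain ⟨z, hz⟩ := exists_basis_rationalTateModule b hζ hZ hAZ
    obtain ⟨U, hU⟩ : ∃ U : Matrix ι ι L⟦X⟧,
        Z = matIncl L (carrierMatrix b n') * U.map (psIncl L) := by
      refine exists_matrix_of_col_mem fun j => ?_
      rw [← hz, ← mem_tateLattice_iff b hζ N' n' (isUnit_matIncl hn')]
      refine h ((mem_tateLattice_iff b hζ N n (isUnit_matIncl hn) _).2 ?_)
      rw [hz, ← hlat]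
      exact col_mem_latticeOf Z j
    rw [← hlat, hU]
    exact latticeOf_mul_map _ U
  have hlat := le_antisymm (key n n' hn hn' h.le) (key n' n hn' hn h.ge)
  -- The carrier is recovered as the set of `R((z))`-points of its `L[[z]]`-lattice.
  refine N.ext_of_carrier N' (Submodule.ext fun x => ?_)
  rw [carrier_eq_comap b n, carrier_eq_comap b n', ← piIncl_mem_latticeOf_matIncl_iff (L := L) hn,
    ← piIncl_mem_latticeOf_matIncl_iff (L := L) hn', hlat]

/-- The Tate module is the `F[[z]]`-span of the columns of a fundamental matrix, which form an
`F((z))`-basis of the rational Tate module. -/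
theorem isLattice_tateLattice [IsSepClosed L] (hζ : algebraMap R L ζ ≠ 0) (N : P.SubShtuka)
    (n : Module.Basis ι R⟦X⟧ N.carrier) (hn : IsUnit (carrierMatrix b n)) :
    (N.tateLattice L).IsLattice F⸨X⸩ := by
  obtain ⟨Z, hZ, hAZ, hlat⟩ :=
    exists_fundamental_matrix_subShtuka (L := L) b hζ N n (isUnit_matIncl hn)
  obtain ⟨z, hz⟩ := exists_basis_rationalTateModule b hζ hZ hAZ
  have h : N.tateLattice L = Submodule.span F⟦X⟧ (Set.range z) := Submodule.ext fun v => by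
    rw [mem_tateLattice_iff b hζ N n (isUnit_matIncl hn), ← hlat,
      mem_span_iff_coords_mem_latticeOf b hζ hZ hAZ hz]
  refine ⟨h ▸ Submodule.fg_span (Set.finite_range z), ?_⟩
  rw [eq_top_iff, ← z.span_eq, h]
  exact Submodule.span_mono Submodule.subset_span

section Galois

variable {K : Type*} [Field K] [Algebra R K] [Algebra K L] [IsScalarTower R K L]
  [Algebra F K] [IsScalarTower F K L]

theorem coords_galoisRep (g : L ≃ₐ[K] L) (v : P.rationalTateModule L) :
    coords L b (P.galoisRep L K g v : L⸨X⸩ ⊗[R⟦X⟧] M) =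
      fun i => laurentMap (g : L →+* L) (coords L b (v : L⸨X⸩ ⊗[R⟦X⟧] M) i) :=
  coords_gal b g _

theorem tateLattice_mem_galoisStableLattices [IsSepClosed L] (hζ : algebraMap R L ζ ≠ 0)
    (N : P.SubShtuka) (n : Module.Basis ι R⟦X⟧ N.carrier) (hn : IsUnit (carrierMatrix b n)) :
    N.tateLattice L ∈ P.galoisStableLattices L K := by
  refine ⟨isLattice_tateLattice b hζ N n hn, fun g v hv => ?_⟩
  rw [mem_tateLattice_iff b hζ N n (isUnit_matIncl hn)] at hv ⊢
  rw [coords_galoisRep]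
  exact gal_mem_latticeOf_matIncl g _ _ hv

theorem gal_mem_latticeOf {Z : Matrix ι ι L⸨X⸩} (g : L ≃ₐ[K] L)
    (h : ∀ j, (fun i => laurentMap (g : L →+* L) (Z i j)) ∈ latticeOf Z)
    (v : ι → L⸨X⸩) (hv : v ∈ latticeOf Z) :
    (fun i => laurentMap (g : L →+* L) (v i)) ∈ latticeOf Z := by
  obtain ⟨w, rfl⟩ := hv
  obtain ⟨U, hU⟩ := exists_matrix_of_col_mem (Z := Z.map (laurentMap (g : L →+* L))) h
  rw [laurentMap_mulVec, hU]
  exact latticeOf_mul_map Z U ⟨_, rfl⟩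

/-- Every Galois-stable lattice is the Tate module of a sub-shtuka. -/
theorem exists_tateLattice_eq [IsDomain R] [IsDiscreteValuationRing R] [FaithfulSMul R L]
    [IsFractionRing R K] [IsGalois K L] [IsSepClosed L]
    (b : Module.Basis ι R⟦X⟧ M) (hζ : algebraMap R L ζ ≠ 0)
    {T : Submodule F⟦X⟧ (P.rationalTateModule L)} (hT : T ∈ P.galoisStableLattices L K) :
    ∃ (N : P.SubShtuka) (_ : Module.Basis ι R⟦X⟧ N.carrier), N.tateLattice L = T := by
  obtain ⟨κ, t, ht⟩ := exists_basis_of_isLattice (A := F⟦X⟧) (Q := F⸨X⸩)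
    (V := P.rationalTateModule L) T hT.1
  obtain ⟨e, Z, hZ, hAZ, hcol⟩ := isUnit_of_basis_rationalTateModule b hζ t
  have hmem (v : P.rationalTateModule L) :
      v ∈ T ↔ coords L b (v : L⸨X⸩ ⊗[R⟦X⟧] M) ∈ latticeOf Z := by
    rw [← mem_span_iff_coords_mem_latticeOf b hζ hZ hAZ (z := fun j => t (e.symm j)) hcol, ht,
      ← e.symm.surjective.range_comp]
    rfl
  -- Stability of the `L[[z]]`-lattice follows from that of `T`: it suffices to test the generating
  -- columns, which are elements of `T`.
  have hgal (g : L ≃ₐ[K] L) (v : ι → L⸨X⸩) (hv : v ∈ latticeOf Z) :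
      (fun i => laurentMap (g : L →+* L) (v i)) ∈ latticeOf Z := by
    refine gal_mem_latticeOf g (fun j => ?_) v hv
    have h1 := hT.2 g _ ((hmem _).2 ((hcol j).symm ▸ col_mem_latticeOf Z j))
    rw [hmem, coords_galoisRep, hcol] at h1
    exact h1
  obtain ⟨Y, hY, -, U, hU, hYU⟩ := exists_rational_basis (R := R) K Z hZ hgal
  obtain ⟨N, n, rfl⟩ := exists_subShtuka b hζ hY hAZ hU hYU
  -- `T` and the Tate module of `N` consist of the fixed vectors in one and the same
  -- `L[[z]]`-lattice, as `Y` and `Z` differ by `U ∈ GL(L[[z]])`.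
  refine ⟨N, n, Submodule.ext fun v => ?_⟩
  rw [mem_tateLattice_iff b hζ N n (isUnit_matIncl hY), hmem, ← latticeOf_mul_map_of_isUnit Z hU,
    ← hYU]
  rfl

end Galois

end Correspondence

end LocSht

/-- `R` is a complete discrete valuation ring with fraction field `K`, `L` is a separable closure of
`K`, and `P` is a local shtuka over `R` with underlying module `M`. -/
theorem mainTheorem7 {F : Type*} [Field F] [Fintype F]
    {R : Type*} [CommRing R] [IsDomain R] [IsDiscreteValuationRing R]
    [IsAdicComplete (IsLocalRing.maximalIdeal R) R] [Algebra F R]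
    (ζ : R) (hζ_ne : ζ ≠ 0) (hζ_mem : ζ ∈ IsLocalRing.maximalIdeal R)
    (K : Type*) [Field K] [Algebra R K] [IsFractionRing R K] [Algebra F K] [IsScalarTower F R K]
    (L : Type*) [Field L] [Algebra K L] [IsSepClosure K L]
    [Algebra R L] [IsScalarTower R K L]
    [Algebra F L] [IsScalarTower F R L] [IsScalarTower F K L]
    {M : Type*} [AddCommGroup M] [Module R⟦X⟧ M] (P : LocSht.LocalShtuka F ζ M) :
    Set.BijOn (fun N : P.SubShtuka => N.tateLattice L)
      {N : P.SubShtuka | N.IsFullRank} (P.galoisStableLattices L K) := by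
  have hsep : IsSepClosed L := IsSepClosure.sep_closed K
  have hgal : IsGalois K L := IsSepClosure.isGalois
  have hinj : Function.Injective (algebraMap R L) := by
    rw [IsScalarTower.algebraMap_eq R K L]
    exact (algebraMap K L).injective.comp (IsFractionRing.injective R K)
  have hfaith : FaithfulSMul R L := (faithfulSMul_iff_algebraMap_injective R L).2 hinj
  have hζ : algebraMap R L ζ ≠ 0 := (map_ne_zero_iff _ hinj).2 hζ_ne
  have hfree := P.free
  have hfin := P.finite
  let b := Module.finBasis R⟦X⟧ M
  have hbasis (N : P.SubShtuka) (hN : N.IsFullRank) : ∃ n : Module.Basis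
      (Fin (Module.finrank R⟦X⟧ M)) R⟦X⟧ N.carrier, IsUnit (LocSht.carrierMatrix b n) := by
    have hfree' := N.shtuka.free
    have hfin' := N.shtuka.finite
    exact ⟨_, LocSht.isUnit_carrierMatrix b hζ_ne hζ_mem hζ N
      (Module.finBasisOfFinrankEq R⟦X⟧ N.carrier hN)⟩
  refine ⟨fun N hN => ?_, fun N hN N' hN' h => ?_, fun T hT => ?_⟩
  · obtain ⟨n, hn⟩ := hbasis N hN
    exact LocSht.tateLattice_mem_galoisStableLattices b hζ N n hn
  · obtain ⟨n, hn⟩ := hbasis N hN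
    obtain ⟨n', hn'⟩ := hbasis N' hN'
    exact LocSht.eq_of_tateLattice_eq b hζ n n' hn hn' h
  · obtain ⟨N, n, hN⟩ := LocSht.exists_tateLattice_eq b hζ hT
    refine ⟨N, ?_, hN⟩
    exact (Module.finrank_eq_card_basis n).trans (Fintype.card_fin _)
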